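/- Let $M$ be a smooth (finite-dimensional, Hausdorff, second countable) manifold and let $L\subset TM\oplus T^*M$ be a Dirac structure, i.e. a smooth subbundle that is maximally isotropic for $\langle X+\alpha,Y+\beta\rangle_+=\frac12(\beta(X)+\alpha(Y))$ and whose sections are closed under the Courant bracket $$[X+\alpha,Y+\beta]=[X,Y]+\mathcal L_X\beta-\mathcal L_Y\alpha+\tfrac12 d(\alpha(Y)-\beta(X)).$$ Suppose that $(M,L)$ is reducible: the characteristic distribution $D_L=L\cap TM$ has constant rank and its foliation $\mathcal F$ is simple, i.e. the leaf space $N=M/\mathcal F$ is a smooth manifold and the projection $p:M\to N$ is a smooth surjective submersion whose fibres are the leaves of $\mathcal F$ (they are connected and $\ker dp=D_L$). Then there is a unique Poisson bivector $\pi$ on $N$ induced by $L$, i.e. such that for every $f\in C^\infty(N)$ there is a vector field $X_f$ on $M$ with $X_f+d(p^*f)\in\Gamma(L)$ and $X_f(p^*g)=p^*(\pi(df,dg))$ for all $g\in C^\infty(N)$. Write $\pi^\sharp:T^*N\to TN$ for the bundle map with $\beta(\pi^\sharp\alpha)=\pi(\alpha,\beta)$. Moreover: 1. $T^*N$, with anchor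 $\pi^\sharp$ and bracket $[\alpha,\beta]_\pi=\mathcal L_{\pi^\sharp\alpha}\beta-\mathcal L_{\pi^\sharp\beta}\alpha-d\pi(\alpha,\beta)$, is a Lie algebroid over $N$; and $L$, with anchor the projection to $TM$ and bracket the Courant bracket, is a Lie algebroid over $M$. 2. There is a Lie algebroid structure on the pullback $$p^{!!}T^*N=\{(X,\alpha)\in T_xM\oplus T^*_{p(x)}N:\ p_*X=\pi^\sharp\alpha,\ x\in M\}$$ whose anchor is $(X,\alpha)\mapsto X$ and whose bracket is given, for $f_i,g_j\in C^\infty(M)$ and $\alpha_i,\beta_j\in\Omega^1(N)$ (finite sums), by $$\Big[\big(X,\sum_i f_i\otimes\alpha_i\big),\big(Y,\sum_j g_j\otimes\beta_j\big)\Big]=\Big([X,Y],\ \sum_{i,j}f_ig_j\otimes[\alpha_i,\beta_j]_\pi+\sum_jX(g_j)\otimes\beta_j-\sum_iY(f_i)\otimes\alpha_i\Big)$$ whenever the two arguments are sections of $p^{!!}T^*N$, where $f\otimes\alpha$ denotes the section $x\mapsto f(x)\,\alpha_{p(x)}$ of $p^!T^*N$. 3. For every such structure (hence for the unique one), the map $(X,\alpha)\mapsto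 X+p^*\alpha$ is an isomorphism of Lie algebroids over $\mathrm{id}_M$ from $p^{!!}T^*N$ onto $L$. -/

import Mathlib

open Bundle VectorField
open scoped Manifold ContDiff Bundle Topology

noncomputable section

namespace DiracGeometry

/-! ### Smooth subbundles and Lie algebroids

All manifolds are finite-dimensional, real, smooth and without boundary, modelled on a normed
space `E` by `𝓘(ℝ, E)`. -/

section General

variable {E : Type*} [NormedAddCommGroup E] [NormedSpace ℝ E]
  {M : Type*} [TopologicalSpace M] [ChartedSpace E M] [IsManifold 𝓘(ℝ, E) ∞ M]

variable (E M) in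
/-- Smooth vector fields on `M`. -/
abbrev SmoothVectorField : Type _ :=
  Cₛ^∞⟮𝓘(ℝ, E); E, (TangentSpace 𝓘(ℝ, E) : M → Type _)⟯

/-- The derivative `X(h)` of a function `h` along a vector field `X`. -/
def lieD (X : ∀ x : M, TangentSpace 𝓘(ℝ, E) x) (h : M → ℝ) (x : M) : ℝ :=
  mfderiv 𝓘(ℝ, E) 𝓘(ℝ, ℝ) h x (X x)

variable {F : Type*} [NormedAddCommGroup F] [NormedSpace ℝ F]
  {V : M → Type*} [TopologicalSpace (TotalSpace F V)]
  [∀ x, AddCommGroup (V x)] [∀ x, Module ℝ (V x)] [∀ x, TopologicalSpace (V x)]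
  [FiberBundle F V] [VectorBundle ℝ F V]

variable (F) in
/-- A family `A x ⊆ V x` of subspaces of the fibres of a vector bundle `V → M` is a smooth
subbundle if near every point it is spanned by a smooth local frame. -/
def IsSmoothSubbundle (A : ∀ x : M, Submodule ℝ (V x)) : Prop :=
  ∀ x₀ : M, ∃ (k : ℕ) (s : Fin k → ∀ x : M, V x) (U : Set M), IsOpen U ∧ x₀ ∈ U ∧
    (∀ i, ContMDiffOn 𝓘(ℝ, E) (𝓘(ℝ, E).prod 𝓘(ℝ, F)) ∞
      (fun x => TotalSpace.mk' F x (s i x)) U) ∧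
    ∀ x ∈ U, LinearIndependent ℝ (fun i => s i x) ∧
      Submodule.span ℝ (Set.range fun i => s i x) = A x

variable (F) in
/-- The space `Γ(A)` of smooth sections of `V` with values in `A`. -/
def sections (A : ∀ x : M, Submodule ℝ (V x)) : Submodule ℝ Cₛ^∞⟮𝓘(ℝ, E); F, V⟯ where
  carrier := {σ | ∀ x, σ x ∈ A x}
  add_mem' hσ hτ x := (A x).add_mem (hσ x) (hτ x)
  zero_mem' x := (A x).zero_mem
  smul_mem' c _ hσ x := (A x).smul_mem c (hσ x)

/-- The value of a section of `A` at `x`, as an element of the fibre `A x`. -/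
def evalAt {A : ∀ x : M, Submodule ℝ (V x)} (σ : sections (E := E) F A) (x : M) : A x :=
  ⟨σ.1 x, σ.2 x⟩

variable (E F) in
/-- A Lie algebroid structure on a smooth subbundle `A` of a smooth vector bundle `V → M`
(take `A = ⊤` for a structure on `V` itself). -/
structure LieAlgebroid (A : ∀ x : M, Submodule ℝ (V x)) where
  isSubbundle : IsSmoothSubbundle (E := E) F A
  /-- The anchor `A → TM`. -/
  anchor : ∀ x : M, A x →ₗ[ℝ] TangentSpace 𝓘(ℝ, E) x
  anchor_smooth : ∀ σ : sections (E := E) F A,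
    ContMDiff 𝓘(ℝ, E) (𝓘(ℝ, E).prod 𝓘(ℝ, E)) ∞
      (fun x => TotalSpace.mk' E x (anchor x (evalAt σ x)) : M → TangentBundle 𝓘(ℝ, E) M)
  /-- The bracket on sections. -/
  bracket : sections (E := E) F A →ₗ[ℝ] sections (E := E) F A →ₗ[ℝ] sections (E := E) F A
  bracket_self : ∀ σ, bracket σ σ = 0
  jacobi : ∀ σ τ υ,
    bracket σ (bracket τ υ) + bracket τ (bracket υ σ) + bracket υ (bracket σ τ) = 0
  leibniz : ∀ (f : C^∞⟮𝓘(ℝ, E), M; ℝ⟯) (σ τ fτ : sections (E := E) F A),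
    (∀ x, evalAt fτ x = f x • evalAt τ x) → ∀ x,
      evalAt (bracket σ fτ) x =
        f x • evalAt (bracket σ τ) x + lieD (fun y => anchor y (evalAt σ y)) f x • evalAt τ x
  anchor_bracket : ∀ σ τ x, anchor x (evalAt (bracket σ τ) x) =
    mlieBracket 𝓘(ℝ, E) (fun y => anchor y (evalAt σ y)) (fun y => anchor y (evalAt τ y)) x

variable {F' : Type*} [NormedAddCommGroup F'] [NormedSpace ℝ F']
  {V' : M → Type*} [TopologicalSpace (TotalSpace F' V')]
  [∀ x, AddCommGroup (V' x)] [∀ x, Module ℝ (V' x)] [∀ x, TopologicalSpace (V' x)]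
  [FiberBundle F' V'] [VectorBundle ℝ F' V']

/-- An isomorphism of Lie algebroids over the identity of `M`: a smooth isomorphism of vector
bundles that intertwines the anchors and the brackets. -/
structure LieAlgebroid.Iso {A : ∀ x : M, Submodule ℝ (V x)} {B : ∀ x : M, Submodule ℝ (V' x)}
    (𝓐 : LieAlgebroid E F A) (𝓑 : LieAlgebroid E F' B) where
  /-- The linear isomorphisms between the fibres. -/
  toEquiv : ∀ x, A x ≃ₗ[ℝ] B x
  smooth : ∀ σ : sections (E := E) F A, ContMDiff 𝓘(ℝ, E) (𝓘(ℝ, E).prod 𝓘(ℝ, F')) ∞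
    (fun x => TotalSpace.mk' F' x (toEquiv x (evalAt σ x) : V' x))
  smooth_symm : ∀ τ : sections (E := E) F' B, ContMDiff 𝓘(ℝ, E) (𝓘(ℝ, E).prod 𝓘(ℝ, F)) ∞
    (fun x => TotalSpace.mk' F x ((toEquiv x).symm (evalAt τ x) : V x))
  anchor : ∀ x (v : A x), 𝓑.anchor x (toEquiv x v) = 𝓐.anchor x v
  bracket : ∀ (σ τ : sections (E := E) F A) (σ' τ' : sections (E := E) F' B),
    (∀ x, evalAt σ' x = toEquiv x (evalAt σ x)) → (∀ x, evalAt τ' x = toEquiv x (evalAt τ x)) →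
    ∀ x, evalAt (𝓑.bracket σ' τ') x = toEquiv x (evalAt (𝓐.bracket σ τ) x)

end General

/-! ### The pullback Lie algebroid -/

section Pullback

variable {E : Type*} [NormedAddCommGroup E] [NormedSpace ℝ E]
  {M : Type*} [TopologicalSpace M] [ChartedSpace E M] [IsManifold 𝓘(ℝ, E) ∞ M]
  {E' : Type*} [NormedAddCommGroup E'] [NormedSpace ℝ E']
  {N : Type*} [TopologicalSpace N] [ChartedSpace E' N] [IsManifold 𝓘(ℝ, E') ∞ N]
  {F : Type*} [NormedAddCommGroup F] [NormedSpace ℝ F]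
  {V : N → Type*} [TopologicalSpace (TotalSpace F V)]
  [∀ y, AddCommGroup (V y)] [∀ y, Module ℝ (V y)] [∀ y, TopologicalSpace (V y)]
  [FiberBundle F V] [VectorBundle ℝ F V]
  {A : ∀ y : N, Submodule ℝ (V y)}

instance pullbackFiberAddCommGroup (φ : C^∞⟮𝓘(ℝ, E), M; 𝓘(ℝ, E'), N⟯) (x : M) :
    AddCommGroup ((φ *ᵖ V) x) :=
  inferInstanceAs (AddCommGroup (V (φ x)))

variable (V) in
/-- The vector bundle `TM ⊕ φ^!V` over `M`. -/
abbrev TangentPullback (φ : C^∞⟮𝓘(ℝ, E), M; 𝓘(ℝ, E'), N⟯) (x : M) : Type _ :=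
  ((TangentSpace 𝓘(ℝ, E) : M → Type _) ×ᵇ (φ *ᵖ V)) x

/-- The family `φ^{!!}A = {(X, v) ∈ TM ⊕ φ^!A : a(v) = φ_* X}`. -/
def pullbackFiber (φ : C^∞⟮𝓘(ℝ, E), M; 𝓘(ℝ, E'), N⟯) (𝓐 : LieAlgebroid E' F A) (x : M) :
    Submodule ℝ (TangentPullback V φ x) where
  carrier := {w | ∃ h : (w.2 : V (φ x)) ∈ A (φ x),
    𝓐.anchor (φ x) ⟨w.2, h⟩ = mfderiv 𝓘(ℝ, E) 𝓘(ℝ, E') φ x w.1}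
  add_mem' := by
    rintro v w ⟨hv, hv'⟩ ⟨hw, hw'⟩
    refine ⟨(A (φ x)).add_mem hv hw, ?_⟩
    have h := congrArg₂ (· + ·) hv' hw'
    simp only [← map_add] at h
    exact h
  zero_mem' := by
    refine ⟨(A (φ x)).zero_mem, ?_⟩
    exact (map_zero (𝓐.anchor (φ x))).trans (map_zero (mfderiv 𝓘(ℝ, E) 𝓘(ℝ, E') φ x)).symm
  smul_mem' := by
    rintro c v ⟨hv, hv'⟩
    refine ⟨(A (φ x)).smul_mem c hv, ?_⟩
    have h := congrArg (c • ·) hv'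
    simp only [← map_smul] at h
    exact h

/-- `𝓑` is the pullback Lie algebroid structure on `φ^{!!}A`: the anchor is the first projection,
and the bracket of sections `(X, ∑ i, fᵢ ⊗ αᵢ)` and `(Y, ∑ j, gⱼ ⊗ βⱼ)` is
`([X, Y], ∑ i j, fᵢ gⱼ ⊗ [αᵢ, βⱼ] + ∑ j, X(gⱼ) ⊗ βⱼ - ∑ i, Y(fᵢ) ⊗ αᵢ)`, where `f ⊗ α` is the
section `x ↦ f x • α (φ x)` of `φ^!A`. -/
structure IsPullbackAlgebroid (φ : C^∞⟮𝓘(ℝ, E), M; 𝓘(ℝ, E'), N⟯) (𝓐 : LieAlgebroid E' F A)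
    (𝓑 : LieAlgebroid E (E × F) (pullbackFiber φ 𝓐)) : Prop where
  anchor : ∀ x (w : pullbackFiber φ 𝓐 x), 𝓑.anchor x w = w.1.1
  bracket : ∀ (σ τ : sections (E := E) (E × F) (pullbackFiber φ 𝓐)) (m n : ℕ)
    (f : Fin m → C^∞⟮𝓘(ℝ, E), M; ℝ⟯) (α : Fin m → sections (E := E') F A)
    (g : Fin n → C^∞⟮𝓘(ℝ, E), M; ℝ⟯) (β : Fin n → sections (E := E') F A),
    (∀ x, (σ.1 x).2 = ∑ i, f i x • (α i).1 (φ x)) →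
    (∀ x, (τ.1 x).2 = ∑ j, g j x • (β j).1 (φ x)) →
    ∀ x,
      ((𝓑.bracket σ τ).1 x).1 =
        mlieBracket 𝓘(ℝ, E) (fun y => (σ.1 y).1) (fun y => (τ.1 y).1) x ∧
      ((𝓑.bracket σ τ).1 x).2 =
        ∑ i, ∑ j, (f i x * g j x) • (𝓐.bracket (α i) (β j)).1 (φ x) +
          ∑ j, lieD (fun y => (σ.1 y).1) (g j) x • (β j).1 (φ x) -
          ∑ i, lieD (fun y => (τ.1 y).1) (f i) x • (α i).1 (φ x)

end Pullback

/-! ### Poisson and Dirac structures -/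

section Geometry

variable {E : Type*} [NormedAddCommGroup E] [NormedSpace ℝ E]
  {M : Type*} [TopologicalSpace M] [ChartedSpace E M] [IsManifold 𝓘(ℝ, E) ∞ M]

/-- The cotangent spaces `T*_x M`; as a family in `x` this is Mathlib's bundle of continuous
linear maps from `TM` to the trivial line bundle. -/
abbrev CotangentSpace (E : Type*) [NormedAddCommGroup E] [NormedSpace ℝ E]
    {M : Type*} [TopologicalSpace M] [ChartedSpace E M] (x : M) : Type _ :=
  TangentSpace 𝓘(ℝ, E) x →L[ℝ] Bundle.Trivial M ℝ x

variable (E M) in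
/-- Smooth 1-forms on `M`. -/
abbrev OneForm : Type _ :=
  Cₛ^∞⟮𝓘(ℝ, E); E →L[ℝ] ℝ, (CotangentSpace E : M → Type _)⟯

/-- The differential of a function. -/
def dForm (f : M → ℝ) (x : M) : CotangentSpace E x :=
  mfderiv 𝓘(ℝ, E) 𝓘(ℝ, ℝ) f x

/-- The value on a vector field `V` of the Lie derivative of the 1-form `β` along `X`:
`(L_X β)(V) = X(β(V)) - β([X, V])`. -/
def lieForm (X : ∀ x : M, TangentSpace 𝓘(ℝ, E) x) (β : ∀ x : M, CotangentSpace E x)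
    (V : ∀ x : M, TangentSpace 𝓘(ℝ, E) x) (x : M) : ℝ :=
  lieD X (fun y => β y (V y)) x - β x (mlieBracket 𝓘(ℝ, E) X V x)

variable (E M) in
/-- A Poisson bivector `π`, given by the bundle map `π^♯ : T*M → TM`, so that
`π(α, β) = β(π^♯ α)`. The Jacobi identity is that of the bracket `{f, g} = π(df, dg)`. -/
structure PoissonBivector where
  /-- The bundle map `π^♯`. -/
  sharp : ∀ x : M, CotangentSpace E x →ₗ[ℝ] TangentSpace 𝓘(ℝ, E) x
  skew : ∀ (x : M) (α β : CotangentSpace E x), β (sharp x α) = -α (sharp x β)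
  smooth : ∀ α : OneForm E M, ContMDiff 𝓘(ℝ, E) (𝓘(ℝ, E).prod 𝓘(ℝ, E)) ∞
    (fun x => TotalSpace.mk' E x (sharp x (α x)) : M → TangentBundle 𝓘(ℝ, E) M)
  jacobi : ∀ f g h : C^∞⟮𝓘(ℝ, E), M; ℝ⟯,
    let br : (M → ℝ) → (M → ℝ) → M → ℝ := fun u v x => dForm (E := E) v x (sharp x (dForm u x))
    ∀ x, br f (br g h) x + br g (br h f) x + br h (br f g) x = 0

/-- The Poisson bracket `{f, g} = π(df, dg)`. -/
def PoissonBivector.poissonBracket (P : PoissonBivector E M) (f g : M → ℝ) (x : M) : ℝ :=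
  dForm (E := E) g x (P.sharp x (dForm f x))

/-- `𝓒` is the Lie algebroid structure on `T*M` defined by `π`: the anchor is `π^♯` and the bracket
is `[α, β]_π = L_{π^♯ α} β - L_{π^♯ β} α - dπ(α, β)`. -/
structure IsCotangentAlgebroid (P : PoissonBivector E M)
    (𝓒 : LieAlgebroid E (E →L[ℝ] ℝ) (fun x : M => (⊤ : Submodule ℝ (CotangentSpace E x)))) :
    Prop where
  anchor : ∀ x α, 𝓒.anchor x α = P.sharp x α.1
  bracket : ∀ (α β : sections (E := E) (E →L[ℝ] ℝ)
      (fun x : M => (⊤ : Submodule ℝ (CotangentSpace E x))))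
    (V : SmoothVectorField E M) (x : M),
    (𝓒.bracket α β).1 x (V x) =
      lieForm (fun y => P.sharp y (α.1 y)) β.1 V x -
        lieForm (fun y => P.sharp y (β.1 y)) α.1 V x -
        lieD V (fun y => β.1 y (P.sharp y (α.1 y))) x

/-- The generalized tangent bundle `TM ⊕ T*M`. -/
abbrev GenTangent (E : Type*) [NormedAddCommGroup E] [NormedSpace ℝ E]
    {M : Type*} [TopologicalSpace M] [ChartedSpace E M] (x : M) : Type _ :=
  ((TangentSpace 𝓘(ℝ, E) : M → Type _) ×ᵇ (CotangentSpace E : M → Type _)) x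

variable (E M) in
/-- Smooth sections of the generalized tangent bundle. -/
abbrev GenSection : Type _ :=
  Cₛ^∞⟮𝓘(ℝ, E); E × (E →L[ℝ] ℝ), (GenTangent E : M → Type _)⟯

/-- The symmetric form `⟨X + α, Y + β⟩₊ = (β(X) + α(Y)) / 2`. -/
def pairing (x : M) (v w : GenTangent E x) : ℝ :=
  (1 / 2 : ℝ) * ((w.2 v.1 : ℝ) + (v.2 w.1 : ℝ))

/-- `υ` is the Courant bracket of `σ = X + α` and `τ = Y + β`:
`υ = [X, Y] + L_X β - L_Y α + d(α(Y) - β(X)) / 2`, the equality of 1-forms being tested on all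
smooth vector fields. -/
def IsCourantBracket (σ τ υ : GenSection E M) : Prop :=
  (∀ x, (υ x).1 = mlieBracket 𝓘(ℝ, E) (fun y => (σ y).1) (fun y => (τ y).1) x) ∧
  ∀ (V : SmoothVectorField E M) (x : M),
    (υ x).2 (V x) =
      lieForm (fun y => (σ y).1) (fun y => (τ y).2) V x -
        lieForm (fun y => (τ y).1) (fun y => (σ y).2) V x +
        (1 / 2 : ℝ) * lieD V (fun y => ((σ y).2 (τ y).1 : ℝ) - ((τ y).2 (σ y).1 : ℝ)) x

/-- A subspace of `T_x M ⊕ T*_x M` is isotropic if the symmetric form vanishes on it. -/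
def IsIsotropic (x : M) (K : Submodule ℝ (GenTangent E x)) : Prop :=
  ∀ v ∈ K, ∀ w ∈ K, pairing x v w = 0

/-- Dirac structures: integrable, maximally isotropic smooth subbundles of `TM ⊕ T*M`. -/
structure IsDirac (L : ∀ x : M, Submodule ℝ (GenTangent E x)) : Prop where
  isSubbundle : IsSmoothSubbundle (E := E) (E × (E →L[ℝ] ℝ)) L
  isotropic : ∀ x, IsIsotropic x (L x)
  maximal : ∀ x (K : Submodule ℝ (GenTangent E x)), IsIsotropic x K → L x ≤ K → K = L x
  integrable : ∀ σ ∈ sections (E := E) (E × (E →L[ℝ] ℝ)) L,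
    ∀ τ ∈ sections (E := E) (E × (E →L[ℝ] ℝ)) L,
    ∃ υ ∈ sections (E := E) (E × (E →L[ℝ] ℝ)) L, IsCourantBracket σ τ υ

/-- `𝓛` is the Lie algebroid structure on a Dirac structure `L`: the anchor is the projection to
`TM` and the bracket is the Courant bracket. -/
structure IsDiracAlgebroid {L : ∀ x : M, Submodule ℝ (GenTangent E x)}
    (𝓛 : LieAlgebroid E (E × (E →L[ℝ] ℝ)) L) : Prop where
  anchor : ∀ x (v : L x), 𝓛.anchor x v = v.1.1
  bracket : ∀ σ τ, IsCourantBracket σ.1 τ.1 (𝓛.bracket σ τ).1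

/-- The characteristic distribution `D_L = L ∩ TM`. -/
def charDistribution (L : ∀ x : M, Submodule ℝ (GenTangent E x)) (x : M) :
    Submodule ℝ (TangentSpace 𝓘(ℝ, E) x) where
  carrier := {X | ((X, 0) : GenTangent E x) ∈ L x}
  add_mem' := by
    intro X Y hX hY
    have h := (L x).add_mem hX hY
    have e : ((X, 0) : GenTangent E x) + ((Y, 0) : GenTangent E x) = (X + Y, 0) :=
      Prod.ext rfl (add_zero _)
    rw [e] at h
    exact h
  zero_mem' := (L x).zero_mem
  smul_mem' := by
    intro c X hX
    have h := (L x).smul_mem c hX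
    have e : c • ((X, 0) : GenTangent E x) = (c • X, 0) := Prod.ext rfl (smul_zero _)
    rw [e] at h
    exact h

variable {E' : Type*} [NormedAddCommGroup E'] [NormedSpace ℝ E']
  {N : Type*} [TopologicalSpace N] [ChartedSpace E' N] [IsManifold 𝓘(ℝ, E') ∞ N]

/-- `L` is reducible, with quotient projection `p : M → N = M/𝓕`: the characteristic distribution
is regular and its foliation `𝓕` is simple. That is, `p` is a submersion and its fibres are the
leaves of `𝓕`: they are nonempty, connected and tangent to `D_L`. -/
structure IsReducible (L : ∀ x : M, Submodule ℝ (GenTangent E x))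
    (p : C^∞⟮𝓘(ℝ, E), M; 𝓘(ℝ, E'), N⟯) : Prop where
  regular : ∃ k : ℕ, ∀ x, Module.finrank ℝ (charDistribution L x) = k
  submersion : Manifold.IsSubmersion 𝓘(ℝ, E) 𝓘(ℝ, E') ∞ p
  fibre_connected : ∀ y : N, IsConnected (p ⁻¹' {y})
  fibre_tangent : ∀ x : M,
    LinearMap.ker (mfderiv 𝓘(ℝ, E) 𝓘(ℝ, E') p x).toLinearMap = charDistribution L x

/-- `π` is the Poisson structure on `M/𝓕` induced by `L`: for every smooth `f` on `M/𝓕` there is a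
smooth vector field `X_f` with `X_f + d(p^*f) ∈ Γ(L)` and `X_f(p^*g) = p^*{f, g}` for all `g`. -/
def IsInducedPoisson (L : ∀ x : M, Submodule ℝ (GenTangent E x))
    (p : C^∞⟮𝓘(ℝ, E), M; 𝓘(ℝ, E'), N⟯) (P : PoissonBivector E' N) : Prop :=
  ∀ f : C^∞⟮𝓘(ℝ, E'), N; ℝ⟯, ∃ X : SmoothVectorField E M,
    (∀ x, ((X x, dForm (f ∘ p) x) : GenTangent E x) ∈ L x) ∧
    ∀ (g : C^∞⟮𝓘(ℝ, E'), N; ℝ⟯) (x : M), lieD X (g ∘ p) x = P.poissonBracket f g (p x)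

/-- The pullback `p^*α ∈ T*_x M` of a covector `α ∈ T*_{p x} N`. -/
def pullbackCovector (p : C^∞⟮𝓘(ℝ, E), M; 𝓘(ℝ, E'), N⟯) (x : M) (α : CotangentSpace E' (p x)) :
    CotangentSpace E x :=
  ContinuousLinearMap.comp (M₂ := TangentSpace 𝓘(ℝ, E') (p x)) α
    (mfderiv 𝓘(ℝ, E) 𝓘(ℝ, E') p x)

end Geometry

end DiracGeometry

end

noncomputable section

set_option linter.unusedSectionVars false

namespace DiracGeometry

section Toolkit

variable {E : Type*} [NormedAddCommGroup E] [NormedSpace ℝ E]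
  {M : Type*} [TopologicalSpace M] [ChartedSpace E M] [IsManifold 𝓘(ℝ, E) ∞ M]

/-! ### Derivatives of functions along vector fields -/

/-! Write D = ker dp = L ∩ TM. Maximality of L gives the pointwise duality pr_{T*M}(L) = ann(D), and
the covectors annihilating ker dp are exactly the pullbacks p^*ξ. So each 1-form α on N has a vector
field X with X + p^*α ∈ Γ(L), unique up to Γ(D) (`IsReducible.exists_vectorField`). For Z ∈ Γ(D) the
Courant bracket of Z and X + p^*α is [Z, X] + 0, so [Z, X] lies in D again
(`IsReducible.isRelated_lie_zero`). Hence X(p^*g) is constant on the connected fibres, and X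
projects to a field π^♯α on N. The outcome is the equivalence behind everything else
(`IsReducible.exists_sharp`): X + p^*ξ ∈ L iff p_*X = π^♯ξ, that is, L is the backward image of the
graph of π^♯. Isotropy of L makes π skew, and brackets of lifted sections make the graph involutive.

The algebroids come from one construction, for involutive isotropic subbundles that need not be
maximal, so that it serves both L and the graph of π^♯ ≅ T*N. On such a subbundle the Courant
bracket equals the Dorfman bracket [X, Y] + L_X β - i_Y dα, whose Jacobiator is the differential of
a function that vanishes by isotropy (`dorfmanForm_jacobi`). The Jacobi identity of π is read off
the graph as well.

By the equivalence, (X, α) ↦ X + p^*α is a bijection from p^{!!}T*N onto L. The algebroid structure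
of L is transported along it, and `dorfmanForm_of_combination` shows that the result obeys the
prescribed formula. Near a point every section is a finite combination of forms dgᵢ with function
coefficients, so the formula determines the bracket (`IsPullbackAlgebroid.bracket_eq`) and the
isomorphism holds for every structure obeying it. -/

theorem lieD_eq (X : ∀ x : M, TangentSpace 𝓘(ℝ, E) x) (f : M → ℝ) (x : M) :
    lieD X f x = mvfderiv 𝓘(ℝ, E) f x (X x) := rfl

theorem lieD_eq_dForm (X : ∀ x : M, TangentSpace 𝓘(ℝ, E) x) (f : M → ℝ) (x : M) :
    lieD X f x = dForm f x (X x) := rfl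

section
variable {X Y : ∀ x : M, TangentSpace 𝓘(ℝ, E) x} {f g : M → ℝ} {x : M}

theorem lieD_add (hf : MDifferentiableAt 𝓘(ℝ, E) 𝓘(ℝ, ℝ) f x)
    (hg : MDifferentiableAt 𝓘(ℝ, E) 𝓘(ℝ, ℝ) g x) :
    lieD X (fun y => f y + g y) x = lieD X f x + lieD X g x := by
  simp only [lieD_eq]
  rw [mvfderiv_fun_add hf hg]; rfl

theorem lieD_mul (hf : MDifferentiableAt 𝓘(ℝ, E) 𝓘(ℝ, ℝ) f x)
    (hg : MDifferentiableAt 𝓘(ℝ, E) 𝓘(ℝ, ℝ) g x) :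
    lieD X (fun y => f y * g y) x = lieD X f x * g x + f x * lieD X g x := by
  simp only [lieD_eq]
  rw [mvfderiv_fun_mul hf hg, add_comm, mul_comm _ (g x)]; rfl

theorem lieD_const (c : ℝ) : lieD X (fun _ => c) x = 0 := by
  rw [lieD_eq, mvfderiv_const]; rfl

theorem lieD_const_mul (c : ℝ) (hf : MDifferentiableAt 𝓘(ℝ, E) 𝓘(ℝ, ℝ) f x) :
    lieD X (fun y => c * f y) x = c * lieD X f x := by
  rw [lieD_mul mdifferentiableAt_const hf, lieD_const, zero_mul, zero_add]

theorem lieD_sum {ι : Type*} (s : Finset ι) {f : ι → M → ℝ}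
    (hf : ∀ i, MDifferentiableAt 𝓘(ℝ, E) 𝓘(ℝ, ℝ) (f i) x) :
    lieD X (fun y => ∑ i ∈ s, f i y) x = ∑ i ∈ s, lieD X (f i) x := by
  classical
  have key : MDifferentiableAt 𝓘(ℝ, E) 𝓘(ℝ, ℝ) (fun y => ∑ i ∈ s, f i y) x ∧
      lieD X (fun y => ∑ i ∈ s, f i y) x = ∑ i ∈ s, lieD X (f i) x := by
    induction s using Finset.induction_on with
    | empty => simpa using ⟨mdifferentiableAt_const, lieD_const (X := X) (x := x) 0⟩
    | insert a s ha ih =>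
      simp only [Finset.sum_insert ha]
      exact ⟨(hf a).add ih.1, by rw [lieD_add (hf a) ih.1, ih.2]⟩
  exact key.2

theorem lieD_congr (h : f =ᶠ[𝓝 x] g) : lieD X f x = lieD X g x := by
  unfold lieD
  rw [h.mfderiv_eq]
  rfl

theorem lieD_vec_add (f : M → ℝ) (x : M) :
    lieD (fun y => X y + Y y) f x = lieD X f x + lieD Y f x := by
  simp only [lieD_eq, map_add]

theorem lieD_vec_smul (c : M → ℝ) (f : M → ℝ) (x : M) :
    lieD (fun y => c y • X y) f x = c x * lieD X f x := by
  simp only [lieD_eq, map_smul, smul_eq_mul]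

end

/-- Y(f) is the fibre component of the tangent map of f composed with Y. -/
theorem contMDiffAt_lieD {Y : ∀ x : M, TangentSpace 𝓘(ℝ, E) x} {x : M}
    (hY : ContMDiffAt 𝓘(ℝ, E) (𝓘(ℝ, E).prod 𝓘(ℝ, E)) ∞
      (fun x => TotalSpace.mk' E x (Y x) : M → TangentBundle 𝓘(ℝ, E) M) x)
    {f : M → ℝ} (hf : ContMDiff 𝓘(ℝ, E) 𝓘(ℝ, ℝ) ∞ f) :
    ContMDiffAt 𝓘(ℝ, E) 𝓘(ℝ, ℝ) ∞ (lieD Y f) x := by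
  have h1 : ContMDiff 𝓘(ℝ, E).tangent 𝓘(ℝ, ℝ).tangent ∞ (tangentMap 𝓘(ℝ, E) 𝓘(ℝ, ℝ) f) :=
    hf.contMDiff_tangentMap (by simp)
  have h2 := (contMDiff_snd_tangentBundle_modelSpace ℝ 𝓘(ℝ, ℝ) (n := ∞)).comp h1
  exact h2.contMDiffAt.comp x hY

/-! ### Bump functions and global extensions -/

theorem exists_bump [FiniteDimensional ℝ E] [T2Space M] {x₀ : M} {U : Set M} (hU : U ∈ 𝓝 x₀) :
    ∃ χ : C^∞⟮𝓘(ℝ, E), M; ℝ⟯, (∀ᶠ x in 𝓝 x₀, χ x = 1) ∧ tsupport χ ⊆ U := by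
  obtain ⟨f, -, hf⟩ := (SmoothBumpFunction.nhds_basis_tsupport (I := 𝓘(ℝ, E)) x₀).mem_iff.1 hU
  exact ⟨⟨f, f.contMDiff⟩, f.eventuallyEq_one, hf⟩

section Extend

variable {F : Type*} [NormedAddCommGroup F] [NormedSpace ℝ F]
  {V : M → Type*} [TopologicalSpace (TotalSpace F V)]
  [∀ x, AddCommGroup (V x)] [∀ x, Module ℝ (V x)] [∀ x, TopologicalSpace (V x)]
  [FiberBundle F V] [VectorBundle ℝ F V]

/-- Cutting off by a bump function makes local sections global without changing their germ. All
later calculus therefore uses global sections only. -/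
theorem exists_section_eventuallyEq [FiniteDimensional ℝ E] [T2Space M] {x₀ : M} {U : Set M}
    (hU : IsOpen U) (hx₀ : x₀ ∈ U) {s : ∀ x, V x}
    (hs : ContMDiffOn 𝓘(ℝ, E) (𝓘(ℝ, E).prod 𝓘(ℝ, F)) ∞ (fun x => TotalSpace.mk' F x (s x)) U) :
    ∃ σ : Cₛ^∞⟮𝓘(ℝ, E); F, V⟯, ∀ᶠ x in 𝓝 x₀, σ x = s x := by
  obtain ⟨χ, h1, h2⟩ := exists_bump (E := E) (hU.mem_nhds hx₀)
  refine ⟨⟨fun x => χ x • s x, ?_⟩, ?_⟩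
  · exact ContMDiffOn.smul_section_of_tsupport χ.contMDiff.contMDiffOn hU h2 hs
  · filter_upwards [h1] with x hx
    change χ x • s x = s x
    rw [hx, one_smul]

end Extend

theorem exists_vectorField_eq [FiniteDimensional ℝ E] [T2Space M] (x₀ : M)
    (v : TangentSpace 𝓘(ℝ, E) x₀) : ∃ V : SmoothVectorField E M, V x₀ = v := by
  obtain ⟨s, hs, h⟩ := FiberBundle.exists_contMDiffOn_extend (k := ∞) 𝓘(ℝ, E) E v
  obtain ⟨U, hUs, hU, hx⟩ := mem_nhds_iff.1 hs
  obtain ⟨σ, hσ⟩ := exists_section_eventuallyEq hU hx (h.mono hUs)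
  refine ⟨σ, hσ.self_of_nhds.trans ?_⟩
  simp

/-! ### The Lie algebra of vector fields -/

/-- Over ℝ, `minSmoothness ℝ n` is n. These are the regularity instances required by the Lie bracket
of vector fields. -/
theorem isManifold_minSmoothness_two : IsManifold 𝓘(ℝ, E) (minSmoothness ℝ 2) M := by
  rw [minSmoothness_of_isRCLikeNormedField]; infer_instance

theorem isManifold_minSmoothness_three : IsManifold 𝓘(ℝ, E) (minSmoothness ℝ 3) M := by
  rw [minSmoothness_of_isRCLikeNormedField]; infer_instance

attribute [local instance] isManifold_minSmoothness_two isManifold_minSmoothness_three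

theorem contMDiff_mlieBracket [CompleteSpace E] (X Y : SmoothVectorField E M) :
    ContMDiff 𝓘(ℝ, E) (𝓘(ℝ, E).prod 𝓘(ℝ, E)) ∞
      (fun x => TotalSpace.mk' E x (mlieBracket 𝓘(ℝ, E) X Y x) : M → TangentBundle 𝓘(ℝ, E) M) := by
  intro x
  have : IsManifold 𝓘(ℝ, E) (((⊤ : ℕ∞) : WithTop ℕ∞) + 1) M := inferInstanceAs (IsManifold _ ∞ M)
  exact ContMDiffAt.mlieBracket_vectorField (n := ⊤) (m := ⊤) (X.contMDiff x) (Y.contMDiff x)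
    (by simp)

theorem SmoothVectorField.mdifferentiableAt (X : SmoothVectorField E M) (x : M) :
    MDifferentiableAt 𝓘(ℝ, E) (𝓘(ℝ, E).prod 𝓘(ℝ, E))
      (fun x => TotalSpace.mk' E x (X x) : M → TangentBundle 𝓘(ℝ, E) M) x :=
  (X.contMDiff x).mdifferentiableAt (by simp)

theorem mlieBracket_smul_right_apply [CompleteSpace E] {f : M → ℝ}
    {V W : ∀ x : M, TangentSpace 𝓘(ℝ, E) x} {x : M}
    (hf : MDifferentiableAt 𝓘(ℝ, E) 𝓘(ℝ, ℝ) f x)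
    (hW : MDifferentiableAt 𝓘(ℝ, E) (𝓘(ℝ, E).prod 𝓘(ℝ, E))
      (fun x => TotalSpace.mk' E x (W x) : M → TangentBundle 𝓘(ℝ, E) M) x) :
    mlieBracket 𝓘(ℝ, E) V (fun y => f y • W y) x =
      lieD V f x • W x + f x • mlieBracket 𝓘(ℝ, E) V W x :=
  mlieBracket_smul_right hf hW

theorem smooth_mdifferentiableAt (f : C^∞⟮𝓘(ℝ, E), M; ℝ⟯) (x : M) :
    MDifferentiableAt 𝓘(ℝ, E) 𝓘(ℝ, ℝ) f x :=
  (f.contMDiff x).mdifferentiableAt (by simp)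

/-- The derivative of a smooth function along a smooth vector field, as a smooth function. -/
def lieDer (X : SmoothVectorField E M) (f : C^∞⟮𝓘(ℝ, E), M; ℝ⟯) : C^∞⟮𝓘(ℝ, E), M; ℝ⟯ :=
  ⟨lieD X f, fun x => contMDiffAt_lieD (X.contMDiff x) f.contMDiff⟩

/-- The product of a smooth function and a smooth vector field. -/
def smulVF (f : C^∞⟮𝓘(ℝ, E), M; ℝ⟯) (X : SmoothVectorField E M) : SmoothVectorField E M :=
  ⟨fun x => f x • X x, f.contMDiff.smul_section X.contMDiff⟩

section LieRing

variable [FiniteDimensional ℝ E]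

instance : Bracket (SmoothVectorField E M) (SmoothVectorField E M) :=
  ⟨fun X Y => ⟨mlieBracket 𝓘(ℝ, E) X Y,
    haveI := FiniteDimensional.complete ℝ E; contMDiff_mlieBracket X Y⟩⟩

instance : LieRing (SmoothVectorField E M) where
  add_lie X Y Z := by
    have := FiniteDimensional.complete ℝ E
    ext x
    exact mlieBracket_add_left (X.mdifferentiableAt x) (Y.mdifferentiableAt x)
  lie_add X Y Z := by
    have := FiniteDimensional.complete ℝ E
    ext x
    exact mlieBracket_add_right (Y.mdifferentiableAt x) (Z.mdifferentiableAt x)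
  lie_self X := by
    ext x
    exact congrFun (mlieBracket_self (V := X)) x
  leibniz_lie X Y Z := by
    have := FiniteDimensional.complete ℝ E
    ext x
    have hle : minSmoothness ℝ 2 ≤ ∞ := by
      rw [minSmoothness_of_isRCLikeNormedField]; exact WithTop.coe_le_coe.2 le_top
    exact leibniz_identity_mlieBracket_apply
      ((X.contMDiff x).of_le hle) ((Y.contMDiff x).of_le hle)
      ((Z.contMDiff x).of_le hle)

theorem lie_smulVF (X Y : SmoothVectorField E M) (f : C^∞⟮𝓘(ℝ, E), M; ℝ⟯) :
    ⁅X, smulVF f Y⁆ = smulVF (lieDer X f) Y + smulVF f ⁅X, Y⁆ := by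
  have := FiniteDimensional.complete ℝ E
  ext x
  exact mlieBracket_smul_right_apply (smooth_mdifferentiableAt f x) (Y.mdifferentiableAt x)

variable [T2Space M]

/-- The action on functions is recovered from the Jacobi identity: expand [X, [Y, fZ]] = [[X, Y],
fZ] + [Y, [X, fZ]] by the Leibniz rule for a field Z with Z(x) ≠ 0, and compare the multiples of
Z(x) that remain. If the tangent space is zero, every derivative vanishes. -/
theorem lieD_mlieBracket (X Y : SmoothVectorField E M) (f : C^∞⟮𝓘(ℝ, E), M; ℝ⟯) (x : M) :
    lieD (mlieBracket 𝓘(ℝ, E) X Y) f x = lieD X (lieD Y f) x - lieD Y (lieD X f) x := by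
  rcases subsingleton_or_nontrivial (TangentSpace 𝓘(ℝ, E) x) with hs | hs
  · have h : ∀ (Z : ∀ x : M, TangentSpace 𝓘(ℝ, E) x) (h : M → ℝ), lieD Z h x = 0 := fun Z h => by
      rw [lieD_eq, Subsingleton.elim (Z x) 0, map_zero]
    simp [h]
  · obtain ⟨v, hv⟩ := exists_ne (0 : TangentSpace 𝓘(ℝ, E) x)
    obtain ⟨Z, rfl⟩ := exists_vectorField_eq x v
    have h := leibniz_lie X Y (smulVF f Z)
    simp only [lie_smulVF, lie_add] at h
    have h' := congrArg (fun W : SmoothVectorField E M => W x) h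
    rw [leibniz_lie X Y Z] at h'
    have key : lieD X (lieD Y f) x • Z x =
        lieD (mlieBracket 𝓘(ℝ, E) X Y) f x • Z x + lieD Y (lieD X f) x • Z x := by
      change (lieD X (lieD Y f) x • Z x + lieD Y f x • ⁅X, Z⁆ x) +
        (lieD X f x • ⁅Y, Z⁆ x + f x • (⁅⁅X, Y⁆, Z⁆ x + ⁅Y, ⁅X, Z⁆⁆ x)) =
        (lieD (mlieBracket 𝓘(ℝ, E) X Y) f x • Z x + f x • ⁅⁅X, Y⁆, Z⁆ x) +
        ((lieD Y (lieD X f) x • Z x + lieD X f x • ⁅Y, Z⁆ x) +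
          (lieD Y f x • ⁅X, Z⁆ x + f x • ⁅Y, ⁅X, Z⁆⁆ x)) at h'
      rw [smul_add] at h'
      have e := sub_eq_zero.2 h'
      rw [← sub_eq_zero, ← e]
      abel
    rw [← add_smul] at key
    linarith [smul_left_injective ℝ hv key]

instance : LieRingModule (SmoothVectorField E M) C^∞⟮𝓘(ℝ, E), M; ℝ⟯ where
  bracket := lieDer
  add_lie X Y f := by
    ext x
    exact lieD_vec_add (X := X) (Y := Y) f x
  lie_add X f g := by
    ext x
    exact lieD_add (smooth_mdifferentiableAt f x) (smooth_mdifferentiableAt g x)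
  leibniz_lie X Y f := by
    ext x
    change lieD X (lieD Y f) x = lieD (mlieBracket 𝓘(ℝ, E) X Y) f x + lieD Y (lieD X f) x
    rw [lieD_mlieBracket, sub_add_cancel]

end LieRing

end Toolkit

section Toolkit

variable {E : Type*} [NormedAddCommGroup E] [NormedSpace ℝ E]
  {M : Type*} [TopologicalSpace M] [ChartedSpace E M] [IsManifold 𝓘(ℝ, E) ∞ M]

/-! ### Coordinate frames and smoothness tests -/

theorem exists_function_eventuallyEq [FiniteDimensional ℝ E] [T2Space M] {x₀ : M} {U : Set M}
    (hU : IsOpen U) (hx₀ : x₀ ∈ U) {f : M → ℝ} (hf : ContMDiffOn 𝓘(ℝ, E) 𝓘(ℝ, ℝ) ∞ f U) :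
    ∃ g : C^∞⟮𝓘(ℝ, E), M; ℝ⟯, ∀ᶠ x in 𝓝 x₀, g x = f x := by
  obtain ⟨χ, h1, h2⟩ := exists_bump (E := E) (hU.mem_nhds hx₀)
  refine ⟨⟨fun x => χ x * f x, ?_⟩, ?_⟩
  · refine contMDiff_of_contMDiffOn_union_of_isOpen (χ.contMDiff.contMDiffOn.mul hf) ?_ ?_ hU
      (isOpen_compl_iff.mpr <| isClosed_tsupport χ)
    · refine (contMDiffOn_const (c := (0 : ℝ))).congr fun x hx => ?_
      rw [image_eq_zero_of_notMem_tsupport hx, zero_mul]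
    · exact Set.eq_univ_of_forall fun x =>
        (em (x ∈ tsupport χ)).imp (fun h => h2 h) id
  · filter_upwards [h1] with x hx
    change χ x * f x = f x
    rw [hx, one_mul]

theorem exists_vectorField_symmL [FiniteDimensional ℝ E] [T2Space M] (x₀ : M) (u : E) :
    ∃ V : SmoothVectorField E M, ∀ᶠ x in 𝓝 x₀,
      V x = (trivializationAt E (TangentSpace 𝓘(ℝ, E) : M → Type _) x₀).symmL ℝ x u := by
  let e := trivializationAt E (TangentSpace 𝓘(ℝ, E) : M → Type _) x₀
  have hx₀ : x₀ ∈ e.baseSet := FiberBundle.mem_baseSet_trivializationAt' x₀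
  have hs : ContMDiffOn 𝓘(ℝ, E) (𝓘(ℝ, E).prod 𝓘(ℝ, E)) ∞
      (fun x => TotalSpace.mk' E x (e.symmL ℝ x u) : M → TangentBundle 𝓘(ℝ, E) M) e.baseSet := by
    intro x hx
    rw [e.contMDiffWithinAt_section _ hx]
    refine (contMDiffWithinAt_const (c := u)).congr (fun y hy => ?_) ?_
    · rw [e.symmL_apply hy, e.mk_symm hy, e.apply_symm_apply (by simpa [e.target_eq] using hy)]
    · rw [e.symmL_apply hx, e.mk_symm hx, e.apply_symm_apply (by simpa [e.target_eq] using hx)]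
  exact exists_section_eventuallyEq e.open_baseSet hx₀ hs

/-- The `g i` are chart coordinates and the `V i` the coordinate fields, both cut off to be global.
Completeness and duality of the two families hold only near `x₀`. -/
theorem exists_coordinate_frame [FiniteDimensional ℝ E] [T2Space M] (x₀ : M) :
    ∃ (g : Fin (Module.finrank ℝ E) → C^∞⟮𝓘(ℝ, E), M; ℝ⟯)
      (V : Fin (Module.finrank ℝ E) → SmoothVectorField E M),
      ∀ᶠ x in 𝓝 x₀, (∀ v : TangentSpace 𝓘(ℝ, E) x, ∑ i, (dForm (g i) x v : ℝ) • V i x = v) ∧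
        ∀ i j, (dForm (g i) x (V j x) : ℝ) = if i = j then 1 else 0 := by
  classical
  let b := Module.finBasis ℝ E
  let e := trivializationAt E (TangentSpace 𝓘(ℝ, E) : M → Type _) x₀
  have hx₀ : x₀ ∈ e.baseSet := FiberBundle.mem_baseSet_trivializationAt' x₀
  have hV := fun i => exists_vectorField_symmL (E := E) x₀ (b i)
  choose V hV using hV
  have hg : ∀ i, ∃ g : C^∞⟮𝓘(ℝ, E), M; ℝ⟯, ∀ᶠ x in 𝓝 x₀, ∀ v : TangentSpace 𝓘(ℝ, E) x,
      (dForm g x v : ℝ) = b.coord i (e.continuousLinearMapAt ℝ x v) := by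
    intro i
    have hs : ContMDiffOn 𝓘(ℝ, E) 𝓘(ℝ, ℝ) ∞
        ((b.coord i).toContinuousLinearMap ∘ extChartAt 𝓘(ℝ, E) x₀) e.baseSet :=
      (ContinuousLinearMap.contMDiff _).comp_contMDiffOn
        (contMDiffOn_extChartAt (I := 𝓘(ℝ, E)) (n := ∞) (x := x₀))
    obtain ⟨g, hg⟩ := exists_function_eventuallyEq e.open_baseSet hx₀ hs
    refine ⟨g, ?_⟩
    filter_upwards [eventually_eventually_nhds.2 hg, e.open_baseSet.mem_nhds hx₀] with x hx hxe v
    have hmd : MDifferentiableAt 𝓘(ℝ, E) 𝓘(ℝ, E) (extChartAt 𝓘(ℝ, E) x₀) x :=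
      (contMDiffAt_extChartAt' (n := ∞) hxe).mdifferentiableAt (by simp)
    have hx' : g =ᶠ[𝓝 x] ((b.coord i).toContinuousLinearMap ∘ extChartAt 𝓘(ℝ, E) x₀) := hx
    unfold dForm
    -- The tangent trivialization at `x₀` is the derivative of the chart at `x₀`, so the
    -- differential of a chart coordinate is a coordinate of the trivialization.
    rw [hx'.mfderiv_eq, TangentBundle.continuousLinearMapAt_trivializationAt hxe, mfderiv_comp x
      (ContinuousLinearMap.contMDiff (n := ∞) _ |>.mdifferentiableAt (by simp)) hmd,
      ContinuousLinearMap.mfderiv_eq]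
    rfl
  choose g hg using hg
  refine ⟨g, V, ?_⟩
  filter_upwards [Filter.eventually_all.2 hg, Filter.eventually_all.2 hV,
    e.open_baseSet.mem_nhds hx₀] with x hx hVx hxe
  constructor
  · intro v
    simp only [hx, hVx]
    rw [← e.symmL_continuousLinearMapAt (R := ℝ) hxe v]
    simp only [← map_smul, ← map_sum, e.continuousLinearMapAt_symmL hxe]
    congr 1
    exact b.sum_repr _
  · intro i j
    rw [hx, hVx, e.continuousLinearMapAt_symmL hxe]
    simp [Finsupp.single_apply, eq_comm]

theorem tangent_ext [FiniteDimensional ℝ E] [T2Space M] {x : M} {v w : TangentSpace 𝓘(ℝ, E) x}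
    (h : ∀ g : C^∞⟮𝓘(ℝ, E), M; ℝ⟯, (dForm g x v : ℝ) = dForm g x w) : v = w := by
  obtain ⟨g, V, hgV⟩ := exists_coordinate_frame (E := E) x
  rw [← hgV.self_of_nhds.1 v, ← hgV.self_of_nhds.1 w]
  simp only [h]

theorem covector_apply_eq_sum {x : M} (ξ : CotangentSpace E x) {ι : Type*} [Fintype ι]
    (c : ι → ℝ) (v : ι → TangentSpace 𝓘(ℝ, E) x) :
    (ξ (∑ i, c i • v i) : ℝ) = ∑ i, c i * (ξ (v i) : ℝ) := by
  rw [map_sum]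
  refine Finset.sum_congr rfl fun i _ => ?_
  rw [map_smul]
  rfl

theorem sum_covector_apply {x : M} {ι : Type*} [Fintype ι]
    (c : ι → ℝ) (ξ : ι → CotangentSpace E x) (v : TangentSpace 𝓘(ℝ, E) x) :
    ((∑ i, c i • ξ i) v : ℝ) = ∑ i, c i * (ξ i v : ℝ) := by
  rw [sum_apply]
  rfl

theorem covector_ext {x : M} {ξ η : CotangentSpace E x}
    (h : ∀ v : TangentSpace 𝓘(ℝ, E) x, (ξ v : ℝ) = η v) : ξ = η :=
  ContinuousLinearMap.ext h

theorem covector_ext_vectorField [FiniteDimensional ℝ E] [T2Space M] {x : M}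
    {ξ η : CotangentSpace E x} (h : ∀ V : SmoothVectorField E M, (ξ (V x) : ℝ) = η (V x)) :
    ξ = η :=
  covector_ext fun v => by
    obtain ⟨V, rfl⟩ := exists_vectorField_eq x v
    exact h V

/-- A combination of the coordinate functions with constant coefficients realizes any single
covector. -/
theorem exists_function_dForm_eq [FiniteDimensional ℝ E] [T2Space M] (x : M)
    (ξ : CotangentSpace E x) : ∃ f : C^∞⟮𝓘(ℝ, E), M; ℝ⟯, dForm f x = ξ := by
  obtain ⟨g, V, hgV⟩ := exists_coordinate_frame (E := E) x
  let f : C^∞⟮𝓘(ℝ, E), M; ℝ⟯ := ⟨fun y => ∑ i, (ξ (V i x) : ℝ) * g i y,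
    ContMDiff.sum fun i _ => contMDiff_const.mul (g i).contMDiff⟩
  refine ⟨f, covector_ext_vectorField fun W => ?_⟩
  have h1 : (dForm f x (W x) : ℝ) = ∑ i, (ξ (V i x) : ℝ) * (dForm (g i) x (W x) : ℝ) := by
    have := lieD_sum (X := W) (x := x) Finset.univ (f := fun i y => (ξ (V i x) : ℝ) * g i y)
      fun i => mdifferentiableAt_const.mul (smooth_mdifferentiableAt (g i) x)
    refine this.trans (Finset.sum_congr rfl fun i _ => ?_)
    exact lieD_const_mul _ (smooth_mdifferentiableAt (g i) x)
  rw [h1]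
  conv_rhs => rw [← hgV.self_of_nhds.1 (W x), covector_apply_eq_sum]
  exact Finset.sum_congr rfl fun i _ => mul_comm _ _

/-- The coefficients of Y in a coordinate frame are the functions Y(gᵢ). -/
theorem contMDiffAt_vectorField_of_test [FiniteDimensional ℝ E] [T2Space M]
    {Y : ∀ x : M, TangentSpace 𝓘(ℝ, E) x} {x₀ : M}
    (h : ∀ g : C^∞⟮𝓘(ℝ, E), M; ℝ⟯, ContMDiffAt 𝓘(ℝ, E) 𝓘(ℝ, ℝ) ∞ (lieD Y g) x₀) :
    ContMDiffAt 𝓘(ℝ, E) (𝓘(ℝ, E).prod 𝓘(ℝ, E)) ∞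
      (fun x => TotalSpace.mk' E x (Y x) : M → TangentBundle 𝓘(ℝ, E) M) x₀ := by
  obtain ⟨g, V, hgV⟩ := exists_coordinate_frame (E := E) x₀
  have h1 : ContMDiffAt 𝓘(ℝ, E) (𝓘(ℝ, E).prod 𝓘(ℝ, E)) ∞
      (fun x => TotalSpace.mk' E x (∑ i, lieD Y (g i) x • V i x) :
        M → TangentBundle 𝓘(ℝ, E) M) x₀ :=
    ContMDiffAt.sum_section fun i _ => (h (g i)).smul_section ((V i).contMDiff x₀)
  refine h1.congr_of_eventuallyEq ?_
  filter_upwards [hgV] with x hx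
  rw [← hx.1 (Y x)]
  simp only [lieD_eq_dForm, hx.1 (Y x)]

theorem contMDiffAt_covector_apply {ξ : ∀ x : M, CotangentSpace E x}
    {X : ∀ x : M, TangentSpace 𝓘(ℝ, E) x} {x₀ : M}
    (hξ : ContMDiffAt 𝓘(ℝ, E) (𝓘(ℝ, E).prod 𝓘(ℝ, E →L[ℝ] ℝ)) ∞
      (fun x => TotalSpace.mk' (E →L[ℝ] ℝ) x (ξ x)) x₀)
    (hX : ContMDiffAt 𝓘(ℝ, E) (𝓘(ℝ, E).prod 𝓘(ℝ, E)) ∞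
      (fun x => TotalSpace.mk' E x (X x) : M → TangentBundle 𝓘(ℝ, E) M) x₀) :
    ContMDiffAt 𝓘(ℝ, E) 𝓘(ℝ, ℝ) ∞ (fun x => (ξ x (X x) : ℝ)) x₀ := by
  have h := ContMDiffAt.clm_bundle_apply (E₂ := Bundle.Trivial M ℝ) (F₂ := ℝ) hξ hX
  exact ((contMDiffAt_section x₀).1 h)

theorem contMDiffAt_oneForm_of_test [FiniteDimensional ℝ E] [T2Space M]
    {ξ : ∀ x : M, CotangentSpace E x} {x₀ : M}
    (h : ∀ V : SmoothVectorField E M,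
      ContMDiffAt 𝓘(ℝ, E) 𝓘(ℝ, ℝ) ∞ (fun x => (ξ x (V x) : ℝ)) x₀) :
    ContMDiffAt 𝓘(ℝ, E) (𝓘(ℝ, E).prod 𝓘(ℝ, E →L[ℝ] ℝ)) ∞
      (fun x => TotalSpace.mk' (E →L[ℝ] ℝ) x (ξ x)) x₀ := by
  rw [contMDiffAt_hom_bundle]
  refine ⟨contMDiffAt_id, ?_⟩
  let b := Module.finBasis ℝ E
  let e := trivializationAt E (TangentSpace 𝓘(ℝ, E) : M → Type _) x₀
  choose V hV using fun i => exists_vectorField_symmL (E := E) x₀ (b i)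
  have h1 : ContMDiffAt 𝓘(ℝ, E) 𝓘(ℝ, E →L[ℝ] ℝ) ∞
      (fun x => ∑ i, (ξ x (V i x) : ℝ) • (b.coord i).toContinuousLinearMap) x₀ :=
    ContMDiffAt.sum fun i _ => (h (V i)).smul contMDiffAt_const
  refine h1.congr_of_eventuallyEq ?_
  filter_upwards [Filter.eventually_all.2 hV] with x hx
  ext u
  simp only [hx]
  rw [sum_apply]
  conv_lhs => rw [← b.sum_repr u, map_sum]
  refine Finset.sum_congr rfl fun i _ => ?_
  rw [map_smul]
  have h2 : (trivializationAt ℝ (Bundle.Trivial M ℝ) x₀).continuousLinearMapAt ℝ x =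
      ContinuousLinearMap.id ℝ ℝ := Bundle.Trivial.continuousLinearMapAt_trivialization ..
  rw [ContinuousLinearMap.inCoordinates, h2]
  change (b.repr u i) * (ξ x (e.symmL ℝ x (b i)) : ℝ) = _ * (b.coord i u)
  rw [mul_comm]; rfl

end Toolkit

/-! ### Exact forms and contractions as smooth objects -/

section Toolkit

variable {E : Type*} [NormedAddCommGroup E] [NormedSpace ℝ E]
  {M : Type*} [TopologicalSpace M] [ChartedSpace E M] [IsManifold 𝓘(ℝ, E) ∞ M]

/-- The differential of a smooth function as a smooth 1-form. -/
def exactForm [FiniteDimensional ℝ E] [T2Space M] (f : C^∞⟮𝓘(ℝ, E), M; ℝ⟯) : OneForm E M :=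
  ⟨fun x => dForm f x, fun x => contMDiffAt_oneForm_of_test fun V =>
    contMDiffAt_lieD (V.contMDiff x) f.contMDiff⟩

theorem exactForm_apply [FiniteDimensional ℝ E] [T2Space M] (f : C^∞⟮𝓘(ℝ, E), M; ℝ⟯) (x : M) :
    exactForm f x = dForm f x := rfl

/-- The function `α(X)`. -/
def contract (α : OneForm E M) (X : SmoothVectorField E M) : C^∞⟮𝓘(ℝ, E), M; ℝ⟯ :=
  ⟨fun x => (α x (X x) : ℝ), fun x => contMDiffAt_covector_apply (α.contMDiff x) (X.contMDiff x)⟩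

end Toolkit

/-! ### Smoothness of sections of a direct sum -/

section ProdBundle

variable {E : Type*} [NormedAddCommGroup E] [NormedSpace ℝ E]
  {M : Type*} [TopologicalSpace M] [ChartedSpace E M] [IsManifold 𝓘(ℝ, E) ∞ M]
  {F₁ : Type*} [NormedAddCommGroup F₁] [NormedSpace ℝ F₁]
  {V₁ : M → Type*} [TopologicalSpace (TotalSpace F₁ V₁)]
  [∀ x, AddCommGroup (V₁ x)] [∀ x, Module ℝ (V₁ x)] [∀ x, TopologicalSpace (V₁ x)]
  [FiberBundle F₁ V₁] [VectorBundle ℝ F₁ V₁]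
  {F₂ : Type*} [NormedAddCommGroup F₂] [NormedSpace ℝ F₂]
  {V₂ : M → Type*} [TopologicalSpace (TotalSpace F₂ V₂)]
  [∀ x, AddCommGroup (V₂ x)] [∀ x, Module ℝ (V₂ x)] [∀ x, TopologicalSpace (V₂ x)]
  [FiberBundle F₂ V₂] [VectorBundle ℝ F₂ V₂]

theorem contMDiffWithinAt_prod_section {s : ∀ x, (V₁ ×ᵇ V₂) x} {U : Set M} {x₀ : M} :
    ContMDiffWithinAt 𝓘(ℝ, E) (𝓘(ℝ, E).prod 𝓘(ℝ, F₁ × F₂)) ∞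
      (fun x => TotalSpace.mk' (F₁ × F₂) x (s x)) U x₀ ↔
    ContMDiffWithinAt 𝓘(ℝ, E) (𝓘(ℝ, E).prod 𝓘(ℝ, F₁)) ∞
      (fun x => TotalSpace.mk' F₁ x (s x).1) U x₀ ∧
    ContMDiffWithinAt 𝓘(ℝ, E) (𝓘(ℝ, E).prod 𝓘(ℝ, F₂)) ∞
      (fun x => TotalSpace.mk' F₂ x (s x).2) U x₀ := by
  simp only [contMDiffWithinAt_section]
  exact contMDiffWithinAt_prod_module_iff _

theorem contMDiffAt_prod_section {s : ∀ x, (V₁ ×ᵇ V₂) x} {x₀ : M} :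
    ContMDiffAt 𝓘(ℝ, E) (𝓘(ℝ, E).prod 𝓘(ℝ, F₁ × F₂)) ∞
      (fun x => TotalSpace.mk' (F₁ × F₂) x (s x)) x₀ ↔
    ContMDiffAt 𝓘(ℝ, E) (𝓘(ℝ, E).prod 𝓘(ℝ, F₁)) ∞
      (fun x => TotalSpace.mk' F₁ x (s x).1) x₀ ∧
    ContMDiffAt 𝓘(ℝ, E) (𝓘(ℝ, E).prod 𝓘(ℝ, F₂)) ∞
      (fun x => TotalSpace.mk' F₂ x (s x).2) x₀ :=
  contMDiffWithinAt_prod_section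

end ProdBundle

/-! ### Smoothness of sections along a map -/

section PullbackBundle

variable {E : Type*} [NormedAddCommGroup E] [NormedSpace ℝ E]
  {M : Type*} [TopologicalSpace M] [ChartedSpace E M] [IsManifold 𝓘(ℝ, E) ∞ M]
  {E' : Type*} [NormedAddCommGroup E'] [NormedSpace ℝ E']
  {N : Type*} [TopologicalSpace N] [ChartedSpace E' N] [IsManifold 𝓘(ℝ, E') ∞ N]

section
variable {F : Type*} [NormedAddCommGroup F] [NormedSpace ℝ F]
  {V : N → Type*} [TopologicalSpace (TotalSpace F V)]
  [∀ y, AddCommGroup (V y)] [∀ y, Module ℝ (V y)] [∀ y, TopologicalSpace (V y)]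
  [FiberBundle F V] [VectorBundle ℝ F V]

theorem contMDiffAt_pullback_section_iff (φ : C^∞⟮𝓘(ℝ, E), M; 𝓘(ℝ, E'), N⟯)
    {s : ∀ x, (φ *ᵖ V) x} {x₀ : M} :
    ContMDiffAt 𝓘(ℝ, E) (𝓘(ℝ, E).prod 𝓘(ℝ, F)) ∞
      (fun x => TotalSpace.mk' F x (s x)) x₀ ↔
    ContMDiffAt 𝓘(ℝ, E) (𝓘(ℝ, E').prod 𝓘(ℝ, F)) ∞
      (fun x => TotalSpace.mk' (E := V) F (φ x) (s x)) x₀ := by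
  rw [contMDiffAt_section, contMDiffAt_totalSpace]
  constructor
  · intro h
    exact ⟨φ.contMDiff x₀, h⟩
  · intro h
    exact h.2
end

theorem contMDiffAt_covector_apply_along (φ : C^∞⟮𝓘(ℝ, E), M; 𝓘(ℝ, E'), N⟯)
    {ξ : ∀ x, CotangentSpace E' (φ x)} {v : ∀ x, TangentSpace 𝓘(ℝ, E') (φ x)} {x₀ : M}
    (hξ : ContMDiffAt 𝓘(ℝ, E) (𝓘(ℝ, E').prod 𝓘(ℝ, E' →L[ℝ] ℝ)) ∞
      (fun x => TotalSpace.mk' (E' →L[ℝ] ℝ) (φ x) (ξ x)) x₀)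
    (hv : ContMDiffAt 𝓘(ℝ, E) (𝓘(ℝ, E').prod 𝓘(ℝ, E')) ∞
      (fun x => TotalSpace.mk' E' (φ x) (v x) : M → TangentBundle 𝓘(ℝ, E') N) x₀) :
    ContMDiffAt 𝓘(ℝ, E) 𝓘(ℝ, ℝ) ∞ (fun x => (ξ x (v x) : ℝ)) x₀ := by
  have h := ContMDiffAt.clm_bundle_apply (E₂ := Bundle.Trivial N ℝ) (F₂ := ℝ) hξ hv
  exact ((contMDiffAt_totalSpace).1 h).2

/-- Near `x₀` one has ξ = ∑ ξ(Vᵢ ∘ φ) · (dgᵢ ∘ φ) for a coordinate frame at `φ x₀`. -/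
theorem contMDiffAt_pullback_covector_of_test [FiniteDimensional ℝ E'] [T2Space N]
    (φ : C^∞⟮𝓘(ℝ, E), M; 𝓘(ℝ, E'), N⟯) {ξ : ∀ x, CotangentSpace E' (φ x)} {x₀ : M}
    (h : ∀ V : SmoothVectorField E' N,
      ContMDiffAt 𝓘(ℝ, E) 𝓘(ℝ, ℝ) ∞ (fun x => (ξ x (V (φ x)) : ℝ)) x₀) :
    ContMDiffAt 𝓘(ℝ, E) (𝓘(ℝ, E).prod 𝓘(ℝ, E' →L[ℝ] ℝ)) ∞
      (fun x => TotalSpace.mk' (E := φ *ᵖ (CotangentSpace E' : N → Type _)) (E' →L[ℝ] ℝ) x (ξ x))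
      x₀ := by
  obtain ⟨g, V, hgV⟩ := exists_coordinate_frame (E := E') (φ x₀)
  have hs : ∀ i, ContMDiffAt 𝓘(ℝ, E) (𝓘(ℝ, E).prod 𝓘(ℝ, E' →L[ℝ] ℝ)) ∞
      (fun x => TotalSpace.mk' (E := φ *ᵖ (CotangentSpace E' : N → Type _)) (E' →L[ℝ] ℝ) x
        (exactForm (g i) (φ x))) x₀ := fun i => by
    refine (contMDiffAt_pullback_section_iff φ (V := (CotangentSpace E' : N → Type _))
      (s := fun x => exactForm (g i) (φ x))).2 ?_
    exact ((exactForm (g i)).contMDiff (φ x₀)).comp x₀ (φ.contMDiff x₀)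
  have h1 : ContMDiffAt 𝓘(ℝ, E) (𝓘(ℝ, E).prod 𝓘(ℝ, E' →L[ℝ] ℝ)) ∞
      (fun x => TotalSpace.mk' (E := φ *ᵖ (CotangentSpace E' : N → Type _)) (E' →L[ℝ] ℝ) x
        (∑ i, (ξ x (V i (φ x)) : ℝ) • (exactForm (g i) (φ x) :
          (φ *ᵖ (CotangentSpace E' : N → Type _)) x))) x₀ :=
    ContMDiffAt.sum_section fun i _ => (h (V i)).smul_section (hs i)
  refine h1.congr_of_eventuallyEq ?_
  filter_upwards [φ.contMDiff.continuous.continuousAt.eventually hgV] with x hx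
  refine congrArg (TotalSpace.mk' (E := φ *ᵖ (CotangentSpace E' : N → Type _)) (E' →L[ℝ] ℝ) x) ?_
  refine covector_ext fun v => ?_
  refine Eq.trans ?_ (sum_covector_apply _ _ v).symm
  conv_lhs => rw [← hx.1 v, covector_apply_eq_sum]
  exact Finset.sum_congr rfl fun i _ => mul_comm _ _

end PullbackBundle

/-! ### The Dorfman bracket -/

section Dorfman

variable {𝔤 W : Type*} [LieRing 𝔤] [LieAlgebra ℝ 𝔤] [AddCommGroup W] [Module ℝ W]
  [LieRingModule 𝔤 W] [LieModule ℝ 𝔤 W]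

/-- The 1-form component of the Dorfman bracket of `X + α` and `Y + β`, evaluated on `V`. -/
def dorfmanForm (X : 𝔤) (α : 𝔤 →ₗ[ℝ] W) (Y : 𝔤) (β : 𝔤 →ₗ[ℝ] W) (V : 𝔤) : W :=
  ⁅X, β V⁆ - β ⁅X, V⁆ - ⁅Y, α V⁆ + α ⁅Y, V⁆ + ⁅V, α Y⁆

/-- For pairwise orthogonal arguments the Jacobiator, evaluated on V, expands to V · (ξ(X) + α([Y,
Z])). This function is twice the pairing of X + α with the bracket [Y, Z] + ξ of the other two
sections, so `h`, the orthogonality of these two, kills it. The computation is formal: it takes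
place in a module over a Lie algebra. -/
theorem dorfmanForm_jacobi {X Y Z : 𝔤} {α β γ ξ η ζ : 𝔤 →ₗ[ℝ] W}
    (hξ : ∀ V, ξ V = dorfmanForm Y β Z γ V) (hη : ∀ V, η V = dorfmanForm Z γ X α V)
    (hζ : ∀ V, ζ V = dorfmanForm X α Y β V)
    (hαβ : α Y = -β X) (hβγ : β Z = -γ Y) (hγα : γ X = -α Z)
    (h : ξ X = -α ⁅Y, Z⁆) (V : 𝔤) :
    dorfmanForm X α ⁅Y, Z⁆ ξ V + dorfmanForm Y β ⁅Z, X⁆ η V + dorfmanForm Z γ ⁅X, Y⁆ ζ V = 0 := by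
  have h' := congrArg (fun w => ⁅V, w⁆) h
  have e1 : (⁅Y, X⁆ : 𝔤) = -⁅X, Y⁆ := (lie_skew _ _).symm
  simp only [hξ, hη, hζ, dorfmanForm, hαβ, hβγ, hγα, lie_neg, lie_add, lie_sub, map_sub,
    lie_lie] at h' ⊢
  rw [e1] at h'
  simp only [map_neg, lie_neg] at h'
  rw [← sub_eq_zero] at h'
  rw [← h']
  abel

theorem dorfmanForm_add_left (X X' : 𝔤) (α α' : 𝔤 →ₗ[ℝ] W) (Y : 𝔤) (β : 𝔤 →ₗ[ℝ] W) (V : 𝔤) :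
    dorfmanForm (X + X') (α + α') Y β V = dorfmanForm X α Y β V + dorfmanForm X' α' Y β V := by
  simp only [dorfmanForm, add_lie, LinearMap.add_apply, lie_add, map_add]
  abel

theorem dorfmanForm_add_right (X : 𝔤) (α : 𝔤 →ₗ[ℝ] W) (Y Y' : 𝔤) (β β' : 𝔤 →ₗ[ℝ] W) (V : 𝔤) :
    dorfmanForm X α (Y + Y') (β + β') V = dorfmanForm X α Y β V + dorfmanForm X α Y' β' V := by
  simp only [dorfmanForm, add_lie, LinearMap.add_apply, lie_add, map_add]
  abel

theorem dorfmanForm_smul_left (c : ℝ) (X : 𝔤) (α : 𝔤 →ₗ[ℝ] W) (Y : 𝔤) (β : 𝔤 →ₗ[ℝ] W) (V : 𝔤) :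
    dorfmanForm (c • X) (c • α) Y β V = c • dorfmanForm X α Y β V := by
  simp only [dorfmanForm, smul_lie, LinearMap.smul_apply, lie_smul, map_smul, smul_add, smul_sub]

theorem dorfmanForm_smul_right (c : ℝ) (X : 𝔤) (α : 𝔤 →ₗ[ℝ] W) (Y : 𝔤) (β : 𝔤 →ₗ[ℝ] W) (V : 𝔤) :
    dorfmanForm X α (c • Y) (c • β) V = c • dorfmanForm X α Y β V := by
  simp only [dorfmanForm, smul_lie, LinearMap.smul_apply, lie_smul, map_smul, smul_add, smul_sub]

theorem dorfmanForm_self {X : 𝔤} {α : 𝔤 →ₗ[ℝ] W} (h : α X = 0) (V : 𝔤) :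
    dorfmanForm X α X α V = 0 := by
  simp [dorfmanForm, h]

end Dorfman

/-! ### The Courant bracket in terms of the Dorfman bracket -/

section Courant

variable {E : Type*} [NormedAddCommGroup E] [NormedSpace ℝ E] [FiniteDimensional ℝ E]
  {M : Type*} [TopologicalSpace M] [ChartedSpace E M] [IsManifold 𝓘(ℝ, E) ∞ M] [T2Space M]

attribute [local instance] isManifold_minSmoothness_two

instance : LieAlgebra ℝ (SmoothVectorField E M) where
  lie_smul c X Y := by
    have := FiniteDimensional.complete ℝ E
    ext x
    exact mlieBracket_const_smul_right (Y.mdifferentiableAt x)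

instance : LieModule ℝ (SmoothVectorField E M) C^∞⟮𝓘(ℝ, E), M; ℝ⟯ where
  smul_lie c X f := by
    ext x
    exact lieD_vec_smul (X := X) (fun _ => c) f x
  lie_smul c X f := by
    ext x
    exact lieD_const_mul c (smooth_mdifferentiableAt f x)

theorem lie_mul_smooth (X : SmoothVectorField E M) (f g : C^∞⟮𝓘(ℝ, E), M; ℝ⟯) :
    ⁅X, f * g⁆ = ⁅X, f⁆ * g + f * ⁅X, g⁆ := by
  ext x
  exact lieD_mul (smooth_mdifferentiableAt f x) (smooth_mdifferentiableAt g x)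

theorem smulVF_lie_function (X : SmoothVectorField E M) (f g : C^∞⟮𝓘(ℝ, E), M; ℝ⟯) :
    ⁅smulVF f X, g⁆ = f * ⁅X, g⁆ := by
  ext x
  exact lieD_vec_smul (X := X) f g x

theorem smulVF_lie (X Y : SmoothVectorField E M) (f : C^∞⟮𝓘(ℝ, E), M; ℝ⟯) :
    ⁅smulVF f X, Y⁆ = smulVF f ⁅X, Y⁆ - smulVF ⁅Y, f⁆ X := by
  rw [← lie_skew, lie_smulVF, ← lie_skew X Y]
  ext x
  change -(lieD Y f x • X x + f x • ⁅Y, X⁆ x) = f x • (-⁅Y, X⁆ x) - lieD Y f x • X x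
  rw [smul_neg]
  abel

/-- The contraction with a 1-form, as a linear map. -/
def contractHom (α : OneForm E M) : SmoothVectorField E M →ₗ[ℝ] C^∞⟮𝓘(ℝ, E), M; ℝ⟯ where
  toFun := contract α
  map_add' X Y := by
    ext x
    exact map_add (α x) (X x) (Y x)
  map_smul' c X := by
    ext x
    exact map_smul (α x) c (X x)

theorem contractHom_apply (α : OneForm E M) (X : SmoothVectorField E M) (x : M) :
    contractHom α X x = (α x (X x) : ℝ) := rfl

theorem contractHom_smulVF (α : OneForm E M) (X : SmoothVectorField E M)
    (f : C^∞⟮𝓘(ℝ, E), M; ℝ⟯) : contractHom α (smulVF f X) = f * contractHom α X := by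
  ext x
  exact map_smul (α x) (f x) (X x)

theorem oneForm_ext {α β : OneForm E M} (h : ∀ V, contractHom α V = contractHom β V) : α = β := by
  ext1 x
  exact covector_ext_vectorField fun V => congrArg (fun f : C^∞⟮𝓘(ℝ, E), M; ℝ⟯ => f x) (h V)

/-- The vector field component of a section of `TM ⊕ T*M`. -/
def GenSection.vec (σ : GenSection E M) : SmoothVectorField E M :=
  ⟨fun x => (σ x).1, fun x => (contMDiffAt_prod_section.1 (σ.contMDiff x)).1⟩

/-- The 1-form component of a section of `TM ⊕ T*M`. -/
def GenSection.form (σ : GenSection E M) : OneForm E M :=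
  ⟨fun x => (σ x).2, fun x => (contMDiffAt_prod_section.1 (σ.contMDiff x)).2⟩

/-- The section `X + α` of `TM ⊕ T*M`. -/
def GenSection.mk (X : SmoothVectorField E M) (α : OneForm E M) : GenSection E M :=
  ⟨fun x => (X x, α x),
    fun x => contMDiffAt_prod_section.2 ⟨X.contMDiff x, α.contMDiff x⟩⟩

theorem GenSection.ext' {σ τ : GenSection E M} (h : σ.vec = τ.vec)
    (h' : ∀ V, contractHom σ.form V = contractHom τ.form V) : σ = τ := by
  ext1 x
  exact Prod.ext (congrArg (fun X : SmoothVectorField E M => X x) h)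
    (congrArg (fun α : OneForm E M => α x) (oneForm_ext h'))

theorem contractHom_form_eq_neg {σ τ : GenSection E M} (h : ∀ x, pairing x (σ x) (τ x) = 0) :
    contractHom σ.form τ.vec = -contractHom τ.form σ.vec := by
  ext x
  have := h x
  unfold pairing at this
  change ((σ x).2 (τ x).1 : ℝ) = -((τ x).2 (σ x).1 : ℝ)
  linarith

/-- Orthogonality means β(X) = -α(Y), so the term ½ d(α(Y) - β(X)) becomes d(α(Y)), the last term of
`dorfmanForm`. -/
theorem isCourantBracket_iff {σ τ υ : GenSection E M} (h : ∀ x, pairing x (σ x) (τ x) = 0) :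
    IsCourantBracket σ τ υ ↔ υ.vec = ⁅σ.vec, τ.vec⁆ ∧
      ∀ V, contractHom υ.form V =
        dorfmanForm σ.vec (contractHom σ.form) τ.vec (contractHom τ.form) V := by
  have hc := contractHom_form_eq_neg h
  have h2 : ∀ V : SmoothVectorField E M, ∀ x, (1 / 2 : ℝ) *
      lieD V (fun y => ((σ y).2 (τ y).1 : ℝ) - ((τ y).2 (σ y).1 : ℝ)) x =
        lieD V (contractHom σ.form τ.vec) x := by
    intro V x
    have e : (fun y => ((σ y).2 (τ y).1 : ℝ) - ((τ y).2 (σ y).1 : ℝ)) =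
        fun y => 2 * contractHom σ.form τ.vec y := by
      funext y
      have := congrArg (fun f : C^∞⟮𝓘(ℝ, E), M; ℝ⟯ => f y) hc
      change ((σ y).2 (τ y).1 : ℝ) = -((τ y).2 (σ y).1 : ℝ) at this
      change ((σ y).2 (τ y).1 : ℝ) - ((τ y).2 (σ y).1 : ℝ) = 2 * ((σ y).2 (τ y).1 : ℝ)
      linarith
    rw [e, lieD_const_mul _ (smooth_mdifferentiableAt _ x)]
    ring
  have h3 : ∀ V : SmoothVectorField E M, ∀ x,
      dorfmanForm σ.vec (contractHom σ.form) τ.vec (contractHom τ.form) V x =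
      lieForm (fun y => (σ y).1) (fun y => (τ y).2) V x -
        lieForm (fun y => (τ y).1) (fun y => (σ y).2) V x +
        (1 / 2 : ℝ) * lieD V (fun y => ((σ y).2 (τ y).1 : ℝ) - ((τ y).2 (σ y).1 : ℝ)) x := by
    intro V x
    rw [h2]
    have : dorfmanForm σ.vec (contractHom σ.form) τ.vec (contractHom τ.form) V x =
        lieD (fun y => (σ y).1) (fun y => ((τ y).2 (V y) : ℝ)) x -
          ((τ x).2 (mlieBracket 𝓘(ℝ, E) (fun y => (σ y).1) V x) : ℝ) -
          lieD (fun y => (τ y).1) (fun y => ((σ y).2 (V y) : ℝ)) x +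
          ((σ x).2 (mlieBracket 𝓘(ℝ, E) (fun y => (τ y).1) V x) : ℝ) +
          lieD V (contractHom σ.form τ.vec) x := rfl
    rw [this]
    unfold lieForm
    ring
  constructor
  · rintro ⟨h1, h4⟩
    refine ⟨?_, fun V => ?_⟩
    · ext1 x
      exact h1 x
    · ext x
      exact (h4 V x).trans (h3 V x).symm
  · rintro ⟨h1, h4⟩
    refine ⟨fun x => congrArg (fun X : SmoothVectorField E M => X x) h1, fun V x => ?_⟩
    exact (congrArg (fun f : C^∞⟮𝓘(ℝ, E), M; ℝ⟯ => f x) (h4 V)).trans (h3 V x)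

end Courant

/-! ### The Lie algebroid of an involutive isotropic subbundle -/

section DiracAlgebroid

variable {E : Type*} [NormedAddCommGroup E] [NormedSpace ℝ E] [FiniteDimensional ℝ E]
  {M : Type*} [TopologicalSpace M] [ChartedSpace E M] [IsManifold 𝓘(ℝ, E) ∞ M] [T2Space M]

theorem contractHom_form_add (σ τ : GenSection E M) :
    contractHom (σ + τ).form = contractHom σ.form + contractHom τ.form := rfl

theorem contractHom_form_smul (c : ℝ) (σ : GenSection E M) :
    contractHom (c • σ).form = c • contractHom σ.form := rfl

theorem vec_add (σ τ : GenSection E M) : (σ + τ).vec = σ.vec + τ.vec := rfl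

theorem vec_smul (c : ℝ) (σ : GenSection E M) : (c • σ).vec = c • σ.vec := rfl

variable {L : ∀ x : M, Submodule ℝ (GenTangent E x)}

/-- Involutive isotropic smooth subbundles of `TM ⊕ T*M`. -/
structure IsInvolutive (L : ∀ x : M, Submodule ℝ (GenTangent E x)) : Prop where
  isSubbundle : IsSmoothSubbundle (E := E) (E × (E →L[ℝ] ℝ)) L
  isotropic : ∀ x, IsIsotropic x (L x)
  integrable : ∀ σ ∈ sections (E := E) (E × (E →L[ℝ] ℝ)) L,
    ∀ τ ∈ sections (E := E) (E × (E →L[ℝ] ℝ)) L,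
    ∃ υ ∈ sections (E := E) (E × (E →L[ℝ] ℝ)) L, IsCourantBracket σ τ υ

theorem IsDirac.isInvolutive (hL : IsDirac L) : IsInvolutive L :=
  ⟨hL.isSubbundle, hL.isotropic, hL.integrable⟩

namespace IsInvolutive

theorem pairing_eq_zero (hL : IsInvolutive L)
    (σ τ : sections (E := E) (E × (E →L[ℝ] ℝ)) L) (x : M) :
    pairing x (σ.1 x) (τ.1 x) = 0 :=
  hL.isotropic x _ (σ.2 x) _ (τ.2 x)

theorem exists_bracket (hL : IsInvolutive L) (σ τ : sections (E := E) (E × (E →L[ℝ] ℝ)) L) :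
    ∃ υ : sections (E := E) (E × (E →L[ℝ] ℝ)) L, IsCourantBracket σ.1 τ.1 υ.1 := by
  obtain ⟨υ, h, h'⟩ := hL.integrable σ.1 σ.2 τ.1 τ.2
  exact ⟨⟨υ, h⟩, h'⟩

variable (hL : IsInvolutive L)

/-- The Courant bracket of sections of `L`. -/
def bracketFun (σ τ : sections (E := E) (E × (E →L[ℝ] ℝ)) L) :
    sections (E := E) (E × (E →L[ℝ] ℝ)) L :=
  (hL.exists_bracket σ τ).choose

theorem isCourantBracket_bracketFun (σ τ : sections (E := E) (E × (E →L[ℝ] ℝ)) L) :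
    IsCourantBracket σ.1 τ.1 (hL.bracketFun σ τ).1 :=
  (hL.exists_bracket σ τ).choose_spec

theorem bracketFun_vec (σ τ : sections (E := E) (E × (E →L[ℝ] ℝ)) L) :
    (GenSection.vec (hL.bracketFun σ τ).1) = ⁅(GenSection.vec σ.1), (GenSection.vec τ.1)⁆ :=
  ((isCourantBracket_iff (hL.pairing_eq_zero σ τ)).1 (hL.isCourantBracket_bracketFun σ τ)).1

theorem bracketFun_form (σ τ : sections (E := E) (E × (E →L[ℝ] ℝ)) L)
    (V : SmoothVectorField E M) :
    contractHom (GenSection.form (hL.bracketFun σ τ).1) V =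
      dorfmanForm (GenSection.vec σ.1) (contractHom (GenSection.form σ.1)) (GenSection.vec τ.1)
        (contractHom (GenSection.form τ.1)) V :=
  ((isCourantBracket_iff (hL.pairing_eq_zero σ τ)).1 (hL.isCourantBracket_bracketFun σ τ)).2 V

/-- The Courant bracket of sections of `L`, as a bilinear map. -/
def bracket : sections (E := E) (E × (E →L[ℝ] ℝ)) L →ₗ[ℝ]
    sections (E := E) (E × (E →L[ℝ] ℝ)) L →ₗ[ℝ] sections (E := E) (E × (E →L[ℝ] ℝ)) L :=
  LinearMap.mk₂ ℝ hL.bracketFun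
    (fun σ σ' τ => Subtype.ext <| GenSection.ext'
      (by simp only [Submodule.coe_add, vec_add, bracketFun_vec, add_lie])
      fun V => by
        simp only [Submodule.coe_add, contractHom_form_add, LinearMap.add_apply, bracketFun_form,
          vec_add, dorfmanForm_add_left])
    (fun c σ τ => Subtype.ext <| GenSection.ext'
      (by simp only [Submodule.coe_smul, vec_smul, bracketFun_vec, smul_lie])
      fun V => by
        simp only [Submodule.coe_smul, contractHom_form_smul, LinearMap.smul_apply,
          bracketFun_form, vec_smul, dorfmanForm_smul_left])
    (fun σ τ τ' => Subtype.ext <| GenSection.ext'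
      (by simp only [Submodule.coe_add, vec_add, bracketFun_vec, lie_add])
      fun V => by
        simp only [Submodule.coe_add, contractHom_form_add, LinearMap.add_apply, bracketFun_form,
          vec_add, dorfmanForm_add_right])
    (fun c σ τ => Subtype.ext <| GenSection.ext'
      (by simp only [Submodule.coe_smul, vec_smul, bracketFun_vec, lie_smul])
      fun V => by
        simp only [Submodule.coe_smul, contractHom_form_smul, LinearMap.smul_apply,
          bracketFun_form, vec_smul, dorfmanForm_smul_right])

theorem bracket_self (σ : sections (E := E) (E × (E →L[ℝ] ℝ)) L) : hL.bracket σ σ = 0 := by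
  have h := contractHom_form_eq_neg (hL.pairing_eq_zero σ σ)
  have h0 : contractHom (GenSection.form σ.1) (GenSection.vec σ.1) = 0 := by
    ext x
    have := congrArg (fun f : C^∞⟮𝓘(ℝ, E), M; ℝ⟯ => f x) h
    change contractHom (GenSection.form σ.1) (GenSection.vec σ.1) x =
      -contractHom (GenSection.form σ.1) (GenSection.vec σ.1) x at this
    change contractHom (GenSection.form σ.1) (GenSection.vec σ.1) x = 0
    linarith
  refine Subtype.ext <| GenSection.ext' ?_ fun V => ?_
  · exact (hL.bracketFun_vec σ σ).trans (lie_self _)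
  · exact (hL.bracketFun_form σ σ V).trans (dorfmanForm_self h0 V)

theorem jacobi (σ τ υ : sections (E := E) (E × (E →L[ℝ] ℝ)) L) :
    hL.bracket σ (hL.bracket τ υ) + hL.bracket τ (hL.bracket υ σ) +
      hL.bracket υ (hL.bracket σ τ) = 0 := by
  refine Subtype.ext <| GenSection.ext' ?_ fun V => ?_
  · change GenSection.vec (hL.bracketFun σ (hL.bracketFun τ υ)).1 +
      GenSection.vec (hL.bracketFun τ (hL.bracketFun υ σ)).1 +
      GenSection.vec (hL.bracketFun υ (hL.bracketFun σ τ)).1 = 0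
    simp only [bracketFun_vec]
    exact lie_jacobi _ _ _
  · change contractHom (GenSection.form (hL.bracketFun σ (hL.bracketFun τ υ)).1) V +
      contractHom (GenSection.form (hL.bracketFun τ (hL.bracketFun υ σ)).1) V +
      contractHom (GenSection.form (hL.bracketFun υ (hL.bracketFun σ τ)).1) V = 0
    simp only [hL.bracketFun_form _ (hL.bracketFun _ _), bracketFun_vec]
    refine dorfmanForm_jacobi (hL.bracketFun_form τ υ) (hL.bracketFun_form υ σ)
      (hL.bracketFun_form σ τ) (contractHom_form_eq_neg (hL.pairing_eq_zero σ τ))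
      (contractHom_form_eq_neg (hL.pairing_eq_zero τ υ))
      (contractHom_form_eq_neg (hL.pairing_eq_zero υ σ)) ?_ V
    -- The remaining hypothesis is isotropy applied to the bracket of τ and υ, which is available
    -- because that bracket is again a section of L.
    rw [contractHom_form_eq_neg (hL.pairing_eq_zero _ σ), bracketFun_vec]

/-- In the 1-form component the term -V(f) α(Y) coming from α([fY, V]) cancels the one coming from
V(f α(Y)). The Dorfman form has no anomaly in its second argument. -/
theorem leibniz (f : C^∞⟮𝓘(ℝ, E), M; ℝ⟯) (σ τ fτ : sections (E := E) (E × (E →L[ℝ] ℝ)) L)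
    (h : ∀ x, fτ.1 x = f x • τ.1 x) (x : M) :
    (hL.bracket σ fτ).1 x = f x • (hL.bracket σ τ).1 x + lieD (GenSection.vec σ.1) f x • τ.1 x := by
  have hv : (GenSection.vec fτ.1) = smulVF f (GenSection.vec τ.1) := by
    ext1 y
    exact congrArg Prod.fst (h y)
  have hf : ∀ V, contractHom (GenSection.form fτ.1) V =
      f * contractHom (GenSection.form τ.1) V := by
    intro V
    ext y
    exact congrArg (fun w : GenTangent E y => (w.2 (V y) : ℝ)) (h y)
  refine Prod.ext ?_ (covector_ext_vectorField fun V => ?_)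
  · have := congrArg (fun X : SmoothVectorField E M => X x) (hL.bracketFun_vec σ fτ)
    rw [hv, lie_smulVF, ← bracketFun_vec hL] at this
    exact this.trans (add_comm _ _)
  · have h1 := hL.bracketFun_form σ fτ V
    have h2 := hL.bracketFun_form σ τ V
    have key : contractHom (GenSection.form (hL.bracketFun σ fτ).1) V =
        f * contractHom (GenSection.form (hL.bracketFun σ τ).1) V +
          ⁅GenSection.vec σ.1, f⁆ * contractHom (GenSection.form τ.1) V := by
      rw [h1, h2]
      simp only [dorfmanForm, hf, hv, lie_mul_smooth, smulVF_lie_function, smulVF_lie, map_sub,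
        contractHom_smulVF]
      ring
    exact congrArg (fun f : C^∞⟮𝓘(ℝ, E), M; ℝ⟯ => f x) key

/-- The Lie algebroid of an involutive isotropic subbundle. -/
def lieAlgebroid : LieAlgebroid E (E × (E →L[ℝ] ℝ)) L where
  isSubbundle := hL.isSubbundle
  anchor x := (LinearMap.fst ℝ (TangentSpace 𝓘(ℝ, E) x) (CotangentSpace E x)).comp (L x).subtype
  anchor_smooth σ := (GenSection.vec σ.1).contMDiff
  bracket := hL.bracket
  bracket_self := hL.bracket_self
  jacobi := hL.jacobi
  leibniz f σ τ fτ h x := Subtype.ext <| hL.leibniz f σ τ fτ (fun y => congrArg Subtype.val (h y)) x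
  anchor_bracket σ τ x :=
    congrArg (fun X : SmoothVectorField E M => X x) (hL.bracketFun_vec σ τ)

theorem isDiracAlgebroid_lieAlgebroid : IsDiracAlgebroid hL.lieAlgebroid where
  anchor _ _ := rfl
  bracket := hL.isCourantBracket_bracketFun

end IsInvolutive

end DiracAlgebroid

/-! ### Linear algebra of Dirac structures -/

section Dirac

variable {E : Type*} [NormedAddCommGroup E] [NormedSpace ℝ E] [FiniteDimensional ℝ E]
  {M : Type*} [TopologicalSpace M] [ChartedSpace E M] [IsManifold 𝓘(ℝ, E) ∞ M] [T2Space M]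
  {L : ∀ x : M, Submodule ℝ (GenTangent E x)}

theorem covector_eq_zero_of_mem_charDistribution (hL : ∀ x, IsIsotropic x (L x)) {x : M}
    {v : GenTangent E x} (hv : v ∈ L x) {Z : TangentSpace 𝓘(ℝ, E) x}
    (hZ : Z ∈ charDistribution L x) : (v.2 Z : ℝ) = 0 := by
  have h := hL x v hv (Z, 0) hZ
  unfold pairing at h
  change (1 / 2 : ℝ) * (0 + (v.2 Z : ℝ)) = 0 at h
  linarith

/-- Reflexivity of a finite-dimensional space, written out in a coordinate frame. -/
theorem exists_vector_eq_functional (x : M) (f : CotangentSpace E x →ₗ[ℝ] ℝ) :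
    ∃ X : TangentSpace 𝓘(ℝ, E) x, ∀ η : CotangentSpace E x, f η = η X := by
  obtain ⟨g, V, hgV⟩ := exists_coordinate_frame (E := E) x
  refine ⟨∑ i, f (dForm (g i) x) • V i x, fun η => ?_⟩
  have hη : η = ∑ i, (η (V i x) : ℝ) • (dForm (g i) x : CotangentSpace E x) := by
    refine covector_ext fun v => ?_
    rw [sum_covector_apply]
    conv_lhs => rw [← hgV.self_of_nhds.1 v, covector_apply_eq_sum]
    exact Finset.sum_congr rfl fun i _ => mul_comm _ _
  rw [covector_apply_eq_sum]
  conv_lhs => rw [hη, map_sum]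
  refine Finset.sum_congr rfl fun i _ => ?_
  rw [map_smul, smul_eq_mul, mul_comm]

/-- Adding the line through (X, 0) keeps L isotropic, so by maximality the line was already in L. -/
theorem IsDirac.mem_of_forall_covector_eq_zero (hL : IsDirac L) {x : M}
    {X : TangentSpace 𝓘(ℝ, E) x} (hX : ∀ v ∈ L x, (v.2 X : ℝ) = 0) :
    ((X, 0) : GenTangent E x) ∈ L x := by
  have hiso : IsIsotropic x (L x ⊔ Submodule.span ℝ {((X, 0) : GenTangent E x)}) := by
    intro v hv w hw
    obtain ⟨v, hvL, _, hv', rfl⟩ := Submodule.mem_sup.1 hv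
    obtain ⟨a, rfl⟩ := Submodule.mem_span_singleton.1 hv'
    obtain ⟨w, hwL, _, hw', rfl⟩ := Submodule.mem_sup.1 hw
    obtain ⟨b, rfl⟩ := Submodule.mem_span_singleton.1 hw'
    have h1 := hL.isotropic x v hvL w hwL
    have h2 := hX v hvL
    have h3 := hX w hwL
    unfold pairing at h1 ⊢
    have e1 : ((w + b • ((X, 0) : GenTangent E x)).2 (v + a • ((X, 0) : GenTangent E x)).1 : ℝ) =
        (w.2 v.1 : ℝ) := by
      change ((w.2 + b • 0) (v.1 + a • X) : ℝ) = _
      rw [smul_zero, add_zero, map_add, map_smul]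
      change (w.2 v.1 : ℝ) + a * (w.2 X : ℝ) = _
      rw [h3, mul_zero, add_zero]
    have e2 : ((v + a • ((X, 0) : GenTangent E x)).2 (w + b • ((X, 0) : GenTangent E x)).1 : ℝ) =
        (v.2 w.1 : ℝ) := by
      change ((v.2 + a • 0) (w.1 + b • X) : ℝ) = _
      rw [smul_zero, add_zero, map_add, map_smul]
      change (v.2 w.1 : ℝ) + b * (v.2 X : ℝ) = _
      rw [h2, mul_zero, add_zero]
    rw [e1, e2, h1]
  rw [← hL.maximal x _ hiso le_sup_left]
  exact Submodule.mem_sup_right (Submodule.mem_span_singleton_self _)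

/-- This is ann(L ∩ TM) ⊆ pr_{T*M}(L). If ξ were outside the projection, some functional would
vanish on the projection but not at ξ. It is evaluation at a vector X, which lies in L ∩ TM by
`IsDirac.mem_of_forall_covector_eq_zero`; then ξ(X) = 0, a contradiction. -/
theorem IsDirac.exists_mem_of_annihilates (hL : IsDirac L) {x : M} {ξ : CotangentSpace E x}
    (hξ : ∀ Z ∈ charDistribution L x, (ξ Z : ℝ) = 0) :
    ∃ X : TangentSpace 𝓘(ℝ, E) x, ((X, ξ) : GenTangent E x) ∈ L x := by
  let W : Submodule ℝ (CotangentSpace E x) :=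
    (L x).map (LinearMap.snd ℝ (TangentSpace 𝓘(ℝ, E) x) (CotangentSpace E x))
  by_contra! hne
  have hW : ξ ∉ W := by
    rintro ⟨v, hv, rfl⟩
    exact hne v.1 hv
  obtain ⟨f, hf, hfW⟩ := Submodule.exists_le_ker_of_notMem hW
  obtain ⟨X, hX⟩ := exists_vector_eq_functional x f
  refine hf ?_
  rw [hX]
  refine hξ X (hL.mem_of_forall_covector_eq_zero fun v hv => ?_)
  rw [← hX]
  exact hfW (Submodule.mem_map_of_mem hv)

end Dirac

/-! ### Smooth solutions of linear systems -/

section LinearSystem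

variable {E : Type*} [NormedAddCommGroup E] [NormedSpace ℝ E] [FiniteDimensional ℝ E]
  {M : Type*} [TopologicalSpace M] [ChartedSpace E M] [IsManifold 𝓘(ℝ, E) ∞ M] [T2Space M]

theorem contMDiff_det {n : ℕ} {A : M → Matrix (Fin n) (Fin n) ℝ}
    (hA : ∀ i j, ContMDiff 𝓘(ℝ, E) 𝓘(ℝ, ℝ) ∞ fun x => A x i j) :
    ContMDiff 𝓘(ℝ, E) 𝓘(ℝ, ℝ) ∞ fun x => (A x).det := by
  simp only [Matrix.det_apply']
  exact ContMDiff.sum fun σ _ => contMDiff_const.mul (contMDiff_finsetProd fun i _ => hA _ _)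

/-- A system that is surjective at `x₀` has smooth solutions nearby. Let R be a constant right
inverse of m(x₀). The square matrix B = mR is the identity at `x₀`, hence invertible nearby, and c =
R B⁻¹ t is smooth by Cramer's rule. -/
theorem exists_smooth_solution {n k : ℕ} (m : Fin n → Fin k → C^∞⟮𝓘(ℝ, E), M; ℝ⟯)
    (t : Fin n → C^∞⟮𝓘(ℝ, E), M; ℝ⟯) (x₀ : M)
    (h : ∀ y : Fin n → ℝ, ∃ c : Fin k → ℝ, ∀ i, ∑ a, m i a x₀ * c a = y i) :
    ∃ c : Fin k → C^∞⟮𝓘(ℝ, E), M; ℝ⟯, ∀ᶠ x in 𝓝 x₀, ∀ i, ∑ a, m i a x * c a x = t i x := by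
  classical
  choose R hR using fun j : Fin n => h (Pi.single j 1)
  let B : M → Matrix (Fin n) (Fin n) ℝ := fun x i j => ∑ a, m i a x * R j a
  have hB : ∀ i j, ContMDiff 𝓘(ℝ, E) 𝓘(ℝ, ℝ) ∞ fun x => B x i j := fun i j =>
    ContMDiff.sum fun a _ => (m i a).contMDiff.mul contMDiff_const
  have hdet := contMDiff_det hB
  have hB0 : B x₀ = 1 := by
    ext i j
    rw [Matrix.one_apply, ← Pi.single_apply, ← hR j i]
  let U : Set M := {x | (B x).det ≠ 0}
  have hU : IsOpen U := isOpen_ne.preimage hdet.continuous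
  have hx₀ : x₀ ∈ U := by simp [U, hB0]
  let d : Fin n → M → ℝ := fun j x => ((B x).det)⁻¹ * (B x).cramer (fun i => t i x) j
  have hd : ∀ j, ContMDiffOn 𝓘(ℝ, E) 𝓘(ℝ, ℝ) ∞ (d j) U := by
    intro j
    refine (hdet.contMDiffOn.inv₀ fun x hx => hx).mul (ContMDiff.contMDiffOn ?_)
    simp only [Matrix.cramer_apply]
    refine contMDiff_det fun i l => ?_
    simp only [Matrix.updateCol_apply]
    split_ifs
    · exact (t i).contMDiff
    · exact hB i l
  have hc : ∀ a, ContMDiffOn 𝓘(ℝ, E) 𝓘(ℝ, ℝ) ∞ (fun x => ∑ j, R j a * d j x) U := fun a =>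
    fun x hx => ContMDiffWithinAt.sum fun j _ => contMDiffWithinAt_const.mul (hd j x hx)
  choose c hc' using fun a => exists_function_eventuallyEq hU hx₀ (hc a)
  refine ⟨c, ?_⟩
  filter_upwards [Filter.eventually_all.2 hc', hU.mem_nhds hx₀] with x hx hxU i
  simp only [hx]
  have h1 := congrFun (Matrix.mulVec_cramer (B x) (fun i => t i x)) i
  rw [Matrix.mulVec, dotProduct] at h1
  calc ∑ a, m i a x * ∑ j, R j a * d j x = ∑ j, B x i j * d j x := by
        simp only [Finset.mul_sum, B, Finset.sum_mul]
        rw [Finset.sum_comm]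
        exact Finset.sum_congr rfl fun j _ => Finset.sum_congr rfl fun a _ => by ring
    _ = ((B x).det)⁻¹ * ∑ j, B x i j * (B x).cramer (fun i => t i x) j := by
        rw [Finset.mul_sum]
        exact Finset.sum_congr rfl fun j _ => by simp only [d]; ring
    _ = t i x := by
        rw [h1, Pi.smul_apply, smul_eq_mul, inv_mul_cancel_left₀ hxU]

end LinearSystem

/-! ### Submersions -/

section Submersion

variable {E : Type*} [NormedAddCommGroup E] [NormedSpace ℝ E]
  {M : Type*} [TopologicalSpace M] [ChartedSpace E M] [IsManifold 𝓘(ℝ, E) ∞ M]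
  {E' : Type*} [NormedAddCommGroup E'] [NormedSpace ℝ E']
  {N : Type*} [TopologicalSpace N] [ChartedSpace E' N] [IsManifold 𝓘(ℝ, E') ∞ N]

/-- The composition of smooth functions with a smooth map. -/
def pullbackFunction (p : C^∞⟮𝓘(ℝ, E), M; 𝓘(ℝ, E'), N⟯) (f : C^∞⟮𝓘(ℝ, E'), N; ℝ⟯) :
    C^∞⟮𝓘(ℝ, E), M; ℝ⟯ :=
  ⟨f ∘ p, f.contMDiff.comp p.contMDiff⟩

theorem smoothMap_mdifferentiableAt (p : C^∞⟮𝓘(ℝ, E), M; 𝓘(ℝ, E'), N⟯) (x : M) :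
    MDifferentiableAt 𝓘(ℝ, E) 𝓘(ℝ, E') p x :=
  (p.contMDiff x).mdifferentiableAt (by simp)

theorem dForm_comp (p : C^∞⟮𝓘(ℝ, E), M; 𝓘(ℝ, E'), N⟯) (f : C^∞⟮𝓘(ℝ, E'), N; ℝ⟯) (x : M)
    (v : TangentSpace 𝓘(ℝ, E) x) :
    (dForm (f ∘ p) x v : ℝ) = dForm f (p x) (mfderiv 𝓘(ℝ, E) 𝓘(ℝ, E') p x v) := by
  unfold dForm
  rw [mfderiv_comp x (smooth_mdifferentiableAt f (p x)) (smoothMap_mdifferentiableAt p x)]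
  rfl

/-- In adapted charts p is the projection of a product. The section keeps the complementary
coordinate frozen at its value `c` at `x₀`. -/
theorem exists_local_section {p : M → N} (hp : Manifold.IsSubmersion 𝓘(ℝ, E) 𝓘(ℝ, E') ∞ p)
    (x₀ : M) : ∃ (s : N → M) (U : Set N), IsOpen U ∧ p x₀ ∈ U ∧
      ContMDiffOn 𝓘(ℝ, E') 𝓘(ℝ, E) ∞ s U ∧ s (p x₀) = x₀ ∧ ∀ y ∈ U, p (s y) = y := by
  obtain ⟨F, _, _, hF⟩ := hp
  have h := hF x₀
  let φ := h.domChart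
  let ψ := h.codChart
  let e := h.equiv
  let c := (e (φ x₀)).2
  have hw : ∀ u ∈ φ.target, ψ (p (φ.symm u)) = (e u).1 := fun u hu =>
    h.writtenInCharts (by simpa using hu)
  have hmaps : ∀ x ∈ φ.source, p x ∈ ψ.source := h.mapsto_domChart_source_codChart_source
  have hx₀ : x₀ ∈ φ.source := h.mem_domChart_source
  have hpx₀ : ψ (p x₀) = (e (φ x₀)).1 := by
    rw [← hw _ (φ.map_source hx₀), φ.left_inv hx₀]
  let ι : E' → E := fun u => e.symm (u, c)
  have hι : ContDiff ℝ ∞ ι := e.symm.contDiff.comp (contDiff_id.prodMk contDiff_const)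
  refine ⟨fun y => φ.symm (ι (ψ y)), ψ.source ∩ ψ ⁻¹' (ι ⁻¹' φ.target), ?_, ⟨?_, ?_⟩, ?_, ?_, ?_⟩
  · exact ψ.isOpen_inter_preimage (φ.open_target.preimage hι.continuous)
  · exact hmaps _ hx₀
  · simp only [Set.mem_preimage, hpx₀, ι, c, Prod.mk.eta, e.symm_apply_apply]
    exact φ.map_source hx₀
  · refine (contMDiffOn_symm_of_mem_maximalAtlas h.domChart_mem_maximalAtlas).comp
      (hι.contMDiff.comp_contMDiffOn ((contMDiffOn_of_mem_maximalAtlas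
        h.codChart_mem_maximalAtlas).mono Set.inter_subset_left)) fun y hy => hy.2
  · simp only [hpx₀, ι, c, e.symm_apply_apply]
    exact φ.left_inv hx₀
  · rintro y ⟨hy, hy'⟩
    refine ψ.injOn (hmaps _ (φ.map_target hy')) hy ?_
    rw [hw _ hy']
    simp [ι]

theorem mfderiv_surjective_of_isSubmersion {p : C^∞⟮𝓘(ℝ, E), M; 𝓘(ℝ, E'), N⟯}
    (hp : Manifold.IsSubmersion 𝓘(ℝ, E) 𝓘(ℝ, E') ∞ p) (x : M) :
    Function.Surjective (mfderiv 𝓘(ℝ, E) 𝓘(ℝ, E') p x) := by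
  obtain ⟨s, U, hU, hx, hs, hsx, hps⟩ := exists_local_section hp x
  have hs' : MDifferentiableAt 𝓘(ℝ, E') 𝓘(ℝ, E) s (p x) :=
    (hs.contMDiffAt (hU.mem_nhds hx)).mdifferentiableAt (by simp)
  have h1 : HasMFDerivAt 𝓘(ℝ, E') 𝓘(ℝ, E') (p ∘ s) (p x)
      ((mfderiv 𝓘(ℝ, E) 𝓘(ℝ, E') p (s (p x))).comp (mfderiv 𝓘(ℝ, E') 𝓘(ℝ, E) s (p x))) :=
    (smoothMap_mdifferentiableAt p (s (p x))).hasMFDerivAt.comp _ hs'.hasMFDerivAt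
  have h2 : HasMFDerivAt 𝓘(ℝ, E') 𝓘(ℝ, E') (p ∘ s) (p x)
      (ContinuousLinearMap.id ℝ (TangentSpace 𝓘(ℝ, E') (p x))) :=
    (hasMFDerivAt_id (p x)).congr_of_eventuallyEq
      (Filter.mem_of_superset (hU.mem_nhds hx) hps)
  have h3 := hasMFDerivAt_unique h1 h2
  rw [hsx] at h3
  intro v
  exact ⟨_, congrArg (fun A : E' →L[ℝ] E' => A v) h3⟩

/-- Locally H = (H ∘ p) ∘ s for a smooth local section s of p. -/
theorem contMDiff_of_comp_submersion {p : M → N}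
    (hp : Manifold.IsSubmersion 𝓘(ℝ, E) 𝓘(ℝ, E') ∞ p) (hs : Function.Surjective p) {H : N → ℝ}
    (hH : ContMDiff 𝓘(ℝ, E) 𝓘(ℝ, ℝ) ∞ (H ∘ p)) : ContMDiff 𝓘(ℝ, E') 𝓘(ℝ, ℝ) ∞ H := by
  intro y
  obtain ⟨x, rfl⟩ := hs y
  obtain ⟨s, U, hU, hx, hsm, hsx, hps⟩ := exists_local_section hp x
  refine ((hH.comp_contMDiffOn hsm).contMDiffAt (hU.mem_nhds hx)).congr_of_eventuallyEq ?_
  filter_upwards [hU.mem_nhds hx] with y hy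
  simp [hps y hy]

/-- In an adapted chart, the segment joining two nearby points of one fibre stays in that fibre. Its
velocity is vertical, so h has zero derivative along it. -/
theorem eventually_eq_of_vertical {p : C^∞⟮𝓘(ℝ, E), M; 𝓘(ℝ, E'), N⟯}
    (hp : Manifold.IsSubmersion 𝓘(ℝ, E) 𝓘(ℝ, E') ∞ p) (h : C^∞⟮𝓘(ℝ, E), M; ℝ⟯)
    (hv : ∀ x (v : TangentSpace 𝓘(ℝ, E) x), mfderiv 𝓘(ℝ, E) 𝓘(ℝ, E') p x v = 0 →
      (dForm h x v : ℝ) = 0) (x₀ : M) :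
    ∀ᶠ x in 𝓝 x₀, p x = p x₀ → h x = h x₀ := by
  obtain ⟨F, _, _, hF⟩ := hp
  have hc := hF x₀
  let φ := hc.domChart
  let ψ := hc.codChart
  let e := hc.equiv
  have hw : ∀ u ∈ φ.target, ψ (p (φ.symm u)) = (e u).1 := fun u hu =>
    hc.writtenInCharts (by simpa using hu)
  have hmaps : ∀ x ∈ φ.source, p x ∈ ψ.source := hc.mapsto_domChart_source_codChart_source
  have hx₀ : x₀ ∈ φ.source := hc.mem_domChart_source
  obtain ⟨ε, hε, hball⟩ := Metric.isOpen_iff.1 φ.open_target _ (φ.map_source hx₀)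
  filter_upwards [φ.open_source.mem_nhds hx₀,
    (φ.continuousAt hx₀).preimage_mem_nhds (Metric.ball_mem_nhds _ hε)] with x hx hxb hpx
  let a : ℝ → E := fun t => AffineMap.lineMap (φ x₀) (φ x) t
  have ha : ContDiff ℝ ∞ a := by
    simp only [a, AffineMap.lineMap_apply_module']
    fun_prop
  let T : Set ℝ := a ⁻¹' Metric.ball (φ x₀) ε
  have hT : IsOpen T := Metric.isOpen_ball.preimage ha.continuous
  have hTc : Convex ℝ T := (convex_ball (φ x₀) ε).affine_preimage _
  have h0 : (0 : ℝ) ∈ T := by simp [T, a, hε]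
  have h1 : (1 : ℝ) ∈ T := by simpa [T, a] using hxb
  have hfst : (e (φ x)).1 = (e (φ x₀)).1 := by
    rw [← hw _ (φ.map_source hx₀), ← hw _ (φ.map_source hx), φ.left_inv hx₀, φ.left_inv hx, hpx]
  let c : ℝ → M := fun t => φ.symm (a t)
  have hcT : ∀ t ∈ T, ContMDiffAt 𝓘(ℝ, ℝ) 𝓘(ℝ, E) ∞ c t := fun t ht =>
    (contMDiffAt_symm_of_mem_maximalAtlas hc.domChart_mem_maximalAtlas (hball ht)).comp t
      ha.contMDiff.contMDiffAt
  have hpc : ∀ t ∈ T, p (c t) = p x₀ := by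
    intro t ht
    refine ψ.injOn (hmaps _ (φ.map_target (hball ht))) (hmaps _ hx₀) ?_
    rw [hw _ (hball ht)]
    conv_rhs => rw [← φ.left_inv hx₀, hw _ (φ.map_source hx₀)]
    simp only [a, AffineMap.lineMap_apply_module', map_add, map_smul, map_sub, Prod.fst_add,
      Prod.smul_fst, Prod.fst_sub, hfst, sub_self, smul_zero, zero_add]
  have hder : ∀ t ∈ T, HasDerivAt (h ∘ c) 0 t := by
    intro t ht
    have hcd := ((hcT t ht).mdifferentiableAt (by simp)).hasMFDerivAt
    have e1 : HasMFDerivAt 𝓘(ℝ, ℝ) 𝓘(ℝ, E') (p ∘ c) t _ :=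
      (smoothMap_mdifferentiableAt p (c t)).hasMFDerivAt.comp t hcd
    have e2 : HasMFDerivAt 𝓘(ℝ, ℝ) 𝓘(ℝ, E') (p ∘ c) t _ :=
      (hasMFDerivAt_const (p x₀) t).congr_of_eventuallyEq
        (Filter.mem_of_superset (hT.mem_nhds ht) hpc)
    have e3 := hasMFDerivAt_unique e1 e2
    have e4 : HasMFDerivAt 𝓘(ℝ, ℝ) 𝓘(ℝ, ℝ) (h ∘ c) t _ :=
      (smooth_mdifferentiableAt h (c t)).hasMFDerivAt.comp t hcd
    obtain ⟨A, hA, hA'⟩ : ∃ A : ℝ →L[ℝ] ℝ, HasFDerivAt (h ∘ c) A t ∧ A 1 = 0 :=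
      ⟨_, e4.hasFDerivAt, hv (c t) _ (congrArg (fun A : ℝ →L[ℝ] E' => A 1) e3)⟩
    have e5 := hA.hasDerivAt
    rwa [hA'] at e5
  have hconst := hT.is_const_of_deriv_eq_zero hTc.isPreconnected
    (f := h ∘ c) (fun t ht => (hder t ht).differentiableAt.differentiableWithinAt)
    (fun t ht => (hder t ht).deriv) h1 h0
  simpa [c, a, φ.left_inv hx₀, φ.left_inv hx] using hconst

/-- Being locally constant on each fibre, h is constant there because the fibres are connected. -/
theorem eq_of_vertical {p : C^∞⟮𝓘(ℝ, E), M; 𝓘(ℝ, E'), N⟯}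
    (hp : Manifold.IsSubmersion 𝓘(ℝ, E) 𝓘(ℝ, E') ∞ p) (hconn : ∀ y, IsConnected (p ⁻¹' {y}))
    (h : C^∞⟮𝓘(ℝ, E), M; ℝ⟯)
    (hv : ∀ x (v : TangentSpace 𝓘(ℝ, E) x), mfderiv 𝓘(ℝ, E) 𝓘(ℝ, E') p x v = 0 →
      (dForm h x v : ℝ) = 0) {x x' : M} (hx : p x = p x') : h x = h x' := by
  have := isPreconnected_iff_preconnectedSpace.1 (hconn (p x')).isPreconnected
  have hl : IsLocallyConstant fun z : p ⁻¹' {p x'} => h z := by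
    refine (IsLocallyConstant.iff_eventually_eq _).2 fun z => ?_
    have hz := continuous_subtype_val.continuousAt.eventually (eventually_eq_of_vertical hp h hv z)
    filter_upwards [hz] with w hw
    exact hw (w.2.trans z.2.symm)
  exact hl.apply_eq_of_preconnectedSpace ⟨x, hx⟩ ⟨x', rfl⟩

end Submersion

/-! ### Frames of subbundles -/

section Frame

variable {E : Type*} [NormedAddCommGroup E] [NormedSpace ℝ E] [FiniteDimensional ℝ E]
  {M : Type*} [TopologicalSpace M] [ChartedSpace E M] [IsManifold 𝓘(ℝ, E) ∞ M] [T2Space M]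
  {F : Type*} [NormedAddCommGroup F] [NormedSpace ℝ F]
  {V : M → Type*} [TopologicalSpace (TotalSpace F V)]
  [∀ x, AddCommGroup (V x)] [∀ x, Module ℝ (V x)] [∀ x, TopologicalSpace (V x)]
  [FiberBundle F V] [VectorBundle ℝ F V] {A : ∀ x : M, Submodule ℝ (V x)}

/-- Cutting off keeps the frame in A: outside the domain of the local frame the sections are zero.
-/
theorem IsSmoothSubbundle.exists_frame (hA : IsSmoothSubbundle (E := E) F A) (x₀ : M) :
    ∃ (k : ℕ) (σ : Fin k → sections (E := E) F A), ∀ᶠ x in 𝓝 x₀,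
      LinearIndependent ℝ (fun i => (σ i).1 x) ∧
        Submodule.span ℝ (Set.range fun i => (σ i).1 x) = A x := by
  obtain ⟨k, s, U, hU, hx₀, hs, hspan⟩ := hA x₀
  obtain ⟨χ, h1, h2⟩ := exists_bump (E := E) (hU.mem_nhds hx₀)
  refine ⟨k, fun i => ⟨⟨fun x => χ x • s i x, ContMDiffOn.smul_section_of_tsupport
    χ.contMDiff.contMDiffOn hU h2 (hs i)⟩, fun x => ?_⟩, ?_⟩
  · change χ x • s i x ∈ A x
    by_cases hx : x ∈ U
    · refine (A x).smul_mem _ ?_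
      rw [← (hspan x hx).2]
      exact Submodule.subset_span ⟨i, rfl⟩
    · rw [image_eq_zero_of_notMem_tsupport fun h => hx (h2 h), zero_smul]
      exact (A x).zero_mem
  · filter_upwards [h1, hU.mem_nhds hx₀] with x hx hxU
    have e : (fun i => χ x • s i x) = fun i => s i x := by
      funext i
      rw [hx, one_smul]
    change LinearIndependent ℝ (fun i => χ x • s i x) ∧
      Submodule.span ℝ (Set.range fun i => χ x • s i x) = A x
    rw [e]
    exact hspan x hxU

end Frame

/-! ### Lifting along a submersion -/

section Lift

variable {E : Type*} [NormedAddCommGroup E] [NormedSpace ℝ E] [FiniteDimensional ℝ E]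
  {M : Type*} [TopologicalSpace M] [ChartedSpace E M] [IsManifold 𝓘(ℝ, E) ∞ M] [T2Space M]
  {E' : Type*} [NormedAddCommGroup E'] [NormedSpace ℝ E'] [FiniteDimensional ℝ E']
  {N : Type*} [TopologicalSpace N] [ChartedSpace E' N] [IsManifold 𝓘(ℝ, E') ∞ N] [T2Space N]

/-- The vector fields `V` on `M` and `V'` on `N` are `p`-related. -/
def IsRelated (p : C^∞⟮𝓘(ℝ, E), M; 𝓘(ℝ, E'), N⟯) (V : SmoothVectorField E M)
    (V' : SmoothVectorField E' N) : Prop :=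
  ∀ x, mfderiv 𝓘(ℝ, E) 𝓘(ℝ, E') p x (V x) = V' (p x)

variable {p : C^∞⟮𝓘(ℝ, E), M; 𝓘(ℝ, E'), N⟯}

theorem pullbackCovector_apply (x : M) (α : CotangentSpace E' (p x))
    (v : TangentSpace 𝓘(ℝ, E) x) :
    (pullbackCovector p x α v : ℝ) = α (mfderiv 𝓘(ℝ, E) 𝓘(ℝ, E') p x v) := rfl

theorem IsRelated.lie_pullbackFunction {V : SmoothVectorField E M} {V' : SmoothVectorField E' N}
    (h : IsRelated p V V') (g : C^∞⟮𝓘(ℝ, E'), N; ℝ⟯) :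
    ⁅V, pullbackFunction p g⁆ = pullbackFunction p ⁅V', g⁆ := by
  ext x
  change (dForm (g ∘ p) x (V x) : ℝ) = dForm g (p x) (V' (p x))
  rw [dForm_comp, h x]

theorem isRelated_of_functions {V : SmoothVectorField E M} {V' : SmoothVectorField E' N}
    (h : ∀ g : C^∞⟮𝓘(ℝ, E'), N; ℝ⟯, ⁅V, pullbackFunction p g⁆ = pullbackFunction p ⁅V', g⁆) :
    IsRelated p V V' := by
  refine fun x => tangent_ext fun g => ?_
  rw [← dForm_comp]
  exact congrArg (fun f : C^∞⟮𝓘(ℝ, E), M; ℝ⟯ => f x) (h g)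

theorem IsRelated.lie {V W : SmoothVectorField E M} {V' W' : SmoothVectorField E' N}
    (hV : IsRelated p V V') (hW : IsRelated p W W') : IsRelated p ⁅V, W⁆ ⁅V', W'⁆ := by
  refine isRelated_of_functions fun g => ?_
  rw [lie_lie, hW.lie_pullbackFunction, hV.lie_pullbackFunction, hV.lie_pullbackFunction,
    hW.lie_pullbackFunction, lie_lie]
  rfl

theorem exists_eq_sum_of_frame {x : M} {g : Fin (Module.finrank ℝ E) → C^∞⟮𝓘(ℝ, E), M; ℝ⟯}
    {V : Fin (Module.finrank ℝ E) → SmoothVectorField E M}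
    (h : ∀ v : TangentSpace 𝓘(ℝ, E) x, ∑ i, (dForm (g i) x v : ℝ) • V i x = v)
    {v w : TangentSpace 𝓘(ℝ, E) x} (hvw : ∀ i, (dForm (g i) x v : ℝ) = dForm (g i) x w) :
    v = w := by
  rw [← h v, ← h w]
  simp only [hvw]

theorem dForm_sum_smul (f : C^∞⟮𝓘(ℝ, E), M; ℝ⟯) (x : M) {ι : Type*} [Fintype ι] (c : ι → ℝ)
    (v : ι → TangentSpace 𝓘(ℝ, E) x) :
    (dForm f x (∑ i, c i • v i) : ℝ) = ∑ i, c i * (dForm f x (v i) : ℝ) :=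
  covector_apply_eq_sum (dForm f x) c v

theorem contMDiff_sum_smulVF {k : ℕ} (c : Fin k → C^∞⟮𝓘(ℝ, E), M; ℝ⟯)
    (W : Fin k → SmoothVectorField E M) :
    ContMDiff 𝓘(ℝ, E) (𝓘(ℝ, E).prod 𝓘(ℝ, E)) ∞
      (fun x => TotalSpace.mk' E x (∑ a, c a x • W a x) : M → TangentBundle 𝓘(ℝ, E) M) :=
  ContMDiff.sum_section fun a _ => (c a).contMDiff.smul_section (W a).contMDiff

variable [SigmaCompactSpace M]

/-- Lifts of V' form affine subspaces of the tangent spaces, so local lifts glue by a partition of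
unity. A local lift ∑ cₐ Wₐ solves the linear system ∑ₐ Wₐ(p^*gᵢ) cₐ = p^*(V'(gᵢ)), which is
surjective at `x₀` because dp is. -/
theorem exists_isRelated (hp : Manifold.IsSubmersion 𝓘(ℝ, E) 𝓘(ℝ, E') ∞ p)
    (V' : SmoothVectorField E' N) : ∃ V : SmoothVectorField E M, IsRelated p V V' := by
  refine exists_contMDiffSection_forall_mem_convex_of_local (n := ⊤) 𝓘(ℝ, E)
    (TangentSpace 𝓘(ℝ, E) : M → Type _)
    (fun x => {v | mfderiv 𝓘(ℝ, E) 𝓘(ℝ, E') p x v = V' (p x)}) (fun x => ?_) fun x₀ => ?_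
  · intro v hv w hw a b _ _ hab
    change mfderiv 𝓘(ℝ, E) 𝓘(ℝ, E') p x (a • v + b • w) = V' (p x)
    rw [map_add, map_smul, map_smul, hv, hw, ← add_smul, hab, one_smul]
  obtain ⟨g, W', hgW'⟩ := exists_coordinate_frame (E := E') (p x₀)
  obtain ⟨h, W, hhW⟩ := exists_coordinate_frame (E := E) x₀
  obtain ⟨c, hc⟩ := exists_smooth_solution (fun i a => ⁅W a, pullbackFunction p (g i)⁆)
    (fun i => pullbackFunction p ⁅V', g i⁆) x₀ fun y => by
      obtain ⟨v, hv⟩ := mfderiv_surjective_of_isSubmersion hp x₀ (∑ j, y j • W' j (p x₀))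
      refine ⟨fun a => dForm (h a) x₀ v, fun i => ?_⟩
      change ∑ a, (dForm (g i ∘ p) x₀ (W a x₀) : ℝ) * (dForm (h a) x₀ v : ℝ) = y i
      simp only [mul_comm (dForm (g i ∘ p) x₀ _ : ℝ)]
      rw [← covector_apply_eq_sum, hhW.self_of_nhds.1 v, dForm_comp, hv, dForm_sum_smul]
      simp only [hgW'.self_of_nhds.2]
      simp
  refine ⟨_, Filter.inter_mem hc (p.contMDiff.continuous.continuousAt.eventually hgW'),
    fun x => ∑ a, c a x • W a x, (contMDiff_sum_smulVF c W).contMDiffOn, ?_⟩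
  rintro x ⟨hx, hx'⟩
  refine exists_eq_sum_of_frame hx'.1 fun i => ?_
  rw [← dForm_comp]
  refine (dForm_sum_smul (pullbackFunction p (g i)) x (fun a => c a x) fun a => W a x).trans ?_
  refine Eq.trans ?_ (hx i)
  exact Finset.sum_congr rfl fun a _ => mul_comm _ _

/-- Every tangent vector is the value of a projectable field plus a vertical vector. -/
theorem covector_ext_of_isRelated (hp : Manifold.IsSubmersion 𝓘(ℝ, E) 𝓘(ℝ, E') ∞ p) {x : M}
    {ξ η : CotangentSpace E x}
    (hver : ∀ v, mfderiv 𝓘(ℝ, E) 𝓘(ℝ, E') p x v = 0 → (ξ v : ℝ) = η v)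
    (hrel : ∀ V V', IsRelated p V V' → (ξ (V x) : ℝ) = η (V x)) : ξ = η := by
  refine covector_ext fun v => ?_
  obtain ⟨V', hV'⟩ := exists_vectorField_eq (p x) (mfderiv 𝓘(ℝ, E) 𝓘(ℝ, E') p x v)
  obtain ⟨V, hV⟩ := exists_isRelated hp V'
  have h1 := hver (v - V x) (by rw [map_sub, hV x, hV', sub_self])
  have h2 := hrel V V' hV
  rw [map_sub, map_sub, h2] at h1
  exact sub_left_injective h1

/-- Extend v to a field W and subtract ∑ W(p^*gᵢ) Vᵢ, where the Vᵢ lift a coordinate frame of N. The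
difference is vertical where the frame is valid, and the correction vanishes at `x₀` since v is
vertical. -/
theorem exists_vertical_vectorField (hp : Manifold.IsSubmersion 𝓘(ℝ, E) 𝓘(ℝ, E') ∞ p) (x₀ : M)
    (v : TangentSpace 𝓘(ℝ, E) x₀) (hv : mfderiv 𝓘(ℝ, E) 𝓘(ℝ, E') p x₀ v = 0) :
    ∃ Z : SmoothVectorField E M, IsRelated p Z 0 ∧ Z x₀ = v := by
  obtain ⟨W, hW⟩ := exists_vectorField_eq x₀ v
  obtain ⟨g, V', hgV'⟩ := exists_coordinate_frame (E := E') (p x₀)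
  choose V hV using fun i => exists_isRelated hp (V' i)
  obtain ⟨χ, h1, h2⟩ := exists_bump (E := E) (p.contMDiff.continuous.continuousAt.eventually hgV')
  let W₁ : SmoothVectorField E M :=
    ⟨_, contMDiff_sum_smulVF (fun i => ⁅W, pullbackFunction p (g i)⁆) V⟩
  have hW₁ : ∀ x, W₁ x = ∑ i, (dForm (g i) (p x) (mfderiv 𝓘(ℝ, E) 𝓘(ℝ, E') p x (W x)) : ℝ) •
      V i x := fun x => by
    simp only [← dForm_comp]
    rfl
  refine ⟨smulVF χ (W - W₁), fun x => ?_, ?_⟩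
  · change mfderiv 𝓘(ℝ, E) 𝓘(ℝ, E') p x (χ x • (W x - W₁ x)) = 0
    rw [map_smul]
    by_cases hx : x ∈ tsupport χ
    · have h3 := (h2 hx).1 (mfderiv 𝓘(ℝ, E) 𝓘(ℝ, E') p x (W x))
      rw [map_sub, hW₁, map_sum]
      simp only [map_smul, hV _ x]
      rw [h3, sub_self, smul_zero]
    · rw [image_eq_zero_of_notMem_tsupport hx, zero_smul]
  · change χ x₀ • (W x₀ - W₁ x₀) = v
    rw [h1.self_of_nhds, one_smul, hW₁, hW, hv]
    simp

end Lift

/-! ### Lifting 1-forms of the quotient to sections of L -/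

section LiftDirac

variable {E : Type*} [NormedAddCommGroup E] [NormedSpace ℝ E] [FiniteDimensional ℝ E]
  {M : Type*} [TopologicalSpace M] [ChartedSpace E M] [IsManifold 𝓘(ℝ, E) ∞ M] [T2Space M]
  [SigmaCompactSpace M]
  {E' : Type*} [NormedAddCommGroup E'] [NormedSpace ℝ E'] [FiniteDimensional ℝ E']
  {N : Type*} [TopologicalSpace N] [ChartedSpace E' N] [IsManifold 𝓘(ℝ, E') ∞ N] [T2Space N]
  {L : ∀ x : M, Submodule ℝ (GenTangent E x)} {p : C^∞⟮𝓘(ℝ, E), M; 𝓘(ℝ, E'), N⟯}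

theorem IsReducible.surjective (hp : IsReducible L p) : Function.Surjective p :=
  fun y => (hp.fibre_connected y).nonempty

theorem IsReducible.mem_iff (hp : IsReducible L p) {x : M} {v : TangentSpace 𝓘(ℝ, E) x} :
    ((v, 0) : GenTangent E x) ∈ L x ↔ mfderiv 𝓘(ℝ, E) 𝓘(ℝ, E') p x v = 0 := by
  change v ∈ charDistribution L x ↔ _
  rw [← hp.fibre_tangent x]
  exact LinearMap.mem_ker

theorem IsReducible.covector_eq_zero (hL : IsDirac L) (hp : IsReducible L p) {x : M}
    {w : GenTangent E x} (hw : w ∈ L x) {v : TangentSpace 𝓘(ℝ, E) x}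
    (hv : mfderiv 𝓘(ℝ, E) 𝓘(ℝ, E') p x v = 0) : (w.2 v : ℝ) = 0 :=
  covector_eq_zero_of_mem_charDistribution hL.isotropic hw (hp.mem_iff.2 hv)

theorem IsReducible.exists_mem (hL : IsDirac L) (hp : IsReducible L p) (x : M)
    (α : CotangentSpace E' (p x)) :
    ∃ X : TangentSpace 𝓘(ℝ, E) x, ((X, pullbackCovector p x α) : GenTangent E x) ∈ L x := by
  refine hL.exists_mem_of_annihilates fun Z hZ => ?_
  rw [pullbackCovector_apply, hp.mem_iff.1 hZ, map_zero]

/-- The admissible values of X at a point form an affine subspace, so a partition of unity reduces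
the claim to a local one. There one seeks a combination of a frame of L whose covector part agrees
with p^*α on lifts Vᵢ of a coordinate frame of N. This system is surjective at `x₀` by
`IsReducible.exists_mem`. -/
theorem IsReducible.exists_vectorField (hL : IsDirac L) (hp : IsReducible L p)
    (α : OneForm E' N) : ∃ X : SmoothVectorField E M,
      ∀ x, ((X x, pullbackCovector p x (α (p x))) : GenTangent E x) ∈ L x := by
  refine exists_contMDiffSection_forall_mem_convex_of_local (n := ⊤) 𝓘(ℝ, E)
    (TangentSpace 𝓘(ℝ, E) : M → Type _)
    (fun x => {v | ((v, pullbackCovector p x (α (p x))) : GenTangent E x) ∈ L x})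
    (fun x => ?_) fun x₀ => ?_
  · intro v hv w hw a b _ _ hab
    have h := (L x).add_mem ((L x).smul_mem a hv) ((L x).smul_mem b hw)
    have e : a • ((v, pullbackCovector p x (α (p x))) : GenTangent E x) +
        b • ((w, pullbackCovector p x (α (p x))) : GenTangent E x) =
        (a • v + b • w, pullbackCovector p x (α (p x))) :=
      Prod.ext rfl ((add_smul _ _ _).symm.trans (by rw [hab, one_smul]))
    rw [e] at h
    exact h
  obtain ⟨g, V', hgV'⟩ := exists_coordinate_frame (E := E') (p x₀)
  choose V hV using fun i => exists_isRelated hp.submersion (V' i)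
  obtain ⟨k, σ, hσ⟩ := hL.isSubbundle.exists_frame x₀
  obtain ⟨c, hc⟩ := exists_smooth_solution
    (fun i a => contract (GenSection.form (σ a).1) (V i))
    (fun i => pullbackFunction p (contract α (V' i))) x₀ fun y => by
      obtain ⟨X, hX⟩ := hp.exists_mem hL x₀
        (∑ j, y j • (dForm (g j) (p x₀) : CotangentSpace E' (p x₀)))
      rw [← hσ.self_of_nhds.2] at hX
      obtain ⟨c, hc⟩ := (Submodule.mem_span_range_iff_exists_fun ℝ).1 hX
      refine ⟨c, fun i => ?_⟩
      have h2 := congrArg (fun w : GenTangent E x₀ => (w.2 (V i x₀) : ℝ)) hc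
      have h3 : ((∑ a, c a • (σ a).1 x₀ : GenTangent E x₀).2 (V i x₀) : ℝ) =
          ∑ a, c a * (((σ a).1 x₀).2 (V i x₀) : ℝ) := by
        rw [Prod.snd_sum]
        exact sum_covector_apply c (fun a => ((σ a).1 x₀).2) _
      have h4 : (pullbackCovector p x₀
          (∑ j, y j • (dForm (g j) (p x₀) : CotangentSpace E' (p x₀))) (V i x₀) : ℝ) = y i := by
        rw [pullbackCovector_apply, hV i x₀, sum_covector_apply]
        simp only [hgV'.self_of_nhds.2]
        simp
      rw [h3] at h2
      refine Eq.trans (Finset.sum_congr rfl fun a _ => mul_comm _ _) (h2.trans h4)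
  refine ⟨_, Filter.inter_mem hc (p.contMDiff.continuous.continuousAt.eventually hgV'),
    fun x => ∑ a, c a x • GenSection.vec (σ a).1 x, (contMDiff_sum_smulVF c _).contMDiffOn, ?_⟩
  rintro x ⟨hx, hx'⟩
  have hmem : (∑ a, c a x • (σ a).1 x : GenTangent E x) ∈ L x :=
    (L x).sum_mem fun a _ => (L x).smul_mem _ ((σ a).2 x)
  have e : (∑ a, c a x • (σ a).1 x : GenTangent E x) =
      (∑ a, c a x • GenSection.vec (σ a).1 x, pullbackCovector p x (α (p x))) := by
    refine Prod.ext ?_ (covector_ext fun v => ?_)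
    · rw [Prod.fst_sum]
      rfl
    -- Agreement on the lifts `V i` suffices: v minus its combination of lifts is vertical, and both
    -- covectors vanish on vertical vectors.
    · have hv := hp.covector_eq_zero hL hmem
        (v := v - ∑ i, (dForm (g i) (p x) (mfderiv 𝓘(ℝ, E) 𝓘(ℝ, E') p x v) : ℝ) • V i x) (by
          rw [map_sub, map_sum]
          simp only [map_smul, hV _ x]
          rw [hx'.1, sub_self])
      rw [map_sub, sub_eq_zero] at hv
      refine hv.trans ?_
      rw [pullbackCovector_apply]
      conv_rhs => rw [← hx'.1 (mfderiv 𝓘(ℝ, E) 𝓘(ℝ, E') p x v)]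
      rw [covector_apply_eq_sum, covector_apply_eq_sum]
      refine Finset.sum_congr rfl fun i _ => ?_
      congr 1
      rw [Prod.snd_sum]
      refine (sum_covector_apply (fun a => c a x) (fun a => ((σ a).1 x).2) _).trans ?_
      exact (Finset.sum_congr rfl fun a _ => mul_comm _ _).trans (hx i)
  rw [e] at hmem
  exact hmem

end LiftDirac

/-! ### Tensorial maps are 1-forms -/

section Tensorial

variable {E : Type*} [NormedAddCommGroup E] [NormedSpace ℝ E] [FiniteDimensional ℝ E]
  {M : Type*} [TopologicalSpace M] [ChartedSpace E M] [IsManifold 𝓘(ℝ, E) ∞ M] [T2Space M]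

theorem sum_vectorField_apply {ι : Type*} (s : Finset ι) (V : ι → SmoothVectorField E M) (x : M) :
    (∑ i ∈ s, V i) x = ∑ i ∈ s, V i x :=
  map_sum (⟨⟨fun W => W x, rfl⟩, fun _ _ => rfl⟩ :
    SmoothVectorField E M →+ TangentSpace 𝓘(ℝ, E) x) V s

theorem sum_function_apply {ι : Type*} (s : Finset ι) (f : ι → C^∞⟮𝓘(ℝ, E), M; ℝ⟯) (x : M) :
    (∑ i ∈ s, f i) x = ∑ i ∈ s, f i x :=
  map_sum (⟨⟨fun g => g x, rfl⟩, fun _ _ => rfl⟩ : C^∞⟮𝓘(ℝ, E), M; ℝ⟯ →+ ℝ) f s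

/-- The value of T V at x depends only on V(x): for a bump function χ supported where the coordinate
frame is valid, χV = ∑ χ V(gᵢ) Wᵢ, and the coefficients vanish at x when V(x) = 0. -/
theorem exists_oneForm_of_tensorial (T : SmoothVectorField E M →ₗ[ℝ] C^∞⟮𝓘(ℝ, E), M; ℝ⟯)
    (hT : ∀ f V, T (smulVF f V) = f * T V) : ∃ γ : OneForm E M, contractHom γ = T := by
  have h0 : ∀ (x : M) (V : SmoothVectorField E M), V x = 0 → T V x = 0 := by
    intro x V hV
    obtain ⟨g, W, hgW⟩ := exists_coordinate_frame (E := E) x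
    obtain ⟨χ, h1, h2⟩ := exists_bump (E := E) hgW
    have e : smulVF χ V = ∑ i, smulVF (χ * ⁅V, g i⁆) (W i) := by
      ext1 y
      have e1 : (∑ i, smulVF (χ * ⁅V, g i⁆) (W i)) y =
          ∑ i, χ y • ((dForm (g i) y (V y) : ℝ) • W i y) := by
        rw [sum_vectorField_apply]
        exact Finset.sum_congr rfl fun i _ => mul_smul _ _ _
      rw [e1, ← Finset.smul_sum]
      change χ y • V y = _
      by_cases hy : y ∈ tsupport χ
      · rw [(h2 hy).1]
      · rw [image_eq_zero_of_notMem_tsupport hy, zero_smul, zero_smul]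
    have e2 := congrArg (fun f : C^∞⟮𝓘(ℝ, E), M; ℝ⟯ => f x) (congrArg T e)
    simp only [map_sum, hT] at e2
    change χ x * T V x = _ at e2
    rw [h1.self_of_nhds, one_mul] at e2
    rw [e2, sum_function_apply]
    refine Finset.sum_eq_zero fun i _ => ?_
    change χ x * (dForm (g i) x (V x) : ℝ) * T (W i) x = 0
    rw [hV, map_zero, mul_zero, zero_mul]
  have h1 : ∀ (x : M) (V W : SmoothVectorField E M), V x = W x → T V x = T W x := by
    intro x V W h
    have h2 := h0 x (V - W) (sub_eq_zero.2 h)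
    rw [map_sub] at h2
    exact sub_eq_zero.1 h2
  choose ext hext using fun (x : M) (v : TangentSpace 𝓘(ℝ, E) x) => exists_vectorField_eq x v
  let γ₀ : ∀ x : M, TangentSpace 𝓘(ℝ, E) x →ₗ[ℝ] ℝ := fun x =>
    { toFun := fun v => T (ext x v) x
      map_add' := fun v w => by
        rw [h1 x (ext x (v + w)) (ext x v + ext x w)
          ((hext x (v + w)).trans (congrArg₂ (· + ·) (hext x v) (hext x w)).symm), map_add]
        rfl
      map_smul' := fun c v => by
        rw [h1 x (ext x (c • v)) (c • ext x v)
          ((hext x (c • v)).trans (congrArg (c • ·) (hext x v)).symm), map_smul]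
        rfl }
  let γ : ∀ x : M, CotangentSpace E x := fun x =>
    (LinearMap.toContinuousLinearMap (show E →ₗ[ℝ] ℝ from γ₀ x) : E →L[ℝ] ℝ)
  have hγ : ∀ (V : SmoothVectorField E M) x, (γ x (V x) : ℝ) = T V x := fun V x =>
    h1 x _ _ (hext x (V x))
  refine ⟨⟨γ, fun x => contMDiffAt_oneForm_of_test fun V => ?_⟩, ?_⟩
  · simp only [hγ]
    exact (T V).contMDiff x
  · ext V x
    exact hγ V x

theorem exists_oneForm_dorfmanForm (X : SmoothVectorField E M) (α : OneForm E M)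
    (Y : SmoothVectorField E M) (β : OneForm E M) :
    ∃ γ : OneForm E M, ∀ V, contractHom γ V =
      dorfmanForm X (contractHom α) Y (contractHom β) V := by
  obtain ⟨γ, hγ⟩ := exists_oneForm_of_tensorial
    { toFun := dorfmanForm X (contractHom α) Y (contractHom β)
      map_add' := fun V W => by
        simp only [dorfmanForm, lie_add, map_add, add_lie]
        abel
      map_smul' := fun c V => by
        simp only [dorfmanForm, lie_smul, map_smul, smul_lie, smul_add, smul_sub,
          RingHom.id_apply] }
    fun f V => by
      change dorfmanForm X (contractHom α) Y (contractHom β) (smulVF f V) =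
        f * dorfmanForm X (contractHom α) Y (contractHom β) V
      have e : ∀ (Z : SmoothVectorField E M) (δ : OneForm E M),
          ⁅Z, contractHom δ (smulVF f V)⁆ - contractHom δ ⁅Z, smulVF f V⁆ =
            f * (⁅Z, contractHom δ V⁆ - contractHom δ ⁅Z, V⁆) := by
        intro Z δ
        rw [lie_smulVF, map_add, contractHom_smulVF, contractHom_smulVF, contractHom_smulVF,
          lie_mul_smooth]
        change ⁅Z, f⁆ * _ + _ - (⁅Z, f⁆ * _ + _) = _
        ring
      have e1 := e X β
      have e2 := e Y α
      have e3 := smulVF_lie_function V f (contractHom α Y)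
      unfold dorfmanForm
      linear_combination e1 - e2 + e3
  exact ⟨γ, fun V => congrArg (fun T : _ →ₗ[ℝ] _ => T V) hγ⟩

/-- L_X dg = d(X(g)), while i_Y ddf = 0. -/
theorem dorfmanForm_exact (f g : C^∞⟮𝓘(ℝ, E), M; ℝ⟯) (X Y V : SmoothVectorField E M) :
    dorfmanForm X (contractHom (exactForm f)) Y (contractHom (exactForm g)) V = ⁅V, ⁅X, g⁆⁆ := by
  change ⁅X, ⁅V, g⁆⁆ - ⁅⁅X, V⁆, g⁆ - ⁅Y, ⁅V, f⁆⁆ + ⁅⁅Y, V⁆, f⁆ + ⁅V, ⁅Y, f⁆⁆ = _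
  rw [lie_lie, lie_lie]
  abel

end Tensorial

/-! ### The bundle map induced on the quotient -/

section Pullback

variable {E : Type*} [NormedAddCommGroup E] [NormedSpace ℝ E] [FiniteDimensional ℝ E]
  {M : Type*} [TopologicalSpace M] [ChartedSpace E M] [IsManifold 𝓘(ℝ, E) ∞ M] [T2Space M]
  {E' : Type*} [NormedAddCommGroup E'] [NormedSpace ℝ E'] [FiniteDimensional ℝ E']
  {N : Type*} [TopologicalSpace N] [ChartedSpace E' N] [IsManifold 𝓘(ℝ, E') ∞ N] [T2Space N]
  {p : C^∞⟮𝓘(ℝ, E), M; 𝓘(ℝ, E'), N⟯}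

theorem contMDiffAt_pullbackCovector {ξ : ∀ x, CotangentSpace E' (p x)} {x₀ : M}
    (hξ : ContMDiffAt 𝓘(ℝ, E) (𝓘(ℝ, E').prod 𝓘(ℝ, E' →L[ℝ] ℝ)) ∞
      (fun x => TotalSpace.mk' (E' →L[ℝ] ℝ) (p x) (ξ x)) x₀) :
    ContMDiffAt 𝓘(ℝ, E) (𝓘(ℝ, E).prod 𝓘(ℝ, E →L[ℝ] ℝ)) ∞
      (fun x => TotalSpace.mk' (E →L[ℝ] ℝ) x (pullbackCovector p x (ξ x))) x₀ := by
  refine contMDiffAt_oneForm_of_test fun V => ?_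
  have h1 : ContMDiff 𝓘(ℝ, E).tangent 𝓘(ℝ, E').tangent ∞ (tangentMap 𝓘(ℝ, E) 𝓘(ℝ, E') p) :=
    p.contMDiff.contMDiff_tangentMap (by simp)
  exact contMDiffAt_covector_apply_along p hξ ((h1.comp V.contMDiff) x₀)

/-- The pullback of a 1-form. -/
def pullbackForm (p : C^∞⟮𝓘(ℝ, E), M; 𝓘(ℝ, E'), N⟯) (α : OneForm E' N) : OneForm E M :=
  ⟨fun x => pullbackCovector p x (α (p x)), fun x =>
    contMDiffAt_pullbackCovector ((α.contMDiff.comp p.contMDiff) x)⟩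

theorem contractHom_pullbackForm {V : SmoothVectorField E M} {V' : SmoothVectorField E' N}
    (h : IsRelated p V V') (α : OneForm E' N) :
    contractHom (pullbackForm p α) V = pullbackFunction p (contractHom α V') := by
  ext x
  change (α (p x) (mfderiv 𝓘(ℝ, E) 𝓘(ℝ, E') p x (V x)) : ℝ) = α (p x) (V' (p x))
  rw [h x]

/-- Naturality of the Dorfman bracket: each of its terms is compatible with relatedness. -/
theorem IsRelated.dorfmanForm {X Y V : SmoothVectorField E M} {A B W : SmoothVectorField E' N}
    (hX : IsRelated p X A) (hY : IsRelated p Y B) (hV : IsRelated p V W) (α β : OneForm E' N) :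
    DiracGeometry.dorfmanForm X (contractHom (pullbackForm p α)) Y
        (contractHom (pullbackForm p β)) V =
      pullbackFunction p (DiracGeometry.dorfmanForm A (contractHom α) B (contractHom β) W) := by
  unfold DiracGeometry.dorfmanForm
  rw [contractHom_pullbackForm hV, contractHom_pullbackForm hV, contractHom_pullbackForm hY,
    contractHom_pullbackForm (hX.lie hV), contractHom_pullbackForm (hY.lie hV),
    hX.lie_pullbackFunction, hY.lie_pullbackFunction, hV.lie_pullbackFunction]
  rfl

end Pullback

/-! ### Projectability of the lifts and the bundle map π^♯ -/

section Sharp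

variable {E : Type*} [NormedAddCommGroup E] [NormedSpace ℝ E] [FiniteDimensional ℝ E]
  {M : Type*} [TopologicalSpace M] [ChartedSpace E M] [IsManifold 𝓘(ℝ, E) ∞ M] [T2Space M]
  [SigmaCompactSpace M]
  {E' : Type*} [NormedAddCommGroup E'] [NormedSpace ℝ E'] [FiniteDimensional ℝ E']
  {N : Type*} [TopologicalSpace N] [ChartedSpace E' N] [IsManifold 𝓘(ℝ, E') ∞ N] [T2Space N]
  {L : ∀ x : M, Submodule ℝ (GenTangent E x)} {p : C^∞⟮𝓘(ℝ, E), M; 𝓘(ℝ, E'), N⟯}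

/-- The bracket of Z + 0 and X + p^*α is a section of L with vector part [Z, X]. Its covector part
vanishes on vertical vectors by isotropy, and on projectable fields because Z annihilates
pulled-back functions. Hence [Z, X] lies in L ∩ TM = ker dp. -/
theorem IsReducible.isRelated_lie_zero (hL : IsDirac L) (hp : IsReducible L p)
    {Z X : SmoothVectorField E M} (hZ : IsRelated p Z 0) {α : OneForm E' N}
    (hX : ∀ x, ((X x, pullbackCovector p x (α (p x))) : GenTangent E x) ∈ L x) :
    IsRelated p ⁅Z, X⁆ 0 := by
  let σ : sections (E := E) (E × (E →L[ℝ] ℝ)) L :=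
    ⟨GenSection.mk Z 0, fun x => hp.mem_iff.2 (hZ x)⟩
  let τ : sections (E := E) (E × (E →L[ℝ] ℝ)) L := ⟨GenSection.mk X (pullbackForm p α), hX⟩
  let υ := hL.isInvolutive.bracketFun σ τ
  have hvec : GenSection.vec υ.1 = ⁅Z, X⁆ := hL.isInvolutive.bracketFun_vec σ τ
  intro x
  have hform : (υ.1 x).2 = 0 := by
    refine covector_ext_of_isRelated hp.submersion (fun v hv => hp.covector_eq_zero hL (υ.2 x) hv)
      fun V V' hV => ?_
    have h1 := hL.isInvolutive.bracketFun_form σ τ V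
    have hσ : contractHom (GenSection.form σ.1) = 0 := rfl
    have hβ : contractHom (GenSection.form τ.1) = contractHom (pullbackForm p α) := rfl
    have h0 : ∀ W : SmoothVectorField E M, ⁅W, (0 : C^∞⟮𝓘(ℝ, E), M; ℝ⟯)⁆ = 0 := lie_zero
    rw [hσ, hβ] at h1
    change _ = ⁅Z, contractHom (pullbackForm p α) V⁆ - contractHom (pullbackForm p α) ⁅Z, V⁆ -
      ⁅X, (0 : C^∞⟮𝓘(ℝ, E), M; ℝ⟯)⁆ + 0 + ⁅V, (0 : C^∞⟮𝓘(ℝ, E), M; ℝ⟯)⁆ at h1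
    rw [h0, h0, contractHom_pullbackForm hV, contractHom_pullbackForm (hZ.lie hV),
      hZ.lie_pullbackFunction, zero_lie, zero_lie, map_zero] at h1
    have h2 := congrArg (fun f : C^∞⟮𝓘(ℝ, E), M; ℝ⟯ => f x) h1
    refine h2.trans ?_
    change (0 : ℝ) - 0 - 0 + 0 + 0 = 0
    norm_num
  have hmem := υ.2 x
  have e : (υ.1 x : GenTangent E x) = (⁅Z, X⁆ x, 0) :=
    Prod.ext (congrArg (fun V : SmoothVectorField E M => V x) hvec) hform
  rw [e] at hmem
  exact hp.mem_iff.1 hmem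

/-- For Z vertical, Z(X(p^*g)) = [Z, X](p^*g) + X(Z(p^*g)) = 0, so X(p^*g) is constant on fibres and
p_*X depends only on the point of N. Smoothness of the projected field is tested on functions and
descends along p. -/
theorem IsReducible.exists_isRelated (hL : IsDirac L) (hp : IsReducible L p)
    {X : SmoothVectorField E M} {α : OneForm E' N}
    (hX : ∀ x, ((X x, pullbackCovector p x (α (p x))) : GenTangent E x) ∈ L x) :
    ∃ A : SmoothVectorField E' N, IsRelated p X A := by
  have hconst : ∀ (g : C^∞⟮𝓘(ℝ, E'), N; ℝ⟯) {x x' : M}, p x = p x' →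
      ⁅X, pullbackFunction p g⁆ x = ⁅X, pullbackFunction p g⁆ x' := by
    refine fun g => eq_of_vertical hp.submersion hp.fibre_connected _ fun x v hv => ?_
    obtain ⟨Z, hZ, rfl⟩ := exists_vertical_vectorField hp.submersion x v hv
    change ⁅Z, ⁅X, pullbackFunction p g⁆⁆ x = 0
    rw [leibniz_lie, (hp.isRelated_lie_zero hL hZ hX).lie_pullbackFunction,
      hZ.lie_pullbackFunction, zero_lie]
    change (0 : ℝ) + ⁅X, (0 : C^∞⟮𝓘(ℝ, E), M; ℝ⟯)⁆ x = 0
    rw [lie_zero]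
    exact zero_add _
  choose s hs using hp.surjective
  let A : ∀ y : N, TangentSpace 𝓘(ℝ, E') y := fun y =>
    (mfderiv 𝓘(ℝ, E) 𝓘(ℝ, E') p (s y) (X (s y)) : E')
  -- The set-theoretic section only gives `p (s (p x)) = p x` propositionally. All tangent spaces of
  -- N are the model space `E'`, so vectors at equal points can be compared there.
  have hcast : ∀ {y y' : N} (_ : y = y') (v : TangentSpace 𝓘(ℝ, E') y)
      (w : TangentSpace 𝓘(ℝ, E') y'),
      (∀ g : C^∞⟮𝓘(ℝ, E'), N; ℝ⟯, (dForm g y v : ℝ) = dForm g y' w) → (v : E') = w := by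
    rintro y _ rfl v w h
    exact tangent_ext h
  have hA : ∀ x, mfderiv 𝓘(ℝ, E) 𝓘(ℝ, E') p x (X x) = A (p x) := by
    intro x
    refine hcast (hs (p x)).symm _ (mfderiv 𝓘(ℝ, E) 𝓘(ℝ, E') p _ (X (s (p x)))) fun g => ?_
    rw [← dForm_comp, ← dForm_comp]
    exact hconst g (hs (p x)).symm
  refine ⟨⟨A, fun y => contMDiffAt_vectorField_of_test fun g => ?_⟩, hA⟩
  refine contMDiff_of_comp_submersion hp.submersion hp.surjective ?_ y
  have e : lieD A g ∘ p = ⁅X, pullbackFunction p g⁆ := by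
    funext x
    change (dForm g (p x) (A (p x)) : ℝ) = dForm (g ∘ p) x (X x)
    rw [dForm_comp, hA]
  rw [e]
  exact ContMDiffMap.contMDiff _

/-- Two vectors paired with the same covector in L differ by an element of L ∩ TM = ker dp, so their
projections agree. -/
theorem IsReducible.exists_sharp_oneForm (hL : IsDirac L) (hp : IsReducible L p)
    (α : OneForm E' N) : ∃ A : SmoothVectorField E' N,
      ∀ x (v : TangentSpace 𝓘(ℝ, E) x),
        ((v, pullbackCovector p x (α (p x))) : GenTangent E x) ∈ L x →
          mfderiv 𝓘(ℝ, E) 𝓘(ℝ, E') p x v = A (p x) := by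
  obtain ⟨X, hX⟩ := hp.exists_vectorField hL α
  obtain ⟨A, hA⟩ := hp.exists_isRelated hL hX
  refine ⟨A, fun x v hv => ?_⟩
  have h := (L x).sub_mem hv (hX x)
  have e : ((v, pullbackCovector p x (α (p x))) : GenTangent E x) -
      ((X x, pullbackCovector p x (α (p x))) : GenTangent E x) = (v - X x, 0) :=
    Prod.ext rfl (sub_self _)
  rw [e] at h
  have h2 := hp.mem_iff.1 h
  rw [map_sub, hA x] at h2
  exact sub_eq_zero.1 h2

/-- L is the backward image of the graph of S. To define S, each covector is extended to an exact
form; the projected value does not depend on the extension, and it is linear since L is a subspace.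
Conversely, a vector with the right projection differs from an admissible one by an element of ker
dp, which L contains. -/
theorem IsReducible.exists_sharp (hL : IsDirac L) (hp : IsReducible L p) :
    ∃ S : ∀ y : N, CotangentSpace E' y →ₗ[ℝ] TangentSpace 𝓘(ℝ, E') y,
      (∀ x (v : TangentSpace 𝓘(ℝ, E) x) (ξ : CotangentSpace E' (p x)),
        ((v, pullbackCovector p x ξ) : GenTangent E x) ∈ L x ↔
          mfderiv 𝓘(ℝ, E) 𝓘(ℝ, E') p x v = S (p x) ξ) ∧
      (∀ α : OneForm E' N, ContMDiff 𝓘(ℝ, E') (𝓘(ℝ, E').prod 𝓘(ℝ, E')) ∞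
        (fun y => TotalSpace.mk' E' y (S y (α y)) : N → TangentBundle 𝓘(ℝ, E') N)) := by
  choose A hA using hp.exists_sharp_oneForm hL
  choose f hf using fun (y : N) (ξ : CotangentSpace E' y) => exists_function_dForm_eq y ξ
  have h1 : ∀ x (v : TangentSpace 𝓘(ℝ, E) x) (ξ : CotangentSpace E' (p x)),
      ((v, pullbackCovector p x ξ) : GenTangent E x) ∈ L x →
        mfderiv 𝓘(ℝ, E) 𝓘(ℝ, E') p x v = A (exactForm (f (p x) ξ)) (p x) := by
    intro x v ξ h
    refine hA (exactForm (f (p x) ξ)) x v ?_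
    rw [exactForm_apply, hf]
    exact h
  let S : ∀ y : N, CotangentSpace E' y →ₗ[ℝ] TangentSpace 𝓘(ℝ, E') y := fun y =>
    { toFun := fun ξ => A (exactForm (f y ξ)) y
      map_add' := fun ξ η => by
        obtain ⟨x, rfl⟩ := hp.surjective y
        obtain ⟨v, hv⟩ := hp.exists_mem hL x ξ
        obtain ⟨w, hw⟩ := hp.exists_mem hL x η
        rw [← h1 x v ξ hv, ← h1 x w η hw, ← h1 x (v + w) (ξ + η) ((L x).add_mem hv hw), map_add]
      map_smul' := fun c ξ => by
        obtain ⟨x, rfl⟩ := hp.surjective y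
        obtain ⟨v, hv⟩ := hp.exists_mem hL x ξ
        rw [← h1 x v ξ hv, ← h1 x (c • v) (c • ξ) ((L x).smul_mem c hv), map_smul]
        rfl }
  refine ⟨S, fun x v ξ => ⟨h1 x v ξ, fun h => ?_⟩, fun α => ?_⟩
  · obtain ⟨w, hw⟩ := hp.exists_mem hL x ξ
    have h3 : mfderiv 𝓘(ℝ, E) 𝓘(ℝ, E') p x (v - w) = 0 := by
      rw [map_sub, h, sub_eq_zero]
      exact (h1 x w ξ hw).symm
    have h4 := (L x).add_mem (hp.mem_iff.2 h3) hw
    have e : ((v - w, 0) : GenTangent E x) + ((w, pullbackCovector p x ξ) : GenTangent E x) =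
        (v, pullbackCovector p x ξ) := Prod.ext (sub_add_cancel _ _) (zero_add _)
    rw [e] at h4
    exact h4
  · have e : ∀ y, S y (α y) = A α y := fun y => by
      obtain ⟨x, rfl⟩ := hp.surjective y
      obtain ⟨v, hv⟩ := hp.exists_mem hL x (α (p x))
      rw [← hA α x v hv]
      exact (h1 x v _ hv).symm
    simp only [e]
    exact (A α).contMDiff

end Sharp

/-! ### The induced Poisson structure -/

section Graph

variable {E : Type*} [NormedAddCommGroup E] [NormedSpace ℝ E] [FiniteDimensional ℝ E]
  {M : Type*} [TopologicalSpace M] [ChartedSpace E M] [IsManifold 𝓘(ℝ, E) ∞ M] [T2Space M]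

/-- The graph of a bundle map `T*M → TM`. -/
def sharpGraph (S : ∀ x : M, CotangentSpace E x →ₗ[ℝ] TangentSpace 𝓘(ℝ, E) x) (x : M) :
    Submodule ℝ (GenTangent E x) where
  carrier := {w | w.1 = S x w.2}
  add_mem' := by
    intro v w hv hw
    exact (congrArg₂ (· + ·) hv hw).trans (map_add (S x) v.2 w.2).symm
  zero_mem' := (map_zero (S x)).symm
  smul_mem' := by
    intro c v hv
    exact (congrArg (c • ·) hv).trans (map_smul (S x) c v.2).symm

variable {S : ∀ x : M, CotangentSpace E x →ₗ[ℝ] TangentSpace 𝓘(ℝ, E) x}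

theorem isSmoothSubbundle_sharpGraph
    (hS : ∀ α : OneForm E M, ContMDiff 𝓘(ℝ, E) (𝓘(ℝ, E).prod 𝓘(ℝ, E)) ∞
      (fun x => TotalSpace.mk' E x (S x (α x)) : M → TangentBundle 𝓘(ℝ, E) M)) :
    IsSmoothSubbundle (E := E) (E × (E →L[ℝ] ℝ)) (sharpGraph S) := by
  intro x₀
  obtain ⟨g, V, hgV⟩ := exists_coordinate_frame (E := E) x₀
  obtain ⟨U, hU, hUo, hx₀⟩ := mem_nhds_iff.1 hgV
  let σ : Fin (Module.finrank ℝ E) → GenSection E M := fun i =>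
    GenSection.mk ⟨_, hS (exactForm (g i))⟩ (exactForm (g i))
  refine ⟨_, fun i x => σ i x, U, hUo, hx₀, fun i => (σ i).contMDiff.contMDiffOn,
    fun x hx => ⟨?_, ?_⟩⟩
  · rw [Fintype.linearIndependent_iff]
    intro c hc j
    have h1 := congrArg (fun w : GenTangent E x => (w.2 (V j x) : ℝ)) hc
    have h2 : ((∑ i, c i • σ i x : GenTangent E x).2 (V j x) : ℝ) = c j := by
      rw [Prod.snd_sum]
      refine (sum_covector_apply c (fun i => dForm (g i) x) (V j x)).trans ?_
      simp only [(hU hx).2]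
      simp
    exact h2.symm.trans h1
  · refine le_antisymm (Submodule.span_le.2 ?_) fun w hw => ?_
    · rintro _ ⟨i, rfl⟩
      exact (rfl : S x (dForm (g i) x) = S x (dForm (g i) x))
    · have h1 : w.2 = ∑ i, (w.2 (V i x) : ℝ) • (dForm (g i) x : CotangentSpace E x) := by
        refine covector_ext fun v => ?_
        rw [sum_covector_apply]
        conv_lhs => rw [← (hU hx).1 v, covector_apply_eq_sum]
        exact Finset.sum_congr rfl fun i _ => mul_comm _ _
      refine (Submodule.mem_span_range_iff_exists_fun ℝ).2 ⟨fun i => (w.2 (V i x) : ℝ), ?_⟩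
      refine Prod.ext ?_ ?_
      · rw [Prod.fst_sum]
        have hw' : w.1 = S x w.2 := hw
        rw [hw', h1, map_sum]
        refine Finset.sum_congr rfl fun i _ => ?_
        rw [map_smul, ← h1]
        rfl
      · rw [Prod.snd_sum]
        exact h1.symm

theorem isIsotropic_sharpGraph
    (hS : ∀ (x : M) (α β : CotangentSpace E x), (β (S x α) : ℝ) = -α (S x β)) (x : M) :
    IsIsotropic x (sharpGraph S x) := by
  intro v hv w hw
  have hv' : v.1 = S x v.2 := hv
  have hw' : w.1 = S x w.2 := hw
  unfold pairing
  rw [hv', hw', hS x v.2 w.2]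
  ring

/-- The bracket of A + df and B + dg is [A, B] + d(A(g)) by `dorfmanForm_exact`, and it lies in the
graph. -/
theorem IsInvolutive.sharp_poissonBracket (hG : IsInvolutive (sharpGraph S))
    {f g : C^∞⟮𝓘(ℝ, E), M; ℝ⟯} {A B : SmoothVectorField E M}
    (hA : ∀ x, A x = S x (dForm f x)) (hB : ∀ x, B x = S x (dForm g x)) (x : M) :
    ⁅A, B⁆ x = S x (dForm (lieDer A g) x) := by
  let σ : sections (E := E) (E × (E →L[ℝ] ℝ)) (sharpGraph S) :=
    ⟨GenSection.mk A (exactForm f), hA⟩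
  let τ : sections (E := E) (E × (E →L[ℝ] ℝ)) (sharpGraph S) :=
    ⟨GenSection.mk B (exactForm g), hB⟩
  have h1 := hG.bracketFun_vec σ τ
  have h2 : ((hG.bracketFun σ τ).1 x).2 = dForm (lieDer A g) x := by
    refine covector_ext_vectorField fun V => ?_
    have h3 := (hG.bracketFun_form σ τ V).trans (dorfmanForm_exact f g A B V)
    exact congrArg (fun h : C^∞⟮𝓘(ℝ, E), M; ℝ⟯ => h x) h3
  have h4 : ((hG.bracketFun σ τ).1 x).1 = S x ((hG.bracketFun σ τ).1 x).2 :=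
    (hG.bracketFun σ τ).2 x
  rw [h2] at h4
  exact (congrArg (fun V : SmoothVectorField E M => V x) h1).symm.trans h4

/-- The Poisson bivector with involutive graph. -/
def poissonOfInvolutive (hG : IsInvolutive (sharpGraph S))
    (hskew : ∀ (x : M) (α β : CotangentSpace E x), (β (S x α) : ℝ) = -α (S x β))
    (hS : ∀ α : OneForm E M, ContMDiff 𝓘(ℝ, E) (𝓘(ℝ, E).prod 𝓘(ℝ, E)) ∞
      (fun x => TotalSpace.mk' E x (S x (α x)) : M → TangentBundle 𝓘(ℝ, E) M)) :
    PoissonBivector E M where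
  sharp := S
  skew := hskew
  smooth := hS
  jacobi f g h := by
    intro br x
    let H : C^∞⟮𝓘(ℝ, E), M; ℝ⟯ → SmoothVectorField E M := fun u => ⟨_, hS (exactForm u)⟩
    have h1 : ∀ u v : C^∞⟮𝓘(ℝ, E), M; ℝ⟯, br u v = lieDer (H u) v := fun u v => rfl
    have h2 : ∀ u v : C^∞⟮𝓘(ℝ, E), M; ℝ⟯, ⁅H u, v⁆ = -⁅H v, u⁆ := fun u v => by
      ext y
      exact hskew y (dForm u y) (dForm v y)
    -- Hamiltonian fields respect brackets. Together with skewness `h2` this turns the Jacobi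
    -- identity into the commutator formula for the action of fields on h.
    have h3 : H ⁅H f, g⁆ = ⁅H f, H g⁆ := by
      ext1 y
      exact (hG.sharp_poissonBracket (f := f) (g := g) (fun _ => rfl) (fun _ => rfl) y).symm
    rw [h1, h1, h1, h1, h1, h1]
    change ⁅H f, ⁅H g, h⁆⁆ x + ⁅H g, ⁅H h, f⁆⁆ x + ⁅H h, ⁅H f, g⁆⁆ x = 0
    rw [h2 h f, h2 h ⁅H f, g⁆, h3, lie_neg, lie_lie]
    change ⁅H f, ⁅H g, h⁆⁆ x + -⁅H g, ⁅H f, h⁆⁆ x +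
      -(⁅H f, ⁅H g, h⁆⁆ x - ⁅H g, ⁅H f, h⁆⁆ x) = 0
    ring

end Graph

/-! ### Existence and uniqueness of the induced Poisson structure -/

section Induced

variable {E : Type*} [NormedAddCommGroup E] [NormedSpace ℝ E] [FiniteDimensional ℝ E]
  {M : Type*} [TopologicalSpace M] [ChartedSpace E M] [IsManifold 𝓘(ℝ, E) ∞ M] [T2Space M]
  [SigmaCompactSpace M]
  {E' : Type*} [NormedAddCommGroup E'] [NormedSpace ℝ E'] [FiniteDimensional ℝ E']
  {N : Type*} [TopologicalSpace N] [ChartedSpace E' N] [IsManifold 𝓘(ℝ, E') ∞ N] [T2Space N]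
  {L : ∀ x : M, Submodule ℝ (GenTangent E x)} {p : C^∞⟮𝓘(ℝ, E), M; 𝓘(ℝ, E'), N⟯}

theorem IsReducible.skew (hL : IsDirac L) (hp : IsReducible L p)
    {S : ∀ y : N, CotangentSpace E' y →ₗ[ℝ] TangentSpace 𝓘(ℝ, E') y}
    (hS : ∀ x (v : TangentSpace 𝓘(ℝ, E) x) (ξ : CotangentSpace E' (p x)),
      ((v, pullbackCovector p x ξ) : GenTangent E x) ∈ L x ↔
        mfderiv 𝓘(ℝ, E) 𝓘(ℝ, E') p x v = S (p x) ξ) (y : N) (α β : CotangentSpace E' y) :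
    (β (S y α) : ℝ) = -α (S y β) := by
  obtain ⟨x, rfl⟩ := hp.surjective y
  obtain ⟨v, hv⟩ := hp.exists_mem hL x α
  obtain ⟨w, hw⟩ := hp.exists_mem hL x β
  have h := hL.isotropic x _ hv _ hw
  unfold pairing at h
  simp only [pullbackCovector_apply] at h
  rw [(hS x v α).1 hv, (hS x w β).1 hw] at h
  linarith

/-- Sections of the graph lift to sections X + p^*α and Y + p^*β of L. By naturality the bracket of
the lifts is [X, Y] + p^*γ, where γ is the Dorfman form on N. It lies in L, and projecting it puts
the bracket on N back into the graph. -/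
theorem IsReducible.isInvolutive_sharpGraph (hL : IsDirac L) (hp : IsReducible L p)
    {S : ∀ y : N, CotangentSpace E' y →ₗ[ℝ] TangentSpace 𝓘(ℝ, E') y}
    (hS : ∀ x (v : TangentSpace 𝓘(ℝ, E) x) (ξ : CotangentSpace E' (p x)),
      ((v, pullbackCovector p x ξ) : GenTangent E x) ∈ L x ↔
        mfderiv 𝓘(ℝ, E) 𝓘(ℝ, E') p x v = S (p x) ξ)
    (hS' : ∀ α : OneForm E' N, ContMDiff 𝓘(ℝ, E') (𝓘(ℝ, E').prod 𝓘(ℝ, E')) ∞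
      (fun y => TotalSpace.mk' E' y (S y (α y)) : N → TangentBundle 𝓘(ℝ, E') N)) :
    IsInvolutive (sharpGraph S) where
  isSubbundle := isSmoothSubbundle_sharpGraph hS'
  isotropic := isIsotropic_sharpGraph (hp.skew hL hS)
  integrable σ hσ τ hτ := by
    obtain ⟨X, hX⟩ := hp.exists_vectorField hL (GenSection.form σ)
    obtain ⟨Y, hY⟩ := hp.exists_vectorField hL (GenSection.form τ)
    have hXA : IsRelated p X (GenSection.vec σ) := fun x =>
      ((hS x _ _).1 (hX x)).trans (hσ (p x)).symm
    have hYB : IsRelated p Y (GenSection.vec τ) := fun x =>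
      ((hS x _ _).1 (hY x)).trans (hτ (p x)).symm
    obtain ⟨γ, hγ⟩ := exists_oneForm_dorfmanForm (GenSection.vec σ) (GenSection.form σ)
      (GenSection.vec τ) (GenSection.form τ)
    refine ⟨GenSection.mk ⁅(GenSection.vec σ), (GenSection.vec τ)⁆ γ, fun y => ?_,
      (isCourantBracket_iff fun y => ?_).2 ⟨rfl, hγ⟩⟩
    · obtain ⟨x, rfl⟩ := hp.surjective y
      let σ' : sections (E := E) (E × (E →L[ℝ] ℝ)) L :=
        ⟨GenSection.mk X (pullbackForm p (GenSection.form σ)), hX⟩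
      let τ' : sections (E := E) (E × (E →L[ℝ] ℝ)) L :=
        ⟨GenSection.mk Y (pullbackForm p (GenSection.form τ)), hY⟩
      let υ := hL.isInvolutive.bracketFun σ' τ'
      have hvec : GenSection.vec υ.1 = ⁅X, Y⁆ := hL.isInvolutive.bracketFun_vec σ' τ'
      have hform : (υ.1 x).2 = pullbackCovector p x (γ (p x)) := by
        refine covector_ext_of_isRelated hp.submersion (fun v hv => ?_) fun V V' hV => ?_
        · rw [hp.covector_eq_zero hL (υ.2 x) hv, pullbackCovector_apply, hv, map_zero]
        · have h1 : contractHom (GenSection.form υ.1) V = _ :=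
            (hL.isInvolutive.bracketFun_form σ' τ' V).trans
              (hXA.dorfmanForm hYB hV (GenSection.form σ) (GenSection.form τ))
          rw [← hγ, ← contractHom_pullbackForm hV] at h1
          exact congrArg (fun h : C^∞⟮𝓘(ℝ, E), M; ℝ⟯ => h x) h1
      have hmem := υ.2 x
      have e : (υ.1 x : GenTangent E x) = (⁅X, Y⁆ x, pullbackCovector p x (γ (p x))) :=
        Prod.ext (congrArg (fun V : SmoothVectorField E M => V x) hvec) hform
      rw [e] at hmem
      exact (hXA.lie hYB x).symm.trans ((hS x _ _).1 hmem)
    · exact isIsotropic_sharpGraph (hp.skew hL hS) y _ (hσ y) _ (hτ y)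

theorem IsReducible.exists_poisson (hL : IsDirac L) (hp : IsReducible L p) :
    ∃ P : PoissonBivector E' N, IsInvolutive (sharpGraph P.sharp) ∧
      ∀ x (v : TangentSpace 𝓘(ℝ, E) x) (ξ : CotangentSpace E' (p x)),
        ((v, pullbackCovector p x ξ) : GenTangent E x) ∈ L x ↔
          mfderiv 𝓘(ℝ, E) 𝓘(ℝ, E') p x v = P.sharp (p x) ξ := by
  obtain ⟨S, hS, hS'⟩ := hp.exists_sharp hL
  have hG := hp.isInvolutive_sharpGraph hL hS hS'
  exact ⟨poissonOfInvolutive hG (hp.skew hL hS) hS', hG, hS⟩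

theorem pullbackCovector_dForm (f : C^∞⟮𝓘(ℝ, E'), N; ℝ⟯) (x : M) :
    pullbackCovector p x (dForm f (p x)) = dForm (f ∘ p) x :=
  covector_ext fun v => (dForm_comp p f x v).symm

theorem IsReducible.isInducedPoisson (hL : IsDirac L) (hp : IsReducible L p)
    {P : PoissonBivector E' N}
    (hP : ∀ x (v : TangentSpace 𝓘(ℝ, E) x) (ξ : CotangentSpace E' (p x)),
      ((v, pullbackCovector p x ξ) : GenTangent E x) ∈ L x ↔
        mfderiv 𝓘(ℝ, E) 𝓘(ℝ, E') p x v = P.sharp (p x) ξ) : IsInducedPoisson L p P := by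
  intro f
  obtain ⟨X, hX⟩ := hp.exists_vectorField hL (exactForm f)
  refine ⟨X, fun x => ?_, fun g x => ?_⟩
  · rw [← pullbackCovector_dForm]
    exact hX x
  · change (dForm (g ∘ p) x (X x) : ℝ) = dForm g (p x) (P.sharp (p x) (dForm f (p x)))
    rw [dForm_comp, (hP x _ _).1 (hX x)]
    rfl

/-- The fields X_f belonging to P' satisfy X_f + p^*df ∈ L, so they project to P^♯df. Every covector
is some df, and functions separate tangent vectors. -/
theorem IsReducible.inducedPoisson_unique (hp : IsReducible L p)
    {P P' : PoissonBivector E' N}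
    (hP : ∀ x (v : TangentSpace 𝓘(ℝ, E) x) (ξ : CotangentSpace E' (p x)),
      ((v, pullbackCovector p x ξ) : GenTangent E x) ∈ L x ↔
        mfderiv 𝓘(ℝ, E) 𝓘(ℝ, E') p x v = P.sharp (p x) ξ) (hP' : IsInducedPoisson L p P') :
    P' = P := by
  have h : P'.sharp = P.sharp := by
    funext y
    refine LinearMap.ext fun ξ => ?_
    obtain ⟨x, rfl⟩ := hp.surjective y
    obtain ⟨f, rfl⟩ := exists_function_dForm_eq (p x) ξ
    obtain ⟨X, hX, hXg⟩ := hP' f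
    have h1 := hX x
    rw [← pullbackCovector_dForm] at h1
    rw [← (hP x _ _).1 h1]
    refine tangent_ext fun g => ?_
    rw [← dForm_comp]
    exact (hXg g x).symm
  cases P
  cases P'
  cases h
  rfl

end Induced

/-! ### Transport of Lie algebroid structures -/

section Transport

variable {E : Type*} [NormedAddCommGroup E] [NormedSpace ℝ E] [FiniteDimensional ℝ E]
  {M : Type*} [TopologicalSpace M] [ChartedSpace E M] [IsManifold 𝓘(ℝ, E) ∞ M] [T2Space M]
  {F : Type*} [NormedAddCommGroup F] [NormedSpace ℝ F]
  {V : M → Type*} [TopologicalSpace (TotalSpace F V)]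
  [∀ x, AddCommGroup (V x)] [∀ x, Module ℝ (V x)] [∀ x, TopologicalSpace (V x)]
  [FiberBundle F V] [VectorBundle ℝ F V]
  {F' : Type*} [NormedAddCommGroup F'] [NormedSpace ℝ F']
  {V' : M → Type*} [TopologicalSpace (TotalSpace F' V')]
  [∀ x, AddCommGroup (V' x)] [∀ x, Module ℝ (V' x)] [∀ x, TopologicalSpace (V' x)]
  [FiberBundle F' V'] [VectorBundle ℝ F' V']
  {A : ∀ x : M, Submodule ℝ (V x)} {B : ∀ x : M, Submodule ℝ (V' x)}

/-- The isomorphism between spaces of sections given by a smooth isomorphism of subbundles. -/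
def sectionsEquiv (e : ∀ x, A x ≃ₗ[ℝ] B x)
    (he : ∀ σ : sections (E := E) F A, ContMDiff 𝓘(ℝ, E) (𝓘(ℝ, E).prod 𝓘(ℝ, F')) ∞
      (fun x => TotalSpace.mk' F' x (e x (evalAt σ x) : V' x)))
    (he' : ∀ τ : sections (E := E) F' B, ContMDiff 𝓘(ℝ, E) (𝓘(ℝ, E).prod 𝓘(ℝ, F)) ∞
      (fun x => TotalSpace.mk' F x ((e x).symm (evalAt τ x) : V x))) :
    sections (E := E) F A ≃ₗ[ℝ] sections (E := E) F' B where
  toFun σ := ⟨⟨fun x => e x (evalAt σ x), he σ⟩, fun x => (e x (evalAt σ x)).2⟩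
  invFun τ := ⟨⟨fun x => (e x).symm (evalAt τ x), he' τ⟩, fun x => ((e x).symm (evalAt τ x)).2⟩
  map_add' σ τ := Subtype.ext <| ContMDiffSection.ext fun x =>
    congrArg Subtype.val (map_add (e x) (evalAt σ x) (evalAt τ x))
  map_smul' c σ := Subtype.ext <| ContMDiffSection.ext fun x =>
    congrArg Subtype.val (map_smul (e x) c (evalAt σ x))
  left_inv σ := Subtype.ext <| ContMDiffSection.ext fun x =>
    congrArg Subtype.val ((e x).symm_apply_apply (evalAt σ x))
  right_inv τ := Subtype.ext <| ContMDiffSection.ext fun x =>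
    congrArg Subtype.val ((e x).apply_symm_apply (evalAt τ x))

theorem evalAt_injective {σ τ : sections (E := E) F A} (h : ∀ x, evalAt σ x = evalAt τ x) :
    σ = τ :=
  Subtype.ext <| ContMDiffSection.ext fun x => congrArg Subtype.val (h x)

theorem isSmoothSubbundle_of_equiv (hB : IsSmoothSubbundle (E := E) F' B)
    (e : ∀ x, A x ≃ₗ[ℝ] B x)
    (he' : ∀ τ : sections (E := E) F' B, ContMDiff 𝓘(ℝ, E) (𝓘(ℝ, E).prod 𝓘(ℝ, F)) ∞
      (fun x => TotalSpace.mk' F x ((e x).symm (evalAt τ x) : V x))) :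
    IsSmoothSubbundle (E := E) F A := by
  intro x₀
  obtain ⟨k, τ, hτ⟩ := hB.exists_frame x₀
  obtain ⟨U, hU, hUo, hx₀⟩ := mem_nhds_iff.1 hτ
  refine ⟨k, fun i x => (e x).symm (evalAt (τ i) x), U, hUo, hx₀,
    fun i => (he' (τ i)).contMDiffOn, fun x hx => ?_⟩
  obtain ⟨hli, hspan⟩ := hU hx
  let φ : B x →ₗ[ℝ] V x := (A x).subtype.comp (e x).symm.toLinearMap
  have hφ : Function.Injective φ := (Subtype.val_injective).comp (e x).symm.injective
  have hli' : LinearIndependent ℝ fun i => evalAt (τ i) x :=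
    LinearIndependent.of_comp (B x).subtype hli
  have hspan' : Submodule.span ℝ (Set.range fun i => evalAt (τ i) x) = ⊤ := by
    refine Submodule.map_injective_of_injective (B x).subtype_injective ?_
    rw [Submodule.map_span, ← Set.range_comp, Submodule.map_top, Submodule.range_subtype]
    exact hspan
  refine ⟨hli'.map' φ (LinearMap.ker_eq_bot.2 hφ), ?_⟩
  change Submodule.span ℝ (Set.range (φ ∘ fun i => evalAt (τ i) x)) = A x
  rw [Set.range_comp, ← Submodule.map_span, hspan', Submodule.map_top, LinearMap.range_comp,
    LinearEquiv.range, Submodule.map_top, Submodule.range_subtype]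

variable (e : ∀ x, A x ≃ₗ[ℝ] B x)
  (he : ∀ σ : sections (E := E) F A, ContMDiff 𝓘(ℝ, E) (𝓘(ℝ, E).prod 𝓘(ℝ, F')) ∞
    (fun x => TotalSpace.mk' F' x (e x (evalAt σ x) : V' x)))
  (he' : ∀ τ : sections (E := E) F' B, ContMDiff 𝓘(ℝ, E) (𝓘(ℝ, E).prod 𝓘(ℝ, F)) ∞
    (fun x => TotalSpace.mk' F x ((e x).symm (evalAt τ x) : V x)))

/-- The transport of a Lie algebroid structure along a smooth isomorphism of subbundles. -/
def LieAlgebroid.transport (𝓑 : LieAlgebroid E F' B) : LieAlgebroid E F A where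
  isSubbundle := isSmoothSubbundle_of_equiv 𝓑.isSubbundle e he'
  anchor x := (𝓑.anchor x).comp (e x).toLinearMap
  anchor_smooth σ := 𝓑.anchor_smooth (sectionsEquiv e he he' σ)
  bracket := (𝓑.bracket.compl₁₂ (sectionsEquiv e he he').toLinearMap
    (sectionsEquiv e he he').toLinearMap).compr₂ (sectionsEquiv e he he').symm.toLinearMap
  bracket_self σ := by
    change (sectionsEquiv e he he').symm (𝓑.bracket (sectionsEquiv e he he' σ)
      (sectionsEquiv e he he' σ)) = 0
    rw [𝓑.bracket_self, map_zero]
  jacobi σ τ υ := by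
    let T := sectionsEquiv e he he'
    change T.symm (𝓑.bracket (T σ) (T (T.symm (𝓑.bracket (T τ) (T υ))))) +
      T.symm (𝓑.bracket (T τ) (T (T.symm (𝓑.bracket (T υ) (T σ))))) +
      T.symm (𝓑.bracket (T υ) (T (T.symm (𝓑.bracket (T σ) (T τ))))) = 0
    rw [T.apply_symm_apply, T.apply_symm_apply, T.apply_symm_apply, ← map_add, ← map_add,
      𝓑.jacobi, map_zero]
  leibniz f σ τ fτ h x := by
    let T := sectionsEquiv e he he'
    have h1 := 𝓑.leibniz f (T σ) (T τ) (T fτ) (fun y => by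
      change e y (evalAt fτ y) = f y • e y (evalAt τ y)
      rw [h y, map_smul]) x
    have h2 := congrArg (e x).symm h1
    rw [map_add, map_smul, map_smul] at h2
    refine h2.trans ?_
    congr 2
    exact (e x).symm_apply_apply (evalAt τ x)
  anchor_bracket σ τ x := by
    let T := sectionsEquiv e he he'
    refine Eq.trans ?_ (𝓑.anchor_bracket (T σ) (T τ) x)
    exact congrArg (𝓑.anchor x) ((e x).apply_symm_apply _)

theorem LieAlgebroid.evalAt_transport_bracket (𝓑 : LieAlgebroid E F' B)
    (σ τ : sections (E := E) F A) (x : M) :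
    e x (evalAt ((𝓑.transport e he he').bracket σ τ) x) =
      evalAt (𝓑.bracket (sectionsEquiv e he he' σ) (sectionsEquiv e he he' τ)) x :=
  (e x).apply_symm_apply _

end Transport

/-! ### The cotangent Lie algebroid -/

section Cotangent

variable {E : Type*} [NormedAddCommGroup E] [NormedSpace ℝ E] [FiniteDimensional ℝ E]
  {M : Type*} [TopologicalSpace M] [ChartedSpace E M] [IsManifold 𝓘(ℝ, E) ∞ M] [T2Space M]

/-- The isomorphism of `T*M` with the graph of `π^♯`. -/
def sharpGraphEquiv (S : ∀ x : M, CotangentSpace E x →ₗ[ℝ] TangentSpace 𝓘(ℝ, E) x) (x : M) :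
    (⊤ : Submodule ℝ (CotangentSpace E x)) ≃ₗ[ℝ] sharpGraph S x where
  toFun α := ⟨(S x α.1, α.1), rfl⟩
  invFun w := ⟨w.1.2, trivial⟩
  map_add' α β := Subtype.ext <| Prod.ext (map_add (S x) α.1 β.1) rfl
  map_smul' c α := Subtype.ext <| Prod.ext (map_smul (S x) c α.1) rfl
  left_inv _ := rfl
  right_inv w := Subtype.ext <| Prod.ext (Eq.symm w.2) rfl

theorem contMDiff_sharpGraphEquiv (P : PoissonBivector E M)
    (σ : sections (E := E) (E →L[ℝ] ℝ) (fun x : M => (⊤ : Submodule ℝ (CotangentSpace E x)))) :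
    ContMDiff 𝓘(ℝ, E) (𝓘(ℝ, E).prod 𝓘(ℝ, E × (E →L[ℝ] ℝ))) ∞
      (fun x => TotalSpace.mk' (E × (E →L[ℝ] ℝ)) x
        (sharpGraphEquiv P.sharp x (evalAt σ x) : GenTangent E x)) := fun x =>
  contMDiffAt_prod_section.2 ⟨P.smooth σ.1 x, σ.1.contMDiff x⟩

theorem contMDiff_sharpGraphEquiv_symm (P : PoissonBivector E M)
    (τ : sections (E := E) (E × (E →L[ℝ] ℝ)) (sharpGraph P.sharp)) :
    ContMDiff 𝓘(ℝ, E) (𝓘(ℝ, E).prod 𝓘(ℝ, E →L[ℝ] ℝ)) ∞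
      (fun x => TotalSpace.mk' (E →L[ℝ] ℝ) x
        ((sharpGraphEquiv P.sharp x).symm (evalAt τ x) : CotangentSpace E x)) :=
  (GenSection.form τ.1).contMDiff

variable {P : PoissonBivector E M} (hG : IsInvolutive (sharpGraph P.sharp))

/-- The Lie algebroid structure on the cotangent bundle of a Poisson manifold. -/
def cotangentAlgebroid :
    LieAlgebroid E (E →L[ℝ] ℝ) (fun x : M => (⊤ : Submodule ℝ (CotangentSpace E x))) :=
  hG.lieAlgebroid.transport (sharpGraphEquiv P.sharp) (contMDiff_sharpGraphEquiv P)
    (contMDiff_sharpGraphEquiv_symm P)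

/-- The section `π^♯ α + α` of the graph of `π^♯`. -/
def sharpGraphSection (P : PoissonBivector E M)
    (α : sections (E := E) (E →L[ℝ] ℝ) (fun x : M => (⊤ : Submodule ℝ (CotangentSpace E x)))) :
    sections (E := E) (E × (E →L[ℝ] ℝ)) (sharpGraph P.sharp) :=
  sectionsEquiv (sharpGraphEquiv P.sharp) (contMDiff_sharpGraphEquiv P)
    (contMDiff_sharpGraphEquiv_symm P) α

theorem isCotangentAlgebroid_cotangentAlgebroid :
    IsCotangentAlgebroid P (cotangentAlgebroid hG) where
  anchor _ _ := rfl
  bracket α β V x := by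
    have h := (hG.isCourantBracket_bracketFun (sharpGraphSection P α)
      (sharpGraphSection P β)).2 V x
    -- By skewness the difference is -2π(α, β), so half its differential is the term -dπ(α, β).
    have e : (fun y => (α.1 y (P.sharp y (β.1 y)) : ℝ) - (β.1 y (P.sharp y (α.1 y)) : ℝ)) =
        fun y => (-2 : ℝ) * (β.1 y (P.sharp y (α.1 y)) : ℝ) := by
      funext y
      rw [P.skew y (α.1 y) (β.1 y)]
      ring
    refine h.trans ?_
    change lieForm (fun y => P.sharp y (α.1 y)) β.1 V x -
        lieForm (fun y => P.sharp y (β.1 y)) α.1 V x + (1 / 2 : ℝ) * lieD V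
          (fun y => (α.1 y (P.sharp y (β.1 y)) : ℝ) - (β.1 y (P.sharp y (α.1 y)) : ℝ)) x = _
    rw [e, lieD_const_mul]
    · ring
    · exact smooth_mdifferentiableAt
        (contract β.1 ⟨fun y => P.sharp y (α.1 y), P.smooth α.1⟩) x

theorem contractHom_cotangentAlgebroid_bracket
    (α β : sections (E := E) (E →L[ℝ] ℝ) (fun x : M => (⊤ : Submodule ℝ (CotangentSpace E x))))
    (V : SmoothVectorField E M) :
    contractHom ((cotangentAlgebroid hG).bracket α β).1 V =
      dorfmanForm ⟨fun x => P.sharp x (α.1 x), P.smooth α.1⟩ (contractHom α.1)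
        ⟨fun x => P.sharp x (β.1 x), P.smooth β.1⟩ (contractHom β.1) V :=
  hG.bracketFun_form (sharpGraphSection P α) (sharpGraphSection P β) V

end Cotangent

/-! ### The pullback of the cotangent Lie algebroid -/

section Combination

variable {E : Type*} [NormedAddCommGroup E] [NormedSpace ℝ E] [FiniteDimensional ℝ E]
  {M : Type*} [TopologicalSpace M] [ChartedSpace E M] [IsManifold 𝓘(ℝ, E) ∞ M] [T2Space M]
  {E' : Type*} [NormedAddCommGroup E'] [NormedSpace ℝ E'] [FiniteDimensional ℝ E']
  {N : Type*} [TopologicalSpace N] [ChartedSpace E' N] [IsManifold 𝓘(ℝ, E') ∞ N] [T2Space N]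
  {p : C^∞⟮𝓘(ℝ, E), M; 𝓘(ℝ, E'), N⟯} {ι κ : Type*} [Fintype ι] [Fintype κ]

theorem lie_sum_mul (X : SmoothVectorField E M) (f h : ι → C^∞⟮𝓘(ℝ, E), M; ℝ⟯) :
    ⁅X, ∑ i, f i * h i⁆ = ∑ i, (⁅X, f i⁆ * h i + f i * ⁅X, h i⁆) := by
  rw [lie_sum]
  exact Finset.sum_congr rfl fun i _ => lie_mul_smooth X (f i) (h i)

variable {X Y V : SmoothVectorField E M} {f : ι → C^∞⟮𝓘(ℝ, E), M; ℝ⟯}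
  {A : ι → SmoothVectorField E' N} {g : κ → C^∞⟮𝓘(ℝ, E), M; ℝ⟯}
  {B : κ → SmoothVectorField E' N} {V' : SmoothVectorField E' N}

theorem lie_pullbackFunction_of_combination
    (hX : ∀ x, mfderiv 𝓘(ℝ, E) 𝓘(ℝ, E') p x (X x) = ∑ i, f i x • A i (p x))
    (u : C^∞⟮𝓘(ℝ, E'), N; ℝ⟯) :
    ⁅X, pullbackFunction p u⁆ = ∑ i, f i * pullbackFunction p ⁅A i, u⁆ := by
  ext x
  rw [sum_function_apply]
  change (dForm (u ∘ p) x (X x) : ℝ) = ∑ i, f i x * (dForm u (p x) (A i (p x)) : ℝ)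
  rw [dForm_comp, hX, dForm_sum_smul]

/-- X is related only to a combination of fields with coefficients on M, so differentiating these
along V produces the correction -∑ V(fᵢ) Aᵢ. The identity is tested on pulled-back functions. -/
theorem mfderiv_lie_of_combination
    (hX : ∀ x, mfderiv 𝓘(ℝ, E) 𝓘(ℝ, E') p x (X x) = ∑ i, f i x • A i (p x))
    (hV : IsRelated p V V') (x : M) :
    mfderiv 𝓘(ℝ, E) 𝓘(ℝ, E') p x (⁅X, V⁆ x) =
      ∑ i, f i x • ⁅A i, V'⁆ (p x) - ∑ i, ⁅V, f i⁆ x • A i (p x) := by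
  refine tangent_ext fun u => ?_
  rw [← dForm_comp, map_sub, dForm_sum_smul, dForm_sum_smul]
  have h : ⁅⁅X, V⁆, pullbackFunction p u⁆ = ∑ i, f i * pullbackFunction p ⁅⁅A i, V'⁆, u⁆ -
      ∑ i, ⁅V, f i⁆ * pullbackFunction p ⁅A i, u⁆ := by
    rw [lie_lie, hV.lie_pullbackFunction, lie_pullbackFunction_of_combination hX,
      lie_pullbackFunction_of_combination hX, lie_sum_mul, ← Finset.sum_sub_distrib,
      ← Finset.sum_sub_distrib]
    refine Finset.sum_congr rfl fun i _ => ?_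
    rw [hV.lie_pullbackFunction, lie_lie]
    have e : pullbackFunction p (⁅A i, ⁅V', u⁆⁆ - ⁅V', ⁅A i, u⁆⁆) =
      pullbackFunction p ⁅A i, ⁅V', u⁆⁆ - pullbackFunction p ⁅V', ⁅A i, u⁆⁆ := rfl
    rw [e]
    ring
  have h2 := congrArg (fun h : C^∞⟮𝓘(ℝ, E), M; ℝ⟯ => h x) h
  refine h2.trans ?_
  change (∑ i, f i * pullbackFunction p ⁅⁅A i, V'⁆, u⁆) x -
      (∑ i, ⁅V, f i⁆ * pullbackFunction p ⁅A i, u⁆) x = _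
  rw [sum_function_apply, sum_function_apply]
  rfl

variable {ξ : OneForm E M} {α : ι → OneForm E' N}
  {η : OneForm E M} {β : κ → OneForm E' N}

theorem contractHom_of_combination
    (hξ : ∀ x, ξ x = pullbackCovector p x (∑ i, f i x • α i (p x)))
    (W : SmoothVectorField E M) (x : M) : contractHom ξ W x =
      ∑ i, f i x * (α i (p x) (mfderiv 𝓘(ℝ, E) 𝓘(ℝ, E') p x (W x)) : ℝ) := by
  rw [contractHom_apply, hξ, pullbackCovector_apply, sum_covector_apply]

theorem contractHom_of_combination_of_isRelated
    (hξ : ∀ x, ξ x = pullbackCovector p x (∑ i, f i x • α i (p x))) (hV : IsRelated p V V') :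
    contractHom ξ V = ∑ i, f i * pullbackFunction p (contractHom (α i) V') := by
  ext x
  rw [contractHom_of_combination hξ, hV x, sum_function_apply]
  rfl

theorem contractHom_lie_of_combination
    (hX : ∀ x, mfderiv 𝓘(ℝ, E) 𝓘(ℝ, E') p x (X x) = ∑ i, f i x • A i (p x))
    (hη : ∀ x, η x = pullbackCovector p x (∑ j, g j x • β j (p x))) (hV : IsRelated p V V') :
    contractHom η ⁅X, V⁆ = ∑ i, ∑ j, (g j * (f i * pullbackFunction p (contractHom (β j) ⁅A i, V'⁆)
      - ⁅V, f i⁆ * pullbackFunction p (contractHom (β j) (A i)))) := by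
  rw [Finset.sum_comm]
  ext x
  rw [contractHom_of_combination hη, sum_function_apply]
  refine Finset.sum_congr rfl fun j _ => ?_
  rw [mfderiv_lie_of_combination hX hV, map_sub, covector_apply_eq_sum, covector_apply_eq_sum,
    ← Finset.sum_sub_distrib, Finset.mul_sum, sum_function_apply]
  rfl

theorem contractHom_of_combination_of_combination
    (hξ : ∀ x, ξ x = pullbackCovector p x (∑ i, f i x • α i (p x)))
    (hY : ∀ x, mfderiv 𝓘(ℝ, E) 𝓘(ℝ, E') p x (Y x) = ∑ j, g j x • B j (p x)) :
    contractHom ξ Y = ∑ i, ∑ j, f i * (g j * pullbackFunction p (contractHom (α i) (B j))) := by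
  ext x
  rw [contractHom_of_combination hξ, sum_function_apply]
  refine Finset.sum_congr rfl fun i _ => ?_
  rw [hY, covector_apply_eq_sum, Finset.mul_sum, sum_function_apply]
  rfl

/-- This is the source of the prescribed bracket formula. Besides its terms, the expansion contains
derivatives of the coefficients along V. Those with V(gⱼ) cancel between ξ([Y, V]) and V(ξ(Y)).
Those with V(fᵢ) cancel between -η([X, V]) and V(ξ(Y)) by the skewness `hαβ`. -/
theorem dorfmanForm_of_combination
    (hX : ∀ x, mfderiv 𝓘(ℝ, E) 𝓘(ℝ, E') p x (X x) = ∑ i, f i x • A i (p x))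
    (hξ : ∀ x, ξ x = pullbackCovector p x (∑ i, f i x • α i (p x)))
    (hY : ∀ x, mfderiv 𝓘(ℝ, E) 𝓘(ℝ, E') p x (Y x) = ∑ j, g j x • B j (p x))
    (hη : ∀ x, η x = pullbackCovector p x (∑ j, g j x • β j (p x)))
    (hαβ : ∀ i j, contractHom (α i) (B j) = -contractHom (β j) (A i))
    (hV : IsRelated p V V') :
    dorfmanForm X (contractHom ξ) Y (contractHom η) V =
      ∑ i, ∑ j, f i * g j * pullbackFunction p
        (dorfmanForm (A i) (contractHom (α i)) (B j) (contractHom (β j)) V') +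
      ∑ j, ⁅X, g j⁆ * pullbackFunction p (contractHom (β j) V') -
      ∑ i, ⁅Y, f i⁆ * pullbackFunction p (contractHom (α i) V') := by
  have h1 : ⁅X, contractHom η V⁆ = ∑ j, ⁅X, g j⁆ * pullbackFunction p (contractHom (β j) V') +
      ∑ i, ∑ j, g j * (f i * pullbackFunction p ⁅A i, contractHom (β j) V'⁆) := by
    rw [contractHom_of_combination_of_isRelated hη hV, lie_sum_mul, Finset.sum_add_distrib,
      Finset.sum_comm (s := (Finset.univ : Finset ι))]
    congr 1
    refine Finset.sum_congr rfl fun j _ => ?_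
    rw [lie_pullbackFunction_of_combination hX, Finset.mul_sum]
  have h3 : ⁅Y, contractHom ξ V⁆ = ∑ i, ⁅Y, f i⁆ * pullbackFunction p (contractHom (α i) V') +
      ∑ i, ∑ j, f i * (g j * pullbackFunction p ⁅B j, contractHom (α i) V'⁆) := by
    rw [contractHom_of_combination_of_isRelated hξ hV, lie_sum_mul, Finset.sum_add_distrib]
    congr 1
    refine Finset.sum_congr rfl fun j _ => ?_
    rw [lie_pullbackFunction_of_combination hY, Finset.mul_sum]
  have h4 := contractHom_lie_of_combination hY hξ hV
  rw [Finset.sum_comm] at h4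
  have h5 : ⁅V, contractHom ξ Y⁆ = ∑ i, ∑ j, (⁅V, f i⁆ * (g j * pullbackFunction p
      (contractHom (α i) (B j))) + f i * (⁅V, g j⁆ * pullbackFunction p (contractHom (α i) (B j)) +
        g j * pullbackFunction p ⁅V', contractHom (α i) (B j)⁆)) := by
    rw [contractHom_of_combination_of_combination hξ hY, lie_sum]
    refine Finset.sum_congr rfl fun i _ => ?_
    rw [lie_sum]
    refine Finset.sum_congr rfl fun j _ => ?_
    rw [lie_mul_smooth, lie_mul_smooth, hV.lie_pullbackFunction]
  have key : (∑ i, ∑ j, f i * g j * pullbackFunction p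
        (dorfmanForm (A i) (contractHom (α i)) (B j) (contractHom (β j)) V')) =
      (∑ i, ∑ j, g j * (f i * pullbackFunction p ⁅A i, contractHom (β j) V'⁆)) -
      contractHom η ⁅X, V⁆ -
      (∑ i, ∑ j, f i * (g j * pullbackFunction p ⁅B j, contractHom (α i) V'⁆)) +
      contractHom ξ ⁅Y, V⁆ + ⁅V, contractHom ξ Y⁆ := by
    rw [contractHom_lie_of_combination hX hη hV, h4, h5]
    simp only [← Finset.sum_sub_distrib, ← Finset.sum_add_distrib]
    refine Finset.sum_congr rfl fun i _ => Finset.sum_congr rfl fun j _ => ?_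
    have e1 : pullbackFunction p
        (dorfmanForm (A i) (contractHom (α i)) (B j) (contractHom (β j)) V') =
        pullbackFunction p ⁅A i, contractHom (β j) V'⁆ -
        pullbackFunction p (contractHom (β j) ⁅A i, V'⁆) -
        pullbackFunction p ⁅B j, contractHom (α i) V'⁆ +
        pullbackFunction p (contractHom (α i) ⁅B j, V'⁆) +
        pullbackFunction p ⁅V', contractHom (α i) (B j)⁆ := rfl
    have e2 : pullbackFunction p (contractHom (α i) (B j)) =
        -pullbackFunction p (contractHom (β j) (A i)) := by
      rw [hαβ]
      rfl
    rw [e1, e2]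
    ring
  rw [key]
  unfold dorfmanForm
  rw [h1, h3]
  ring

end Combination

/-! ### The identification of p^{!!}T*N with L -/

section PullbackEquiv

variable {E : Type*} [NormedAddCommGroup E] [NormedSpace ℝ E] [FiniteDimensional ℝ E]
  {M : Type*} [TopologicalSpace M] [ChartedSpace E M] [IsManifold 𝓘(ℝ, E) ∞ M] [T2Space M]
  [SigmaCompactSpace M]
  {E' : Type*} [NormedAddCommGroup E'] [NormedSpace ℝ E'] [FiniteDimensional ℝ E']
  {N : Type*} [TopologicalSpace N] [ChartedSpace E' N] [IsManifold 𝓘(ℝ, E') ∞ N] [T2Space N]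
  {L : ∀ x : M, Submodule ℝ (GenTangent E x)} {p : C^∞⟮𝓘(ℝ, E), M; 𝓘(ℝ, E'), N⟯}

theorem pullbackCovector_injective (hp : Manifold.IsSubmersion 𝓘(ℝ, E) 𝓘(ℝ, E') ∞ p) (x : M) :
    Function.Injective (pullbackCovector p x) := by
  intro α β h
  refine covector_ext fun v => ?_
  obtain ⟨w, rfl⟩ := mfderiv_surjective_of_isSubmersion hp x v
  exact congrArg (fun ξ : CotangentSpace E x => (ξ w : ℝ)) h

/-- A covector that kills ker dp factors through dp: compose it with a linear right inverse of dp.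
-/
theorem exists_pullbackCovector_eq (hp : Manifold.IsSubmersion 𝓘(ℝ, E) 𝓘(ℝ, E') ∞ p) (x : M)
    (ξ : CotangentSpace E x)
    (hξ : ∀ v, mfderiv 𝓘(ℝ, E) 𝓘(ℝ, E') p x v = 0 → (ξ v : ℝ) = 0) :
    ∃ α : CotangentSpace E' (p x), pullbackCovector p x α = ξ := by
  let D : E →L[ℝ] E' := mfderiv 𝓘(ℝ, E) 𝓘(ℝ, E') p x
  obtain ⟨R, hR⟩ := D.toLinearMap.exists_rightInverse_of_surjective
    (LinearMap.range_eq_top.2 (mfderiv_surjective_of_isSubmersion hp x))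
  let ξ' : E →L[ℝ] ℝ := ξ
  refine ⟨(ξ'.comp (LinearMap.toContinuousLinearMap R) : E' →L[ℝ] ℝ), covector_ext fun v => ?_⟩
  let u : E := v
  have h1 : D (R (D u) - u) = 0 := by
    rw [map_sub, sub_eq_zero]
    exact congrArg (fun T : E' →ₗ[ℝ] E' => T (D u)) hR
  have h2 : ξ' (R (D u) - u) = 0 := hξ _ h1
  rw [map_sub, sub_eq_zero] at h2
  exact h2

/-- The evaluation of covectors at a tangent vector. -/
def covectorEval {x : M} (v : TangentSpace 𝓘(ℝ, E) x) : CotangentSpace E x →ₗ[ℝ] ℝ where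
  toFun ξ := ξ v
  map_add' _ _ := rfl
  map_smul' _ _ := rfl

variable {P : PoissonBivector E' N} (hG : IsInvolutive (sharpGraph P.sharp))

theorem mem_pullbackFiber_iff {x : M} {w : TangentPullback (CotangentSpace E' : N → Type _) p x} :
    w ∈ pullbackFiber p (cotangentAlgebroid hG) x ↔
      P.sharp (p x) w.2 = mfderiv 𝓘(ℝ, E) 𝓘(ℝ, E') p x w.1 :=
  ⟨fun h => h.2, fun h => ⟨trivial, h⟩⟩

variable (hL : IsDirac L) (hp : IsReducible L p)
  (hP : ∀ x (v : TangentSpace 𝓘(ℝ, E) x) (ξ : CotangentSpace E' (p x)),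
    ((v, pullbackCovector p x ξ) : GenTangent E x) ∈ L x ↔
      mfderiv 𝓘(ℝ, E) 𝓘(ℝ, E') p x v = P.sharp (p x) ξ)

/-- The map `(X, α) ↦ X + p^*α`. -/
def pullbackMap (x : M) : pullbackFiber p (cotangentAlgebroid hG) x →ₗ[ℝ] L x where
  toFun w := ⟨(w.1.1, pullbackCovector p x w.1.2),
    (hP x _ _).2 ((mem_pullbackFiber_iff hG).1 w.2).symm⟩
  map_add' _ _ := rfl
  map_smul' _ _ := rfl

/-- The isomorphism `(X, α) ↦ X + p^*α`. -/
def pullbackEquiv (x : M) : pullbackFiber p (cotangentAlgebroid hG) x ≃ₗ[ℝ] L x :=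
  LinearEquiv.ofBijective (pullbackMap hG hP x) <| by
    constructor
    · intro v w h
      have h1 : ((v.1.1, pullbackCovector p x v.1.2) : GenTangent E x) =
        (w.1.1, pullbackCovector p x w.1.2) := congrArg Subtype.val h
      have h2 : v.1.1 = w.1.1 := (Prod.ext_iff.1 h1).1
      have h3 : pullbackCovector p x v.1.2 = pullbackCovector p x w.1.2 := (Prod.ext_iff.1 h1).2
      exact Subtype.ext (Prod.ext h2 (pullbackCovector_injective hp.submersion x h3))
    · intro w
      obtain ⟨α, hα⟩ := exists_pullbackCovector_eq hp.submersion x w.1.2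
        fun v hv => hp.covector_eq_zero hL w.2 hv
      have hw : ((w.1.1, pullbackCovector p x α) : GenTangent E x) ∈ L x := by
        rw [hα]
        exact w.2
      exact ⟨⟨(w.1.1, α), (mem_pullbackFiber_iff hG).2 ((hP x _ _).1 hw).symm⟩,
        Subtype.ext (Prod.ext rfl hα)⟩

theorem contMDiff_pullbackEquiv
    (σ : sections (E := E) (E × (E' →L[ℝ] ℝ)) (pullbackFiber p (cotangentAlgebroid hG))) :
    ContMDiff 𝓘(ℝ, E) (𝓘(ℝ, E).prod 𝓘(ℝ, E × (E →L[ℝ] ℝ))) ∞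
      (fun x => TotalSpace.mk' (E × (E →L[ℝ] ℝ)) x
        (pullbackEquiv hG hL hp hP x (evalAt σ x) : GenTangent E x)) := fun x =>
  contMDiffAt_prod_section.2 ⟨(contMDiffAt_prod_section.1 (σ.1.contMDiff x)).1,
    contMDiffAt_pullbackCovector ((contMDiffAt_pullback_section_iff p).1
      (contMDiffAt_prod_section.1 (σ.1.contMDiff x)).2)⟩

theorem contMDiff_pullbackEquiv_symm
    (τ : sections (E := E) (E × (E →L[ℝ] ℝ)) L) :
    ContMDiff 𝓘(ℝ, E) (𝓘(ℝ, E).prod 𝓘(ℝ, E × (E' →L[ℝ] ℝ))) ∞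
      (fun x => TotalSpace.mk' (E × (E' →L[ℝ] ℝ)) x
        ((pullbackEquiv hG hL hp hP x).symm (evalAt τ x) :
          TangentPullback (CotangentSpace E' : N → Type _) p x)) := by
  have h : ∀ x, ((((pullbackEquiv hG hL hp hP x).symm (evalAt τ x)).1.1,
      pullbackCovector p x ((pullbackEquiv hG hL hp hP x).symm (evalAt τ x)).1.2) :
      GenTangent E x) = τ.1 x := fun x =>
    congrArg Subtype.val ((pullbackEquiv hG hL hp hP x).apply_symm_apply (evalAt τ x))
  intro x₀
  refine contMDiffAt_prod_section.2 ⟨?_, ?_⟩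
  · refine ((GenSection.vec τ.1).contMDiff x₀).congr_of_eventuallyEq
      (Filter.Eventually.of_forall ?_)
    exact fun x => congrArg (TotalSpace.mk' E x) (congrArg Prod.fst (h x))
  -- On V' ∘ p the unknown covector takes the value of the 1-form component of τ on a lift of V',
  -- which is smooth.
  · refine contMDiffAt_pullback_covector_of_test p fun V' => ?_
    obtain ⟨V, hV⟩ := exists_isRelated hp.submersion V'
    refine ((contractHom (GenSection.form τ.1) V).contMDiff x₀).congr_of_eventuallyEq
      (Filter.Eventually.of_forall fun x => ?_)
    have h1 := congrArg (fun w : GenTangent E x => (w.2 (V x) : ℝ)) (h x)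
    refine Eq.trans ?_ h1
    exact congrArg (show CotangentSpace E' (p x) from
      ((pullbackEquiv hG hL hp hP x).symm (evalAt τ x)).1.2) (hV x).symm

/-- The Lie algebroid structure on `p^{!!}T*N`. -/
def pullbackAlgebroid :
    LieAlgebroid E (E × (E' →L[ℝ] ℝ)) (pullbackFiber p (cotangentAlgebroid hG)) :=
  hL.isInvolutive.lieAlgebroid.transport (pullbackEquiv hG hL hp hP)
    (contMDiff_pullbackEquiv hG hL hp hP) (contMDiff_pullbackEquiv_symm hG hL hp hP)

theorem isPullbackAlgebroid_pullbackAlgebroid :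
    IsPullbackAlgebroid p (cotangentAlgebroid hG) (pullbackAlgebroid hG hL hp hP) where
  anchor _ _ := rfl
  bracket σ τ m n f α g β hσ hτ x := by
    let T := sectionsEquiv (pullbackEquiv hG hL hp hP) (contMDiff_pullbackEquiv hG hL hp hP)
      (contMDiff_pullbackEquiv_symm hG hL hp hP)
    have hυ := congrArg Subtype.val (LieAlgebroid.evalAt_transport_bracket
      (pullbackEquiv hG hL hp hP) (contMDiff_pullbackEquiv hG hL hp hP)
      (contMDiff_pullbackEquiv_symm hG hL hp hP) hL.isInvolutive.lieAlgebroid σ τ x)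
    have hvec := hL.isInvolutive.bracketFun_vec (T σ) (T τ)
    refine ⟨(congrArg Prod.fst hυ).trans
      (congrArg (fun W : SmoothVectorField E M => W x) hvec), ?_⟩
    let A : Fin m → SmoothVectorField E' N := fun i => ⟨_, P.smooth (α i).1⟩
    let B : Fin n → SmoothVectorField E' N := fun j => ⟨_, P.smooth (β j).1⟩
    have hX : ∀ y, mfderiv 𝓘(ℝ, E) 𝓘(ℝ, E') p y (GenSection.vec (T σ).1 y) =
        ∑ i, f i y • A i (p y) := fun y => by
      refine ((mem_pullbackFiber_iff hG).1 (σ.2 y)).symm.trans ?_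
      rw [hσ y, map_sum]
      simp only [map_smul]
      rfl
    have hY : ∀ y, mfderiv 𝓘(ℝ, E) 𝓘(ℝ, E') p y (GenSection.vec (T τ).1 y) =
        ∑ j, g j y • B j (p y) := fun y => by
      refine ((mem_pullbackFiber_iff hG).1 (τ.2 y)).symm.trans ?_
      rw [hτ y, map_sum]
      simp only [map_smul]
      rfl
    have hξ : ∀ y, GenSection.form (T σ).1 y =
        pullbackCovector p y (∑ i, f i y • (α i).1 (p y)) := fun y =>
      congrArg (pullbackCovector p y) (hσ y)
    have hη : ∀ y, GenSection.form (T τ).1 y =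
        pullbackCovector p y (∑ j, g j y • (β j).1 (p y)) := fun y =>
      congrArg (pullbackCovector p y) (hτ y)
    have hαβ : ∀ i j, contractHom (α i).1 (B j) = -contractHom (β j).1 (A i) := fun i j => by
      ext y
      exact P.skew y _ _
    -- Covectors on N are compared on a field V' by evaluating their pullbacks on a lift V, where
    -- `dorfmanForm_of_combination` applies.
    refine covector_ext_vectorField fun V' => ?_
    obtain ⟨V, hV⟩ := exists_isRelated hp.submersion V'
    have h1 := (hL.isInvolutive.bracketFun_form (T σ) (T τ) V).trans
      (dorfmanForm_of_combination hX hξ hY hη hαβ hV)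
    have h2 := congrArg (fun h : C^∞⟮𝓘(ℝ, E), M; ℝ⟯ => h x) h1
    have h3 := congrArg (fun w : GenTangent E x => (w.2 (V x) : ℝ)) hυ
    let υ : CotangentSpace E' (p x) := (((pullbackAlgebroid hG hL hp hP).bracket σ τ).1 x).2
    have h4 : (υ (V' (p x)) : ℝ) = _ := (congrArg υ (hV x).symm).trans (h3.trans h2)
    refine h4.trans ?_
    change _ = covectorEval (V' (p x)) (∑ i, ∑ j, (f i x * g j x) •
        ((cotangentAlgebroid hG).bracket (α i) (β j)).1 (p x) +
          ∑ j, lieD (fun y => (σ.1 y).1) (g j) x • (β j).1 (p x) -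
          ∑ i, lieD (fun y => (τ.1 y).1) (f i) x • (α i).1 (p x))
    simp only [map_add, map_sub, map_sum, map_smul]
    change (∑ i, ∑ j, f i * g j * pullbackFunction p
        (dorfmanForm (A i) (contractHom (α i).1) (B j) (contractHom (β j).1) V')) x +
      (∑ j, ⁅GenSection.vec (T σ).1, g j⁆ * pullbackFunction p (contractHom (β j).1 V')) x -
      (∑ i, ⁅GenSection.vec (T τ).1, f i⁆ * pullbackFunction p (contractHom (α i).1 V')) x = _
    simp only [sum_function_apply]
    congr 2
    refine Finset.sum_congr rfl fun i _ => Finset.sum_congr rfl fun j _ => ?_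
    have h5 := contractHom_cotangentAlgebroid_bracket hG (α i) (β j) V'
    rw [← h5]
    rfl

end PullbackEquiv

/-! ### Uniqueness of the pullback Lie algebroid -/

section Locality

variable {E : Type*} [NormedAddCommGroup E] [NormedSpace ℝ E]
  {M : Type*} [TopologicalSpace M] [ChartedSpace E M] [IsManifold 𝓘(ℝ, E) ∞ M]
  {F : Type*} [NormedAddCommGroup F] [NormedSpace ℝ F]
  {V : M → Type*} [TopologicalSpace (TotalSpace F V)]
  [∀ x, AddCommGroup (V x)] [∀ x, Module ℝ (V x)] [∀ x, TopologicalSpace (V x)]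
  [FiberBundle F V] [VectorBundle ℝ F V] {A : ∀ x : M, Submodule ℝ (V x)}

/-- The product of a section of a subbundle with a smooth function. -/
def smulSection (χ : C^∞⟮𝓘(ℝ, E), M; ℝ⟯) (σ : sections (E := E) F A) : sections (E := E) F A :=
  ⟨⟨fun x => χ x • σ.1 x, χ.contMDiff.smul_section σ.1.contMDiff⟩,
    fun x => (A x).smul_mem _ (σ.2 x)⟩

/-- Locality of the bracket: the Leibniz correction vanishes because χ is constant near x. Sections
may therefore be cut off before the bracket is computed. -/
theorem LieAlgebroid.evalAt_bracket_smulSection_right (𝓐 : LieAlgebroid E F A)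
    {χ : C^∞⟮𝓘(ℝ, E), M; ℝ⟯} {x : M} (hχ : ∀ᶠ y in 𝓝 x, χ y = 1)
    (σ τ : sections (E := E) F A) :
    evalAt (𝓐.bracket σ (smulSection χ τ)) x = evalAt (𝓐.bracket σ τ) x := by
  have h : (χ : M → ℝ) =ᶠ[𝓝 x] fun _ => (1 : ℝ) := hχ
  rw [𝓐.leibniz χ σ τ (smulSection χ τ) (fun _ => rfl) x, lieD_congr h, lieD_const, zero_smul,
    add_zero, hχ.self_of_nhds, one_smul]

theorem LieAlgebroid.evalAt_bracket_smulSection (𝓐 : LieAlgebroid E F A)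
    {χ : C^∞⟮𝓘(ℝ, E), M; ℝ⟯} {x : M} (hχ : ∀ᶠ y in 𝓝 x, χ y = 1)
    (σ τ : sections (E := E) F A) :
    evalAt (𝓐.bracket (smulSection χ σ) (smulSection χ τ)) x = evalAt (𝓐.bracket σ τ) x := by
  have hneg : ∀ υ υ' : sections (E := E) F A, -𝓐.bracket υ υ' = 𝓐.bracket υ' υ :=
    LinearMap.IsAlt.neg 𝓐.bracket_self
  have hev : ∀ υ : sections (E := E) F A, evalAt (-υ) x = -evalAt υ x := fun _ => rfl
  rw [𝓐.evalAt_bracket_smulSection_right hχ, ← hneg, hev,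
    𝓐.evalAt_bracket_smulSection_right hχ, ← hev, hneg]

end Locality

section Uniqueness

variable {E : Type*} [NormedAddCommGroup E] [NormedSpace ℝ E] [FiniteDimensional ℝ E]
  {M : Type*} [TopologicalSpace M] [ChartedSpace E M] [IsManifold 𝓘(ℝ, E) ∞ M] [T2Space M]
  {E' : Type*} [NormedAddCommGroup E'] [NormedSpace ℝ E'] [FiniteDimensional ℝ E']
  {N : Type*} [TopologicalSpace N] [ChartedSpace E' N] [IsManifold 𝓘(ℝ, E') ∞ N] [T2Space N]
  {p : C^∞⟮𝓘(ℝ, E), M; 𝓘(ℝ, E'), N⟯}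
  {𝓒 : LieAlgebroid E' (E' →L[ℝ] ℝ) (fun y : N => (⊤ : Submodule ℝ (CotangentSpace E' y)))}

/-- The differential of a function, as a section of the whole cotangent bundle. -/
def exactSection (f : C^∞⟮𝓘(ℝ, E), M; ℝ⟯) : sections (E := E) (E →L[ℝ] ℝ)
    (fun x : M => (⊤ : Submodule ℝ (CotangentSpace E x))) :=
  ⟨exactForm f, fun _ => trivial⟩

/-- The bracket formula needs covector parts that are finite sums of f ⊗ α on all of M. The cutoff
provides this with coefficients χ · ξ(Vᵢ ∘ p), which vanish where the frame is not valid. -/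
theorem exists_eq_sum_of_bump {g : Fin (Module.finrank ℝ E') → C^∞⟮𝓘(ℝ, E'), N; ℝ⟯}
    {V : Fin (Module.finrank ℝ E') → SmoothVectorField E' N} {χ : C^∞⟮𝓘(ℝ, E), M; ℝ⟯}
    (hχ : ∀ x ∈ tsupport χ, ∀ v : TangentSpace 𝓘(ℝ, E') (p x),
      ∑ i, (dForm (g i) (p x) v : ℝ) • V i (p x) = v)
    (σ : sections (E := E) (E × (E' →L[ℝ] ℝ)) (pullbackFiber p 𝓒)) :
    ∃ f : Fin (Module.finrank ℝ E') → C^∞⟮𝓘(ℝ, E), M; ℝ⟯, ∀ x,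
      ((smulSection χ σ).1 x).2 = ∑ i, f i x • (exactSection (g i)).1 (p x) := by
  let ξ : ∀ x, CotangentSpace E' (p x) := fun x => (σ.1 x).2
  have hξ : ∀ (x : M) (i : Fin (Module.finrank ℝ E')),
      ContMDiffAt 𝓘(ℝ, E) 𝓘(ℝ, ℝ) ∞ (fun x => (ξ x (V i (p x)) : ℝ)) x := fun x i =>
    contMDiffAt_covector_apply_along p ((contMDiffAt_pullback_section_iff p).1
      (contMDiffAt_prod_section.1 (σ.1.contMDiff x)).2) (((V i).contMDiff.comp p.contMDiff) x)
  refine ⟨fun i => χ * ⟨fun x => (ξ x (V i (p x)) : ℝ), fun x => hξ x i⟩, fun x => ?_⟩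
  have h1 : χ x • ξ x = ∑ i, (χ x * (ξ x (V i (p x)) : ℝ)) •
      (dForm (g i) (p x) : CotangentSpace E' (p x)) := by
    refine covector_ext fun v => ?_
    rw [sum_covector_apply]
    change χ x * (ξ x v : ℝ) = _
    by_cases hx : x ∈ tsupport χ
    · conv_lhs => rw [← hχ x hx v, covector_apply_eq_sum, Finset.mul_sum]
      exact Finset.sum_congr rfl fun i _ => by ring
    · rw [image_eq_zero_of_notMem_tsupport hx]
      simp
  exact h1

theorem exists_frame_bump (p : C^∞⟮𝓘(ℝ, E), M; 𝓘(ℝ, E'), N⟯) (x₀ : M) :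
    ∃ (g : Fin (Module.finrank ℝ E') → C^∞⟮𝓘(ℝ, E'), N; ℝ⟯)
      (V : Fin (Module.finrank ℝ E') → SmoothVectorField E' N) (χ : C^∞⟮𝓘(ℝ, E), M; ℝ⟯),
      (∀ᶠ x in 𝓝 x₀, χ x = 1) ∧ ∀ x ∈ tsupport χ, ∀ v : TangentSpace 𝓘(ℝ, E') (p x),
        ∑ i, (dForm (g i) (p x) v : ℝ) • V i (p x) = v := by
  obtain ⟨g, V, hgV⟩ := exists_coordinate_frame (E := E') (p x₀)
  obtain ⟨χ, h1, h2⟩ := exists_bump (E := E) (p.contMDiff.continuous.continuousAt.eventually hgV)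
  exact ⟨g, V, χ, h1, fun x hx => (h2 hx).1⟩

-- By locality both sections may be cut off near x. They then have the form to which the prescribed
-- formula applies, and both brackets are given by the same expression.
set_option maxHeartbeats 1000000 in
theorem IsPullbackAlgebroid.bracket_eq
    {𝓑 𝓑' : LieAlgebroid E (E × (E' →L[ℝ] ℝ)) (pullbackFiber p 𝓒)}
    (h : IsPullbackAlgebroid p 𝓒 𝓑) (h' : IsPullbackAlgebroid p 𝓒 𝓑')
    (σ τ : sections (E := E) (E × (E' →L[ℝ] ℝ)) (pullbackFiber p 𝓒)) (x : M) :
    evalAt (𝓑.bracket σ τ) x = evalAt (𝓑'.bracket σ τ) x := by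
  obtain ⟨g, V, χ, h1, hχ⟩ := exists_frame_bump p x
  refine (𝓑.evalAt_bracket_smulSection h1 σ τ).symm.trans
    (Eq.trans ?_ (𝓑'.evalAt_bracket_smulSection h1 σ τ))
  obtain ⟨f, hf⟩ := exists_eq_sum_of_bump hχ σ
  obtain ⟨k, hk⟩ := exists_eq_sum_of_bump hχ τ
  have e := h.bracket (smulSection χ σ) (smulSection χ τ) _ _ f (fun i => exactSection (g i)) k
    (fun i => exactSection (g i)) hf hk x
  have e' := h'.bracket (smulSection χ σ) (smulSection χ τ) _ _ f (fun i => exactSection (g i)) k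
    (fun i => exactSection (g i)) hf hk x
  refine Subtype.ext (Prod.ext (e.1.trans e'.1.symm) ?_)
  exact e.2.trans e'.2.symm

end Uniqueness

/-! ### The isomorphism for an arbitrary pullback structure -/

section Isomorphism

variable {E : Type*} [NormedAddCommGroup E] [NormedSpace ℝ E] [FiniteDimensional ℝ E]
  {M : Type*} [TopologicalSpace M] [ChartedSpace E M] [IsManifold 𝓘(ℝ, E) ∞ M] [T2Space M]
  [SigmaCompactSpace M]
  {E' : Type*} [NormedAddCommGroup E'] [NormedSpace ℝ E'] [FiniteDimensional ℝ E']
  {N : Type*} [TopologicalSpace N] [ChartedSpace E' N] [IsManifold 𝓘(ℝ, E') ∞ N] [T2Space N]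
  {L : ∀ x : M, Submodule ℝ (GenTangent E x)} {p : C^∞⟮𝓘(ℝ, E), M; 𝓘(ℝ, E'), N⟯}
  {P : PoissonBivector E' N} (hG : IsInvolutive (sharpGraph P.sharp))
  (hL : IsDirac L) (hp : IsReducible L p)
  (hP : ∀ x (v : TangentSpace 𝓘(ℝ, E) x) (ξ : CotangentSpace E' (p x)),
    ((v, pullbackCovector p x ξ) : GenTangent E x) ∈ L x ↔
      mfderiv 𝓘(ℝ, E) 𝓘(ℝ, E') p x v = P.sharp (p x) ξ)

/-- The isomorphism `(X, α) ↦ X + p^*α` of Lie algebroids from `p^{!!}T*N` onto `L`. -/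
def pullbackIso
    {𝓑 : LieAlgebroid E (E × (E' →L[ℝ] ℝ)) (pullbackFiber p (cotangentAlgebroid hG))}
    (h : IsPullbackAlgebroid p (cotangentAlgebroid hG) 𝓑) :
    LieAlgebroid.Iso 𝓑 hL.isInvolutive.lieAlgebroid where
  toEquiv := pullbackEquiv hG hL hp hP
  smooth := contMDiff_pullbackEquiv hG hL hp hP
  smooth_symm := contMDiff_pullbackEquiv_symm hG hL hp hP
  anchor x w := (h.anchor x w).symm
  bracket σ τ σ' τ' hσ hτ x := by
    rw [h.bracket_eq (isPullbackAlgebroid_pullbackAlgebroid hG hL hp hP) σ τ x]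
    have hσ' : σ' = sectionsEquiv (pullbackEquiv hG hL hp hP) (contMDiff_pullbackEquiv hG hL hp hP)
      (contMDiff_pullbackEquiv_symm hG hL hp hP) σ := evalAt_injective hσ
    have hτ' : τ' = sectionsEquiv (pullbackEquiv hG hL hp hP) (contMDiff_pullbackEquiv hG hL hp hP)
      (contMDiff_pullbackEquiv_symm hG hL hp hP) τ := evalAt_injective hτ
    rw [hσ', hτ']
    exact (LieAlgebroid.evalAt_transport_bracket (pullbackEquiv hG hL hp hP)
      (contMDiff_pullbackEquiv hG hL hp hP) (contMDiff_pullbackEquiv_symm hG hL hp hP)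
      hL.isInvolutive.lieAlgebroid σ τ x).symm

end Isomorphism

end DiracGeometry

end

theorem mainTheorem3
    {E : Type*} [NormedAddCommGroup E] [NormedSpace ℝ E] [FiniteDimensional ℝ E]
    {M : Type*} [TopologicalSpace M] [ChartedSpace E M] [IsManifold 𝓘(ℝ, E) ∞ M]
    [T2Space M] [SecondCountableTopology M]
    {E' : Type*} [NormedAddCommGroup E'] [NormedSpace ℝ E'] [FiniteDimensional ℝ E']
    {N : Type*} [TopologicalSpace N] [ChartedSpace E' N] [IsManifold 𝓘(ℝ, E') ∞ N]
    [T2Space N] [SecondCountableTopology N]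
    (L : ∀ x : M, Submodule ℝ (DiracGeometry.GenTangent E x))
    (hL : DiracGeometry.IsDirac L)
    (p : C^∞⟮𝓘(ℝ, E), M; 𝓘(ℝ, E'), N⟯)
    (hp : DiracGeometry.IsReducible L p) :
    ∃ P : DiracGeometry.PoissonBivector E' N,
      DiracGeometry.IsInducedPoisson L p P ∧
      (∀ P', DiracGeometry.IsInducedPoisson L p P' → P' = P) ∧
      ∃ (𝓒 : DiracGeometry.LieAlgebroid E' (E' →L[ℝ] ℝ)
            (fun y : N => (⊤ : Submodule ℝ (DiracGeometry.CotangentSpace E' y))))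
        (𝓛 : DiracGeometry.LieAlgebroid E (E × (E →L[ℝ] ℝ)) L),
        DiracGeometry.IsCotangentAlgebroid P 𝓒 ∧
        DiracGeometry.IsDiracAlgebroid 𝓛 ∧
        (∃ 𝓑, DiracGeometry.IsPullbackAlgebroid p 𝓒 𝓑) ∧
        ∀ 𝓑, DiracGeometry.IsPullbackAlgebroid p 𝓒 𝓑 →
          ∃ Ψ : DiracGeometry.LieAlgebroid.Iso 𝓑 𝓛,
            ∀ x (w : DiracGeometry.pullbackFiber p 𝓒 x),
              ((Ψ.toEquiv x w : L x) : DiracGeometry.GenTangent E x) =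
                (w.1.1, DiracGeometry.pullbackCovector p x w.1.2) := by
  -- Together with second countability this gives σ-compactness, needed for the partitions of unity.
  have : LocallyCompactSpace M := ChartedSpace.locallyCompactSpace E M
  obtain ⟨P, hG, hP⟩ := hp.exists_poisson hL
  exact ⟨P, hp.isInducedPoisson hL hP, fun P' hP' => hp.inducedPoisson_unique hP hP',
    DiracGeometry.cotangentAlgebroid hG, hL.isInvolutive.lieAlgebroid,
    DiracGeometry.isCotangentAlgebroid_cotangentAlgebroid hG,
    hL.isInvolutive.isDiracAlgebroid_lieAlgebroid,
    ⟨_, DiracGeometry.isPullbackAlgebroid_pullbackAlgebroid hG hL hp hP⟩,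
    fun 𝓑 h𝓑 => ⟨DiracGeometry.pullbackIso hG hL hp hP h𝓑, fun _ _ => rfl⟩⟩
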